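/- **Setting.** Let $N\ge 2$ be even and let $a_1,\dots,a_N$ be fermionic annihilation operators on the $2^N$-dimensional Fock space, extended by the anti-periodic boundary condition $a_{j+N}=-a_j$. Let $\kappa:\mathbb R\to\mathbb R$ be a decay law, put $\kappa^{(N)}_l=\kappa(\min(l,N-l))$ for $1\le l\le N-1$, and for real couplings $p=(J,\mu,\Delta)$ let $$H(p)=-\frac J2\sum_{j=1}^N(a_j^\dagger a_{j+1}+a_{j+1}^\dagger a_j)-\mu\sum_{j=1}^N\Big(a_j^\dagger a_j-\frac12\Big)+\frac\Delta2\sum_{j=1}^{N-1}\sum_{l=1}^{N-j}\kappa^{(N)}_l\,(a_ja_{j+l}+a_{j+l}^\dagger a_j^\dagger).$$ Let $\theta\in\{J,\mu,\Delta\}$ be the parameter to be estimated and $T>0$ the probe time. A $\theta$-independent control Hamiltonian of the same form, with couplings $q=(J_c,\mu_c,\Delta_c)$, is added: $H_{\rm tot}=H(p)+H(q)$ ($q=0$: no control; otherwise: imperfect control). The generator is $G_\theta=\int_0^T e^{iH_{\rm tot}\tau}\,\partial_\theta H\,e^{-iH_{\rm tot}\tau}\,d\tau$, and the quantum Fisher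 information is $I(\theta)=\sup_\psi 4\,\mathrm{Var}_\psi[G_\theta]$ over normalized states $\psi$. Under optimal control it is $I_0(\theta)=\big(\int_0^T(\chi_{\max}-\chi_{\min})\,d\tau\big)^2$, where $\chi_{\max},\chi_{\min}$ are the extreme eigenvalues of $\partial_\theta H$. Write $(\bar J,\bar\mu,\bar\Delta)=p+q$ for the residual couplings and **assume $\bar\Delta\ne0$**. For $k=(2n+1)\pi/N$, $0\le n<N$, let $$f(k)=2\sum_{l=1}^{N/2-1}\kappa(l)\sin(kl)+\kappa(N/2)\sin(kN/2),\qquad \epsilon(k)=\sqrt{[\bar\Delta f(k)/2]^2+(\bar J\cos k+\bar\mu)^2},$$ $$\sin\phi=-\frac{\bar\Delta f}{2\epsilon},\quad \cos\phi=-\frac{\bar J\cos k+\bar\mu}{\epsilon},\quad \xi_\theta=\frac{\partial_\theta\cos\phi}{\sin\phi}\ \ (\text{read as }0\text{ where }f(k)=0),$$ $$\mathscr E_\theta(k)=\Big\{T^2[\partial_\theta\epsilon]^2+\tfrac14\xi_\theta^2\sin^2(2\epsilon T)+\tfrac14\xi_\theta^2\big(1-\cos(2\epsilon T)\big)^2\Big\}^{1/2},$$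 where $\partial_\theta$ is the derivative in the residual coupling $\theta$. **Theorem.** Let $p,q$ be fixed with $\bar\Delta\neq 0$. 1. If $\epsilon(k)\ne0$ for all momenta $k$ of the chain, then for each $\theta\in\{J,\mu,\Delta\}$ there are fermionic modes $\psi_\theta(k)$, obtained from the $a_j$ by a Bogoliubov transformation, with $G_\theta=\sum_k\mathscr E_\theta(k)\big(\psi_\theta^\dagger(k)\psi_\theta(k)-\frac12\big)$; the supremum defining $I(\theta)$ is attained, and $$I(\theta)=\Big[\sum_k\mathscr E_\theta(k)\Big]^2 .$$ 2. Wherever $\epsilon(k)\neq0$ (here and in 3 and 5 for any real $k$): $\partial_J\epsilon=\cos k\,(\bar J\cos k+\bar\mu)/\epsilon$, $\partial_\mu\epsilon=(\bar J\cos k+\bar\mu)/\epsilon$, $\partial_\Delta\epsilon=\bar\Delta f^2/(4\epsilon)$, $\xi_J=\bar\Delta f\cos k/(2\epsilon^2)$, $\xi_\mu=\bar\Delta f/(2\epsilon^2)$, $\xi_\Delta=-(\bar J\cos k+\bar\mu)f/(2\epsilon^2)$. 3. Wherever $\epsilon(k)\ne0$: $\mathscr E_J(k)\le T|\cos k|$,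 $\mathscr E_\mu(k)\le T$ (no divergence), and $\mathscr E_\Delta(k)\le T|f(k)|/2$. 4. (Heisenberg scaling for $J$ and $\mu$.) Suppose that for some integer $Q\ge0$, up to finitely many joints, $\kappa$ is $C^{2Q+1}$ on $(1,\infty)$ with bounded derivatives of orders $0,\dots,2Q$, and that $\kappa^{(2Q+1)}$ is integrable on $(1,\infty)$. Then for $\theta\in\{J,\mu\}$ and fixed $T$, as $N\to\infty$ through even integers, $I(\theta)=\Theta(N^2)$ and $I(\theta)=\Theta(I_0(\theta))$. 5. (The divergence of $\mathscr E_\Delta$ is that of $f$.) As $|f(k)|\to\infty$, in particular whenever $f$ diverges as $k\to0$ and $N\to\infty$, $$\xi_\Delta(k)\to0,\qquad \frac{\partial_\Delta\epsilon(k)}{|f(k)|}\to\frac{\operatorname{sgn}\bar\Delta}2,\qquad \frac{\mathscr E_\Delta(k)}{|f(k)|}\to\frac T2 ,$$ for each fixed $T$, uniformly in $k$, $N$ and $\kappa$. 6. (Control only improves the prefactor.) For every $\theta$, every even $N\ge2$ and every $\kappa$, $I(\theta)\le I_0(\theta)$. Moreover there is a constant $c>0$, depending only on $p$ and $q$, such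 that for every $T>0$, every even $N\geq 2$ and every $\kappa$ with $\kappa(1)=1$, $$c\,I_0(\Delta)\le I(\Delta)\le I_0(\Delta),$$ so $I(\Delta)$ has the same scaling in $N$ as $I_0(\Delta)$. -/

import Mathlib

open Real Filter Asymptotics
open scoped Matrix

noncomputable section

namespace LRK

/-- The three couplings of the chain: tunnelling `J`, chemical potential `mu`, pairing `Delta`.
The estimation parameter is one of them. -/
inductive Coupling where
  | J | mu | Delta
  deriving DecidableEq

open Coupling

/-- Operators on the Fock space of `N` fermionic modes, as matrices in the occupation basis;
a basis vector is labelled by its set of occupied modes. -/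
abbrev Op (N : ℕ) : Type := Matrix (Finset (Fin N)) (Finset (Fin N)) ℂ

/-- The annihilation operator of the mode `j`:
`|s⟩ ↦ (-1)^{#{i ∈ s, i < j}} |s \ {j}⟩` if `j ∈ s`, and `|s⟩ ↦ 0` otherwise. -/
def annih {N : ℕ} (j : Fin N) : Op N :=
  Matrix.of fun t s =>
    if j ∈ s ∧ t = s.erase j then (-1 : ℂ) ^ (s.filter (fun i => i < j)).card else 0

/-- The site operator `a_j`, for all `j`, under the anti-periodic boundary condition
`a_{j+N} = -a_j`. -/
def site (N j : ℕ) : Op N :=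
  if h : 0 < N then (-1 : ℂ) ^ (j / N) • annih ⟨j % N, Nat.mod_lt j h⟩ else 0

/-- The pairing profile on a chain of `N` sites with decay law `κ`: it equals `κ l` for
`1 ≤ l ≤ N / 2` and is symmetric under `l ↦ N - l`. -/
def pairing (κ : ℝ → ℝ) (N l : ℕ) : ℝ := κ ((min l (N - l) : ℕ) : ℝ)

/-- The long-range Kitaev Hamiltonian with couplings `p`. -/
def hamiltonian (κ : ℝ → ℝ) (N : ℕ) (p : Coupling → ℝ) : Op N :=
  -((p J / 2) • ∑ j ∈ Finset.Icc 1 N,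
      ((site N j)ᴴ * site N (j + 1) + (site N (j + 1))ᴴ * site N j))
  - p mu • ∑ j ∈ Finset.Icc 1 N, ((site N j)ᴴ * site N j - (1 / 2 : ℝ) • (1 : Op N))
  + (p Delta / 2) • ∑ j ∈ Finset.Icc 1 (N - 1), ∑ l ∈ Finset.Icc 1 (N - j),
      pairing κ N l • (site N j * site N (j + l) + (site N (j + l))ᴴ * (site N j)ᴴ)

/-! ### Quantum Fisher information -/

/-- The partial derivative of a scalar function of the couplings. -/
def partialDeriv (θ : Coupling) (F : (Coupling → ℝ) → ℝ) (p : Coupling → ℝ) : ℝ :=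
  deriv (fun t => F (Function.update p θ t)) (p θ)

/-- The (entrywise) partial derivative of an operator depending on the couplings. -/
def opDeriv {N : ℕ} (θ : Coupling) (K : (Coupling → ℝ) → Op N) (p : Coupling → ℝ) : Op N :=
  Matrix.of fun s t => deriv (fun x => K (Function.update p θ x) s t) (p θ)

/-- The evolution operator `exp (-i τ H)`. -/
def evolution {N : ℕ} (H : Op N) (τ : ℝ) : Op N := NormedSpace.exp ((-(Complex.I * τ)) • H)

/-- The generator `∫_0^T U(τ)† (∂_θ K) U(τ) dτ` for a time-independent Hamiltonian `K`,
with `U(τ) = exp (-i τ K)`; the integral is taken entrywise. -/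
def generator {N : ℕ} (θ : Coupling) (K : (Coupling → ℝ) → Op N) (T : ℝ)
    (p : Coupling → ℝ) : Op N :=
  Matrix.of fun s t =>
    ∫ τ in (0 : ℝ)..T, ((evolution (K p) τ)ᴴ * opDeriv θ K p * evolution (K p) τ) s t

/-- The expectation value `⟨ψ|A|ψ⟩` of a Hermitian operator. -/
def expect {N : ℕ} (A : Op N) (ψ : Finset (Fin N) → ℂ) : ℝ := (star ψ ⬝ᵥ (A *ᵥ ψ)).re

/-- The variance of `A` in the state `ψ`. -/
def variance {N : ℕ} (A : Op N) (ψ : Finset (Fin N) → ℂ) : ℝ :=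
  expect (A * A) ψ - expect A ψ ^ 2

/-- The values `4 Var[G]` over all normalized initial states. -/
def fisherValues {N : ℕ} (G : Op N) : Set ℝ :=
  {x | ∃ ψ : Finset (Fin N) → ℂ, star ψ ⬝ᵥ ψ = 1 ∧ x = 4 * variance G ψ}

/-- The generator for the estimation of `θ` in the chain with couplings `p`, subject to the
`θ`-independent control Hamiltonian of the same form with couplings `q`, which is added to
the Hamiltonian of the chain (`q = 0`: no control). -/
def chainGenerator (κ : ℝ → ℝ) (N : ℕ) (T : ℝ) (p q : Coupling → ℝ) (θ : Coupling) : Op N :=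
  generator θ (fun p' => hamiltonian κ N p' + hamiltonian κ N q) T p

/-- The quantum Fisher information `I(θ)`, maximized over initial states. -/
def qfi (κ : ℝ → ℝ) (N : ℕ) (T : ℝ) (p q : Coupling → ℝ) (θ : Coupling) : ℝ :=
  sSup (fisherValues (chainGenerator κ N T p q θ))

/-- The difference between the largest and the smallest eigenvalue of a Hermitian operator. -/
def spread {N : ℕ} (A : Op N) : ℝ := sSup (spectrum ℝ A) - sInf (spectrum ℝ A)

/-- The quantum Fisher information `I₀(θ)` under optimal control,
`(∫_0^T (χ_max - χ_min) dτ)²`, where `χ_max`, `χ_min` are the extreme eigenvalues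
of `∂_θ H` (which does not depend on time). -/
def optimalQFI (κ : ℝ → ℝ) (N : ℕ) (T : ℝ) (p : Coupling → ℝ) (θ : Coupling) : ℝ :=
  (∫ _τ in (0 : ℝ)..T, spread (opDeriv θ (hamiltonian κ N) p)) ^ 2

/-! ### The spectrum -/

/-- The momenta `k = (2 n + 1) π / N`, `n = 0, …, N - 1`. -/
def momentum (N n : ℕ) : ℝ := (2 * n + 1) * π / N

/-- The sine transform `f(k)` of the pairing profile. -/
def pairingTransform (κ : ℝ → ℝ) (N : ℕ) (k : ℝ) : ℝ :=
  2 * ∑ l ∈ Finset.Ico 1 (N / 2), κ l * sin (k * l)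
    + κ ((N / 2 : ℕ) : ℝ) * sin (k * (N / 2 : ℕ))

/-- The quasi-particle energy. -/
def energy (κ : ℝ → ℝ) (N : ℕ) (k : ℝ) (p : Coupling → ℝ) : ℝ :=
  √((p Delta * pairingTransform κ N k / 2) ^ 2 + (p J * cos k + p mu) ^ 2)

/-- The sine of the Bogoliubov angle. -/
def sinPhi (κ : ℝ → ℝ) (N : ℕ) (k : ℝ) (p : Coupling → ℝ) : ℝ :=
  -(p Delta * pairingTransform κ N k) / (2 * energy κ N k p)

/-- The cosine of the Bogoliubov angle. -/
def cosPhi (κ : ℝ → ℝ) (N : ℕ) (k : ℝ) (p : Coupling → ℝ) : ℝ :=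
  -(p J * cos k + p mu) / energy κ N k p

/-- `ξ_θ(k) = ∂_θ cos φ / sin φ`. Where `f(k) = 0`, `cos φ` is locally constant and the
value is `0`. -/
def xi (κ : ℝ → ℝ) (N : ℕ) (k : ℝ) (p : Coupling → ℝ) (θ : Coupling) : ℝ :=
  partialDeriv θ (cosPhi κ N k) p / sinPhi κ N k p

/-- The single-mode spectrum `𝓔_θ(k)` of the generator. -/
def genSpectrum (κ : ℝ → ℝ) (N : ℕ) (T k : ℝ) (p : Coupling → ℝ) (θ : Coupling) : ℝ :=
  √(T ^ 2 * partialDeriv θ (energy κ N k) p ^ 2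
    + 1 / 4 * xi κ N k p θ ^ 2 * sin (2 * energy κ N k p * T) ^ 2
    + 1 / 4 * xi κ N k p θ ^ 2 * (1 - cos (2 * energy κ N k p * T)) ^ 2)

/-- `ψ` is a family of fermionic modes obtained from the site operators by a Bogoliubov
transformation: each `ψ n` is a linear combination of the `a_j` and `a_j†`, and the canonical
anticommutation relations hold. -/
def IsBogoliubov {N : ℕ} (ψ : Fin N → Op N) : Prop :=
  (∃ u v : Fin N → Fin N → ℂ,
    ∀ n, ψ n = ∑ j, (u n j • annih j + v n j • (annih j)ᴴ)) ∧
  (∀ m n, ψ m * ψ n + ψ n * ψ m = 0) ∧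
  (∀ m n, ψ m * (ψ n)ᴴ + (ψ n)ᴴ * ψ m = if m = n then 1 else 0)

/-- The regularity condition on the decay law: up to finitely many joints `κ` is smooth enough on
`(1, ∞)`, its derivatives of order at most `2 Q` are bounded, and the derivative of
order `2 Q + 1` is integrable. -/
def RegularDecay (κ : ℝ → ℝ) : Prop :=
  ∃ (Q : ℕ) (B : Set ℝ), B.Finite ∧
    ContDiffOn ℝ (2 * Q + 1 : ℕ) κ (Set.Ioi 1 \ B) ∧
    (∀ q ≤ 2 * Q, ∃ C : ℝ, ∀ x ∈ Set.Ioi (1 : ℝ) \ B, |iteratedDeriv q κ x| ≤ C) ∧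
    MeasureTheory.IntegrableOn (iteratedDeriv (2 * Q + 1) κ) (Set.Ioi 1)

end LRK

end

open LRK LRK.Coupling

/-!
The Hamiltonian couples, in Fourier modes, only opposite momenta `k` and `-k`, so each such pair
carries a pseudo-spin: the Hamiltonian is a sum of pseudo-spins with components
`A = J cos k + μ` along one axis and `B = Δ f(k) / 2` along another (`hamiltonian_eq_quad`). The
commutator of two such quadratic operators is the vector product of their pseudo-spins
(`quad_commutator`). Hence the Heisenberg evolution rotates the pseudo-spin `v = (a, b)` of `∂_θ H`
about `(A, B)`, and the generator is the quadratic operator whose pseudo-spins are the time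
integrals of the rotating vectors (`integral_heisenberg_quad`). This requires no assumption on the
energy `√(A² + B²)`; where it does not vanish, the length of the integrated vector is the spectrum
`genSpectrum` (`genSpectrum_eq_modeNorm`).

A Bogoliubov transformation turns any such operator into `∑ E (ψ† ψ - 1/2)`, where `E` are the
lengths of its pseudo-spins (`exists_bogoliubov_quad`). Filling or emptying all modes gives the
extreme eigenvalues `± ∑ E / 2`, and their equal superposition has the largest variance, so the
quantum Fisher information is `(∑ E)²` (`IsCAR.isGreatest_fisherValues`). Applied to the generator
and to `∂_θ H`, this reduces the comparison of `I` and `I₀` to comparing the length of an averaged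
rotating vector with `T` times its length: averaging never lengthens it (`rotNorm_le`), keeps its
component along the axis (`le_rotNorm`), and keeps half of its length if it turns by at most one
radian (`half_le_rotNorm`).

For `Δ` the component along the axis is of relative size `|B| / √(A² + B²)`. Since the first
Fourier coefficient of `f` is `κ 1 = 1`, the sum of `|f|` over the momenta is at least `N`, so `A`
costs only a constant factor (`exists_mul_optimalQFI_le`).

For `J` and `μ` the momenta near `π` suffice. There `f` is small, uniformly in `N`
(`RegularDecay.exists_abs_pairingTransform_le`): the integrability of a derivative of `κ` makes a
finite difference of `κ` on the integers summable, boundedness of `κ` then forces the first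
differences to zero, and repeated summation by parts controls the alternating sum near `k = π`. With
a weak pairing either the rotation is slow or its axis is nearly parallel to `v`, and in both cases
half of the length survives (`half_le_rotNorm_of_weak_pairing`).
-/

namespace LRK

/-! ### The anticommutation relations of the site operators -/

/-- The sign with which the mode `j` acts on the occupied set `s`: the parity of the occupied
modes before `j`. -/
def carSign {N : ℕ} (j : Fin N) (s : Finset (Fin N)) : ℂ :=
  (-1) ^ (s.filter (fun i => i < j)).card

lemma carSign_mul_self {N : ℕ} (j : Fin N) (s : Finset (Fin N)) :
    carSign j s * carSign j s = 1 := by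
  unfold carSign
  rw [← mul_pow]; simp

lemma star_carSign {N : ℕ} (j : Fin N) (s : Finset (Fin N)) :
    star (carSign j s) = carSign j s := by
  simp [carSign]

lemma carSign_erase {N : ℕ} (i j : Fin N) (s : Finset (Fin N)) (hj : j ∈ s) :
    carSign i (s.erase j) = (if j < i then -1 else 1) * carSign i s := by
  unfold carSign
  rw [Finset.filter_erase]
  split_ifs with h
  · have : j ∈ s.filter (fun x => x < i) := by simp [hj, h]
    rw [← Finset.card_erase_add_one this, pow_succ]; ring
  · rw [Finset.erase_eq_of_notMem (by simp [h])]; ring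

lemma annih_apply {N : ℕ} (j : Fin N) (t s : Finset (Fin N)) :
    annih j t s = if j ∈ s ∧ t = s.erase j then carSign j s else 0 := rfl

lemma annih_conjTranspose_apply {N : ℕ} (j : Fin N) (t s : Finset (Fin N)) :
    (annih j)ᴴ t s = if j ∈ t ∧ s = t.erase j then carSign j t else 0 := by
  rw [Matrix.conjTranspose_apply, annih_apply]
  split_ifs
  · exact star_carSign j t
  · simp

lemma annih_mul_annih_apply {N : ℕ} (i j : Fin N) (t s : Finset (Fin N)) :
    (annih i * annih j) t s = if j ∈ s ∧ i ∈ s.erase j ∧ t = (s.erase j).erase i then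
      carSign i (s.erase j) * carSign j s else 0 := by
  rw [Matrix.mul_apply, Finset.sum_eq_single (s.erase j)]
  · simp only [annih_apply]
    split_ifs <;> simp_all
  · intro r _ hr
    simp [annih_apply, hr]
  · simp

/-- Annihilation operators anticommute. -/
lemma annih_anticomm {N : ℕ} (i j : Fin N) : annih i * annih j + annih j * annih i = 0 := by
  ext t s
  rw [Matrix.add_apply, annih_mul_annih_apply, annih_mul_annih_apply]
  by_cases hij : i = j
  · subst hij; simp
  by_cases hi : i ∈ s
  · by_cases hj : j ∈ s
    · rw [Finset.erase_right_comm (a := j) (b := i)]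
      by_cases ht : t = (s.erase i).erase j
      · have hji : j ≠ i := fun h => hij h.symm
        simp only [Finset.mem_erase, hi, hj, ht, hij, hji, ne_eq, not_false_eq_true, and_self,
          if_true, Matrix.zero_apply]
        rw [carSign_erase _ _ _ hj, carSign_erase _ _ _ hi]
        rcases lt_or_gt_of_ne hij with h | h
        · simp [h, h.not_gt]; ring
        · simp [h, h.not_gt]; ring
      · simp [ht]
    · simp [hj]
  · simp [hi]

lemma annih_mul_conjTranspose_apply {N : ℕ} (i j : Fin N) (t s : Finset (Fin N)) :
    (annih i * (annih j)ᴴ) t s = if j ∉ s ∧ i ∈ insert j s ∧ t = (insert j s).erase i then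
      carSign i (insert j s) * carSign j (insert j s) else 0 := by
  rw [Matrix.mul_apply, Finset.sum_eq_single (insert j s)]
  · simp only [annih_apply, annih_conjTranspose_apply]
    by_cases hj : j ∈ s
    · have : ¬ (j ∈ insert j s ∧ s = (insert j s).erase j) := by
        rintro ⟨_, h⟩
        rw [h] at hj
        simp at hj
      rw [if_neg this]; simp [hj]
    · simp [hj, Finset.erase_insert hj]
  · intro r _ hr
    have : ¬ (j ∈ r ∧ s = r.erase j) := by
      rintro ⟨h, h'⟩
      exact hr (by rw [h', Finset.insert_erase h])
    rw [annih_conjTranspose_apply, if_neg this, mul_zero]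
  · simp

lemma conjTranspose_mul_annih_apply {N : ℕ} (i j : Fin N) (t s : Finset (Fin N)) :
    ((annih j)ᴴ * annih i) t s = if i ∈ s ∧ j ∉ s.erase i ∧ t = insert j (s.erase i) then
      carSign j (insert j (s.erase i)) * carSign i s else 0 := by
  rw [Matrix.mul_apply, Finset.sum_eq_single (s.erase i)]
  · rw [annih_apply, annih_conjTranspose_apply]
    by_cases hi : i ∈ s
    · by_cases hj : j ∈ s.erase i
      · have : ¬ (j ∈ t ∧ s.erase i = t.erase j) := by
          rintro ⟨_, h⟩
          rw [h] at hj
          simp at hj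
        simp [this, hj]
      · by_cases ht : t = insert j (s.erase i)
        · rw [if_pos ⟨by rw [ht]; simp, by rw [ht, Finset.erase_insert hj]⟩,
            if_pos ⟨hi, rfl⟩, if_pos ⟨hi, hj, ht⟩, ht]
        · have : ¬ (j ∈ t ∧ s.erase i = t.erase j) := by
            rintro ⟨h, h'⟩
            exact ht (by rw [h', Finset.insert_erase h])
          rw [if_neg this, zero_mul, if_neg (fun h => ht h.2.2)]
    · simp [hi]
  · intro r _ hr
    simp [annih_apply, hr]
  · simp

/-- An annihilation and a creation operator anticommute to the Kronecker delta. -/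
lemma annih_anticomm_conjTranspose {N : ℕ} (i j : Fin N) :
    annih i * (annih j)ᴴ + (annih j)ᴴ * annih i = if i = j then 1 else 0 := by
  ext t s
  rw [Matrix.add_apply, annih_mul_conjTranspose_apply, conjTranspose_mul_annih_apply]
  by_cases hij : i = j
  · subst hij
    by_cases hi : i ∈ s
    · by_cases hts : t = s
      · simp [hi, hts, Finset.insert_erase, carSign_mul_self, Matrix.one_apply]
      · simp [hi, hts, Finset.insert_erase]
    · by_cases hts : t = s
      · simp [hi, hts, carSign_mul_self, Matrix.one_apply]
      · simp [hi, hts]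
  · have hji : j ≠ i := fun h => hij h.symm
    by_cases hi : i ∈ s
    · by_cases hj : j ∈ s
      · simp [hi, hj, hij, hji]
      · have e : (insert j s).erase i = insert j (s.erase i) :=
          Finset.erase_insert_of_ne hji
        by_cases ht : t = insert j (s.erase i)
        · have h1 := carSign_erase i j (insert j s) (by simp)
          rw [Finset.erase_insert hj] at h1
          have h2 := carSign_erase j i (insert j s) (by simp [hi])
          rw [e] at h2
          simp only [Finset.mem_insert, Finset.mem_erase, e, hi, hj, ht, hij, hji, ne_eq,
            not_false_eq_true, and_self, and_false, or_true, if_true, h1, h2]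
          rcases lt_or_gt_of_ne hij with h | h
          · simp [h, h.not_gt]; ring
          · simp [h, h.not_gt]; ring
        · simp [ht, e, hij]
    · simp [hi, hij]

/-! ### Field operators -/

/-- The field operator `∑ⱼ (uⱼ aⱼ + vⱼ aⱼ†)`. -/
def field {N : ℕ} (u v : Fin N → ℂ) : Op N := ∑ j, (u j • annih j + v j • (annih j)ᴴ)

lemma field_anticomm {N : ℕ} (u v u' v' : Fin N → ℂ) :
    field u v * field u' v' + field u' v' * field u v =
      (∑ j, (u j * v' j + v j * u' j)) • (1 : Op N) := by
  have h4 (i j : Fin N) : (annih i)ᴴ * (annih j)ᴴ + (annih j)ᴴ * (annih i)ᴴ = 0 := by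
    rw [← Matrix.conjTranspose_mul, ← Matrix.conjTranspose_mul, ← Matrix.conjTranspose_add,
      annih_anticomm, Matrix.conjTranspose_zero]
  have key (i j : Fin N) : (u i • annih i + v i • (annih i)ᴴ) * (u' j • annih j + v' j • (annih j)ᴴ)
      + (u' j • annih j + v' j • (annih j)ᴴ) * (u i • annih i + v i • (annih i)ᴴ) =
      if i = j then (u i * v' i + v i * u' i) • (1 : Op N) else 0 := by
    have h1 := annih_anticomm i j
    have h2 := annih_anticomm_conjTranspose i j
    have h3 := annih_anticomm_conjTranspose j i
    calc _ = (u i * u' j) • (annih i * annih j + annih j * annih i)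
          + (u i * v' j) • (annih i * (annih j)ᴴ + (annih j)ᴴ * annih i)
          + (v i * u' j) • (annih j * (annih i)ᴴ + (annih i)ᴴ * annih j)
          + (v i * v' j) • ((annih i)ᴴ * (annih j)ᴴ + (annih j)ᴴ * (annih i)ᴴ) := by
            simp only [add_mul, mul_add, smul_mul_smul_comm]
            simp only [mul_comm (u' j), mul_comm (v' j)]
            module
      _ = _ := by
        rw [h1, h2, h3, h4]
        by_cases h : i = j
        · subst h; simp [add_smul]
        · simp [h, Ne.symm h]
  unfold field
  rw [Finset.sum_mul_sum, Finset.sum_mul_sum, Finset.sum_comm (γ := Fin N) (s := Finset.univ)]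
  rw [← Finset.sum_add_distrib]
  simp only [← Finset.sum_add_distrib]
  rw [Finset.sum_comm, Finset.sum_smul]
  simp [key]

lemma field_conjTranspose {N : ℕ} (u v : Fin N → ℂ) : (field u v)ᴴ = field (star v) (star u) := by
  unfold field
  rw [Matrix.conjTranspose_sum]
  refine Finset.sum_congr rfl fun j _ => ?_
  simp [Matrix.conjTranspose_add, Matrix.conjTranspose_smul, add_comm]

/-! ### Fourier modes -/

/-- The phase `exp (i k j)` at the momentum number `n`. -/
noncomputable def phase (N n j : ℕ) : ℂ := Complex.exp (Complex.I * (momentum N n * j : ℝ))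

lemma phase_zero (N n : ℕ) : phase N n 0 = 1 := by simp [phase]

lemma phase_add (N n i j : ℕ) : phase N n (i + j) = phase N n i * phase N n j := by
  unfold phase
  rw [← Complex.exp_add]; congr 1; push_cast; ring

lemma phase_eq (N n j : ℕ) : phase N n j =
    (cos (momentum N n * j) : ℝ) + (sin (momentum N n * j) : ℝ) * Complex.I := by
  unfold phase
  rw [mul_comm, Complex.exp_mul_I]; push_cast; rfl

lemma phase_chain {N : ℕ} (hN : 0 < N) (n : ℕ) : phase N n N = -1 := by
  have : (N : ℝ) ≠ 0 := by positivity
  have h : momentum N n * N = π + n * (2 * π) := by unfold momentum; field_simp; ring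
  rw [phase_eq, h, Real.cos_add_nat_mul_two_pi, Real.sin_add_nat_mul_two_pi]
  simp

lemma phase_mod {N : ℕ} (hN : 0 < N) (n j : ℕ) :
    phase N n j = (-1) ^ (j / N) * phase N n (j % N) := by
  have (a b : ℕ) : phase N n (N * a + b) = (-1) ^ a * phase N n b := by
    induction a with
    | zero => simp
    | succ a ih => rw [mul_add, mul_one, add_right_comm, phase_add, ih, phase_chain hN]; ring
  conv_lhs => rw [← Nat.div_add_mod j N]
  exact this _ _

/-- The momentum of `n.rev` is the opposite one, up to the period `2 π`. -/
lemma momentum_rev_mul {N : ℕ} (n : Fin N) (l : ℕ) :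
    momentum N n.rev * l = -(momentum N n * l) + l * (2 * π) := by
  have hN : (N : ℝ) ≠ 0 := by
    have := n.pos
    positivity
  unfold momentum
  rw [Fin.val_rev, Nat.cast_sub (by omega)]
  push_cast
  field_simp; ring

lemma phase_rev {N : ℕ} (n : Fin N) (j : ℕ) : phase N n.rev j = star (phase N n j) := by
  rw [phase_eq, phase_eq, momentum_rev_mul, Real.cos_add_nat_mul_two_pi,
    Real.sin_add_nat_mul_two_pi, Real.cos_neg, Real.sin_neg, Complex.star_def, map_add, map_mul,
    Complex.conj_ofReal, Complex.conj_ofReal, Complex.conj_I]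
  push_cast
  ring

/-- Multiplication by the phase at `n` against that at `m` is a power of the primitive `N`-th
root of unity. -/
lemma star_phase_mul_phase (N m n j : ℕ) : star (phase N m j) * phase N n j =
    (Complex.exp (2 * π * Complex.I / N) ^ n / Complex.exp (2 * π * Complex.I / N) ^ m) ^ j := by
  unfold phase momentum
  rw [Complex.star_def, ← Complex.exp_conj, ← Complex.exp_add, ← Complex.exp_nat_mul,
    ← Complex.exp_nat_mul, ← Complex.exp_sub, ← Complex.exp_nat_mul]
  congr 1
  simp only [map_mul, Complex.conj_I, Complex.conj_ofReal]
  push_cast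
  ring

lemma sum_pow_root {N : ℕ} {m n : ℕ} (hm : m < N) (hn : n < N) :
    ∑ j ∈ Finset.range N, (Complex.exp (2 * π * Complex.I / N) ^ n /
      Complex.exp (2 * π * Complex.I / N) ^ m) ^ j = if m = n then (N : ℂ) else 0 := by
  have hN : N ≠ 0 := by omega
  have hζ := Complex.isPrimitiveRoot_exp N hN
  set ζ := Complex.exp (2 * π * Complex.I / N)
  have h0 : ζ ≠ 0 := Complex.exp_ne_zero _
  split_ifs with h
  · subst h; simp [h0]
  · have h1 : ζ ^ n / ζ ^ m ≠ 1 := by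
      intro h'
      rw [div_eq_one_iff_eq (pow_ne_zero _ h0)] at h'
      exact h (hζ.pow_inj hn hm h').symm
    have h2 : (ζ ^ n / ζ ^ m) ^ N = 1 := by
      rw [div_pow, ← pow_mul, ← pow_mul, mul_comm n, mul_comm m, pow_mul, pow_mul, hζ.pow_eq_one]
      simp
    rw [geom_sum_eq h1, h2]; simp

lemma sum_Icc_star_phase_mul_phase {N : ℕ} (m n : Fin N) :
    ∑ j ∈ Finset.Icc 1 N, star (phase N m j) * phase N n j = if m = n then (N : ℂ) else 0 := by
  simp only [star_phase_mul_phase]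
  have := sum_pow_root m.2 n.2
  rw [← Finset.Ico_add_one_right_eq_Icc, Finset.sum_Ico_eq_sum_range]
  simp only [pow_add, ← Finset.mul_sum, Nat.add_sub_cancel]
  rw [this]
  by_cases h : m = n
  · subst h; simp
  · simp [h, Fin.val_inj]

lemma sum_star_phase_mul_phase {N : ℕ} (m n : Fin N) :
    ∑ j : Fin N, star (phase N m j) * phase N n j = if m = n then (N : ℂ) else 0 := by
  rw [Fin.sum_univ_eq_sum_range (fun j => star (phase N m j) * phase N n j)]
  simp only [star_phase_mul_phase]
  rw [sum_pow_root m.2 n.2]; simp [Fin.val_inj]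

/-- Completeness of the phases, dual to their orthogonality. -/
lemma sum_phase_mul_star_phase {N : ℕ} (i j : Fin N) :
    ∑ n : Fin N, phase N n i * star (phase N n j) = if i = j then (N : ℂ) else 0 := by
  have hN : (N : ℂ) ≠ 0 := by
    have := i.pos
    exact_mod_cast this.ne'
  let F : Matrix (Fin N) (Fin N) ℂ := Matrix.of fun m j => star (phase N m j)
  have h1 : F * ((N : ℂ)⁻¹ • Fᴴ) = 1 := by
    ext m n
    rw [Matrix.mul_smul, Matrix.smul_apply, Matrix.mul_apply]
    simp only [F, Matrix.conjTranspose_apply, Matrix.of_apply, star_star]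
    rw [sum_star_phase_mul_phase]
    by_cases h : m = n
    · subst h; simp [hN]
    · simp [h]
  rw [mul_eq_one_comm] at h1
  have h2 := congrFun (congrFun h1 i) j
  rw [Matrix.smul_mul, Matrix.smul_apply, Matrix.mul_apply] at h2
  simp only [F, Matrix.conjTranspose_apply, Matrix.of_apply, star_star] at h2
  rw [smul_eq_mul, inv_mul_eq_iff_eq_mul₀ hN] at h2
  rw [h2]
  by_cases h : i = j
  · subst h; simp
  · simp [h]

/-- The Fourier mode of momentum number `n`. -/
noncomputable def fourier {N : ℕ} (n : Fin N) : Op N :=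
  field (fun j => ((√N)⁻¹ : ℝ) * star (phase N n j)) 0

lemma sqrt_inv_mul_self {N : ℕ} (hN : 0 < N) : (((√N)⁻¹ : ℝ) : ℂ) * ((√N)⁻¹ : ℝ) * N = 1 := by
  have : (√(N : ℝ))⁻¹ * (√N)⁻¹ * N = 1 := by
    have h : (0 : ℝ) < N := by exact_mod_cast hN
    rw [← mul_inv, Real.mul_self_sqrt h.le]
    field_simp
  exact_mod_cast this

lemma fourier_anticomm {N : ℕ} (m n : Fin N) :
    (fourier m : Op N) * fourier n + fourier n * fourier m = 0 := by
  unfold fourier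
  rw [field_anticomm]; simp

lemma fourier_anticomm_conjTranspose {N : ℕ} (m n : Fin N) :
    (fourier m : Op N) * (fourier n)ᴴ + (fourier n)ᴴ * fourier m = if m = n then 1 else 0 := by
  unfold fourier
  rw [field_conjTranspose, field_anticomm]
  have h := sum_star_phase_mul_phase m n
  have : ∑ j : Fin N, (((√N)⁻¹ : ℝ) * star (phase N m j)) *
      star ((((√N)⁻¹ : ℝ) : ℂ) * star (phase N n j)) = if m = n then (1 : ℂ) else 0 := by
    calc _ = (((√N)⁻¹ : ℝ) : ℂ) * ((√N)⁻¹ : ℝ) *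
          ∑ j : Fin N, star (phase N m j) * phase N n j := by
            rw [Finset.mul_sum]
            refine Finset.sum_congr rfl fun j _ => ?_
            simp only [star_mul', star_star]
            simp only [Complex.star_def, Complex.conj_ofReal]
            ring
      _ = _ := by
        rw [h]
        split_ifs
        · exact sqrt_inv_mul_self m.pos
        · simp
  simp only [Pi.star_apply, Pi.zero_apply, star_zero, mul_zero, add_zero]
  rw [this]
  split_ifs <;> simp

/-- Inversion of the Fourier transform; it holds at every site because both sides are
anti-periodic. -/
lemma site_eq_sum_fourier {N : ℕ} (hN : 0 < N) (j : ℕ) :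
    site N j = (((√N)⁻¹ : ℝ) : ℂ) • ∑ n : Fin N, phase N n j • fourier n := by
  have h1 (i : Fin N) : annih i =
      (((√N)⁻¹ : ℝ) : ℂ) • ∑ n : Fin N, phase N n i • (fourier n : Op N) := by
    have (n : Fin N) : (fourier n : Op N) =
        ∑ l : Fin N, ((((√N)⁻¹ : ℝ) : ℂ) * star (phase N n l)) • annih l := by
      simp [fourier, field]
    simp only [this, Finset.smul_sum, smul_smul]
    rw [Finset.sum_comm]
    simp only [← Finset.sum_smul]
    have e (l : Fin N) : ∑ n : Fin N, (((√N)⁻¹ : ℝ) : ℂ) *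
        (phase N n i * ((((√N)⁻¹ : ℝ) : ℂ) * star (phase N n l))) = if i = l then 1 else 0 := by
      calc _ = (((√N)⁻¹ : ℝ) : ℂ) * ((√N)⁻¹ : ℝ) *
            ∑ n : Fin N, phase N n i * star (phase N n l) := by
              rw [Finset.mul_sum]
              exact Finset.sum_congr rfl fun n _ => by ring
        _ = _ := by
          rw [sum_phase_mul_star_phase]
          split_ifs
          · exact sqrt_inv_mul_self hN
          · simp
    simp only [e, ite_smul, one_smul, zero_smul, Finset.sum_ite_eq, Finset.mem_univ, if_true]
  unfold site
  rw [dif_pos hN, h1, smul_comm, Finset.smul_sum]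
  congr 1
  refine Finset.sum_congr rfl fun n _ => ?_
  rw [smul_smul, phase_mod hN n j]

lemma sum_site_conjTranspose_mul {N : ℕ} (hN : 0 < N) (l : ℕ) :
    ∑ j ∈ Finset.Icc 1 N, (site N j)ᴴ * site N (j + l) =
      ∑ n : Fin N, phase N n l • ((fourier n)ᴴ * fourier n : Op N) := by
  have h (j : ℕ) : (site N j)ᴴ * site N (j + l) =
      ∑ m : Fin N, ∑ n : Fin N, ((((√N)⁻¹ : ℝ) : ℂ) * ((√N)⁻¹ : ℝ) * phase N n l *
        (star (phase N m j) * phase N n j)) • ((fourier m)ᴴ * fourier n : Op N) := by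
    rw [site_eq_sum_fourier hN, site_eq_sum_fourier hN, Matrix.conjTranspose_smul,
      smul_mul_smul_comm, Matrix.conjTranspose_sum, Finset.sum_mul_sum, Finset.smul_sum]
    refine Finset.sum_congr rfl fun m _ => ?_
    rw [Finset.smul_sum]
    refine Finset.sum_congr rfl fun n _ => ?_
    rw [Matrix.conjTranspose_smul, smul_mul_smul_comm, smul_smul, phase_add]
    congr 1
    simp only [Complex.star_def, Complex.conj_ofReal]
    ring
  simp only [h]
  rw [Finset.sum_comm]
  refine Finset.sum_congr rfl fun m _ => ?_
  rw [Finset.sum_comm]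
  simp only [← Finset.sum_smul, ← Finset.mul_sum, sum_Icc_star_phase_mul_phase]
  rw [Finset.sum_eq_single m]
  · rw [if_pos rfl, mul_right_comm, sqrt_inv_mul_self hN, one_mul]
  · intro n _ hn
    simp [hn.symm]
  · simp

lemma sum_site_mul {N : ℕ} (hN : 0 < N) (l : ℕ) :
    ∑ j ∈ Finset.Icc 1 N, site N j * site N (j + l) =
      ∑ n : Fin N, star (phase N n l) • (fourier n * fourier n.rev : Op N) := by
  have h (j : ℕ) : site N j * site N (j + l) =
      ∑ m : Fin N, ∑ n : Fin N, ((((√N)⁻¹ : ℝ) : ℂ) * ((√N)⁻¹ : ℝ) * phase N n l *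
        (star (phase N m.rev j) * phase N n j)) • (fourier m * fourier n : Op N) := by
    rw [site_eq_sum_fourier hN, site_eq_sum_fourier hN,
      smul_mul_smul_comm, Finset.sum_mul_sum, Finset.smul_sum]
    refine Finset.sum_congr rfl fun m _ => ?_
    rw [Finset.smul_sum]
    refine Finset.sum_congr rfl fun n _ => ?_
    rw [smul_mul_smul_comm, smul_smul, phase_add, phase_rev, star_star]
    congr 1
    ring
  simp only [h]
  rw [Finset.sum_comm]
  refine Finset.sum_congr rfl fun m _ => ?_
  rw [Finset.sum_comm]
  simp only [← Finset.sum_smul, ← Finset.mul_sum, sum_Icc_star_phase_mul_phase]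
  rw [Finset.sum_eq_single m.rev]
  · rw [if_pos rfl, mul_right_comm, sqrt_inv_mul_self hN, one_mul, phase_rev]
  · intro n _ hn
    simp [hn.symm]
  · simp

/-! ### The Hamiltonian in Fourier modes -/

/-- The quadratic operator `∑ₙ [zₙ (cₙ† cₙ - 1/2) + (wₙ cₙ† c_{-n}† + h.c.) / 2]` in the modes `c`,
where `-n` stands for `n.rev`, the opposite momentum. -/
noncomputable def quad {N : ℕ} (c : Fin N → Op N) (z : Fin N → ℝ) (w : Fin N → ℂ) : Op N :=
  ∑ n, ((z n : ℂ) • ((c n)ᴴ * c n - (1 / 2 : ℂ) • (1 : Op N))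
    + (1 / 2 : ℂ) • (w n • ((c n)ᴴ * (c n.rev)ᴴ) + star (w n) • (c n.rev * c n)))

lemma sin_momentum_mul_sub {N : ℕ} (hN : 0 < N) (n l : ℕ) (hl : l ≤ N) :
    sin (momentum N n * (N - l : ℕ)) = sin (momentum N n * l) := by
  have hN' : (N : ℝ) ≠ 0 := by positivity
  have h : momentum N n * (N - l : ℕ) = π - momentum N n * l + n * (2 * π) := by
    rw [Nat.cast_sub hl]; unfold momentum; field_simp; ring
  rw [h, Real.sin_add_nat_mul_two_pi, Real.sin_pi_sub]

lemma cos_momentum_mul_sub {N : ℕ} (hN : 0 < N) (n l : ℕ) (hl : l ≤ N) :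
    cos (momentum N n * (N - l : ℕ)) = -cos (momentum N n * l) := by
  have hN' : (N : ℝ) ≠ 0 := by positivity
  have h : momentum N n * (N - l : ℕ) = π - momentum N n * l + n * (2 * π) := by
    rw [Nat.cast_sub hl]; unfold momentum; field_simp; ring
  rw [h, Real.cos_add_nat_mul_two_pi, Real.cos_pi_sub]

lemma pairing_sub (κ : ℝ → ℝ) {N l : ℕ} (hl : l ≤ N) : pairing κ N (N - l) = pairing κ N l := by
  unfold pairing
  rw [Nat.sub_sub_self hl, min_comm]

lemma sum_Icc_reflect {M : Type*} [AddCommMonoid M] (N : ℕ) (g : ℕ → M) :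
    ∑ l ∈ Finset.Icc 1 (N - 1), g (N - l) = ∑ l ∈ Finset.Icc 1 (N - 1), g l := by
  refine Finset.sum_nbij' (fun l => N - l) (fun l => N - l) ?_ ?_ ?_ ?_ ?_ <;>
    simp only [Finset.mem_Icc] <;> intro l hl
  · omega
  · omega
  · omega
  · omega
  · trivial

/-- At the momenta of the chain, `f(k)` is the full sine transform of the pairing profile. -/
lemma pairingTransform_momentum (κ : ℝ → ℝ) {N : ℕ} (he : Even N) (hN : 0 < N) (n : ℕ) :
    pairingTransform κ N (momentum N n) =
      ∑ l ∈ Finset.Icc 1 (N - 1), pairing κ N l * sin (momentum N n * l) := by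
  obtain ⟨M, rfl⟩ := he
  have hM : 0 < M := by omega
  have hd : (M + M) / 2 = M := by omega
  set k := momentum (M + M) n
  have hI : Finset.Icc 1 (M + M - 1) = Finset.Ico 1 (M + M) := by ext; simp; omega
  rw [hI, ← Finset.sum_Ico_consecutive _ (show 1 ≤ M by omega) (show M ≤ M + M by omega),
    Finset.sum_eq_sum_Ico_succ_bot (show M < M + M by omega)]
  have h1 : ∑ l ∈ Finset.Ico 1 M, pairing κ (M + M) l * sin (k * l) =
      ∑ l ∈ Finset.Ico 1 M, κ l * sin (k * l) := by
    refine Finset.sum_congr rfl fun l hl => ?_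
    rw [Finset.mem_Ico] at hl
    rw [pairing, min_eq_left (by omega)]
  have h2 : ∑ l ∈ Finset.Ico (M + 1) (M + M), pairing κ (M + M) l * sin (k * l) =
      ∑ l ∈ Finset.Ico 1 M, κ l * sin (k * l) := by
    refine Finset.sum_nbij' (fun l => M + M - l) (fun l => M + M - l) ?_ ?_ ?_ ?_ ?_ <;>
      simp only [Finset.mem_Ico] <;> intro l hl
    · omega
    · omega
    · omega
    · omega
    · rw [sin_momentum_mul_sub hN n l (by omega), pairing, min_eq_right (by omega)]
  have h3 : pairing κ (M + M) M = κ M := by rw [pairing, min_eq_left (by omega)]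
  rw [h1, h2, h3, pairingTransform, hd]
  ring

lemma sum_pairing_phase (κ : ℝ → ℝ) {N : ℕ} (he : Even N) (hN : 0 < N) (n : ℕ) :
    ∑ l ∈ Finset.Icc 1 (N - 1), (pairing κ N l : ℂ) * star (phase N n l) =
      -(Complex.I * pairingTransform κ N (momentum N n)) := by
  have hc : ∑ l ∈ Finset.Icc 1 (N - 1), pairing κ N l * cos (momentum N n * l) = 0 := by
    have := sum_Icc_reflect N fun l => pairing κ N l * cos (momentum N n * l)
    have h2 : ∑ l ∈ Finset.Icc 1 (N - 1), pairing κ N (N - l) * cos (momentum N n * (N - l : ℕ)) =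
        -∑ l ∈ Finset.Icc 1 (N - 1), pairing κ N l * cos (momentum N n * l) := by
      rw [← Finset.sum_neg_distrib]
      refine Finset.sum_congr rfl fun l hl => ?_
      rw [Finset.mem_Icc] at hl
      rw [pairing_sub κ (by omega), cos_momentum_mul_sub hN n l (by omega)]
      ring
    linarith
  have h (l : ℕ) : (pairing κ N l : ℂ) * star (phase N n l) =
      ((pairing κ N l * cos (momentum N n * l) : ℝ) : ℂ) -
        Complex.I * ((pairing κ N l * sin (momentum N n * l) : ℝ) : ℂ) := by
    rw [phase_eq, Complex.star_def, map_add, map_mul, Complex.conj_ofReal, Complex.conj_ofReal,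
      Complex.conj_I, Complex.ofReal_mul, Complex.ofReal_mul]
    ring
  simp only [h, Finset.sum_sub_distrib, ← Finset.mul_sum, ← Complex.ofReal_sum]
  rw [hc, ← pairingTransform_momentum κ he hN]
  simp

lemma site_add_chain {N : ℕ} (hN : 0 < N) (j : ℕ) : site N (j + N) = -site N j := by
  simp only [site, dif_pos hN, Nat.add_mod_right, Nat.add_div_right _ hN, pow_succ]
  simp

lemma site_mul_site_anticomm {N : ℕ} (hN : 0 < N) (i j : ℕ) :
    site N i * site N j = -(site N j * site N i) := by
  simp only [site, dif_pos hN, smul_mul_smul_comm, mul_comm ((-1 : ℂ) ^ (i / N))]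
  rw [eq_neg_iff_add_eq_zero, ← smul_add, annih_anticomm, smul_zero]

/-- The pairing term of the open double sum is half of the sum around the anti-periodic ring:
a pair `(j, j + l)` with `j + l > N` is the pair `(j + l - N, j)` at distance `N - l`. -/
lemma sum_pairing_site (κ : ℝ → ℝ) {N : ℕ} (hN : 0 < N) :
    ∑ l ∈ Finset.Icc 1 (N - 1), pairing κ N l • ∑ j ∈ Finset.Icc 1 N, site N j * site N (j + l) =
      (2 : ℝ) • ∑ j ∈ Finset.Icc 1 (N - 1), ∑ l ∈ Finset.Icc 1 (N - j),
        pairing κ N l • (site N j * site N (j + l)) := by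
  set g : ℕ × ℕ → Op N := fun x => pairing κ N x.2 • (site N x.1 * site N (x.1 + x.2)) with hg
  set A := Finset.Icc 1 N ×ˢ Finset.Icc 1 (N - 1)
  have h1 : ∑ l ∈ Finset.Icc 1 (N - 1), pairing κ N l •
      ∑ j ∈ Finset.Icc 1 N, site N j * site N (j + l) = ∑ x ∈ A, g x := by
    simp only [Finset.smul_sum]
    rw [Finset.sum_comm, Finset.sum_product]
  have h2 : ∑ j ∈ Finset.Icc 1 (N - 1), ∑ l ∈ Finset.Icc 1 (N - j),
      pairing κ N l • (site N j * site N (j + l)) = ∑ x ∈ A with x.1 + x.2 ≤ N, g x := by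
    rw [Finset.sum_sigma']
    refine Finset.sum_nbij' (fun x => (x.1, x.2)) (fun x => ⟨x.1, x.2⟩) ?_ ?_ ?_ ?_ ?_ <;>
      simp only [Finset.mem_sigma, Finset.mem_filter, Finset.mem_Icc, A, Finset.mem_product,
        Prod.forall, Sigma.forall] <;> intro j l h
    · omega
    · omega
    · trivial
    · trivial
    · trivial
  have h3 : ∑ x ∈ A with ¬ x.1 + x.2 ≤ N, g x = ∑ x ∈ A with x.1 + x.2 ≤ N, g x := by
    refine Finset.sum_nbij' (fun x => (x.1 + x.2 - N, N - x.2)) (fun x => (x.1 + x.2, N - x.2))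
      ?_ ?_ ?_ ?_ ?_ <;>
      simp only [Finset.mem_filter, Finset.mem_Icc, A, Finset.mem_product, Prod.forall,
        Prod.mk.injEq] <;> intro j l h
    · omega
    · omega
    · omega
    · omega
    · simp only [hg]
      rw [pairing_sub κ (by omega), show j + l - N + (N - l) = j by omega,
        site_mul_site_anticomm hN (j + l - N) j,
        show j + l = (j + l - N) + N by omega, site_add_chain hN,
        show j + l - N + N - N = j + l - N by omega, mul_neg]
  rw [h1, h2, ← Finset.sum_filter_add_sum_filter_not A (fun x => x.1 + x.2 ≤ N), h3, two_smul]

lemma sum_cos_momentum {N : ℕ} (he : Even N) (hN : 0 < N) :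
    ∑ n : Fin N, cos (momentum N n) = 0 := by
  have hN2 : 1 < N := by
    obtain ⟨M, rfl⟩ := he; omega
  have h := sum_phase_mul_star_phase (N := N) ⟨1, hN2⟩ ⟨0, hN⟩
  simp only [phase_zero, star_one, mul_one] at h
  rw [if_neg (by simp)] at h
  have h2 := congrArg Complex.re h
  rw [Complex.re_sum] at h2
  simpa [phase_eq, ← Complex.ofReal_cos, ← Complex.ofReal_sin] using h2

lemma fourier_rev_mul {N : ℕ} (n : Fin N) :
    (fourier n.rev * fourier n : Op N) = -(fourier n * fourier n.rev) := by
  rw [eq_neg_iff_add_eq_zero, fourier_anticomm]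

/-- The Hamiltonian is quadratic in the Fourier modes and couples only opposite momenta. -/
lemma hamiltonian_eq_quad (κ : ℝ → ℝ) {N : ℕ} (he : Even N) (hN : 0 < N) (p : Coupling → ℝ) :
    hamiltonian κ N p = quad fourier (fun n => -(p J * cos (momentum N n) + p mu))
      (fun n => -(Complex.I * (p Delta * pairingTransform κ N (momentum N n) / 2 : ℝ))) := by
  have hJ : ∑ j ∈ Finset.Icc 1 N,
      ((site N j)ᴴ * site N (j + 1) + (site N (j + 1))ᴴ * site N j) =
      ∑ n : Fin N, (2 * (cos (momentum N n) : ℝ) : ℂ) •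
        ((fourier n)ᴴ * fourier n - (1 / 2 : ℂ) • (1 : Op N)) := by
    have h1 : ∑ j ∈ Finset.Icc 1 N, (site N (j + 1))ᴴ * site N j =
        (∑ j ∈ Finset.Icc 1 N, (site N j)ᴴ * site N (j + 1))ᴴ := by
      simp [Matrix.conjTranspose_sum, Matrix.conjTranspose_mul]
    rw [Finset.sum_add_distrib, h1, sum_site_conjTranspose_mul hN, Matrix.conjTranspose_sum,
      ← Finset.sum_add_distrib]
    simp only [smul_sub, Finset.sum_sub_distrib, ← Finset.sum_smul, ← Finset.mul_sum,
      ← Complex.ofReal_sum, sum_cos_momentum he hN]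
    simp only [Complex.ofReal_zero, mul_zero, zero_smul, sub_zero]
    refine Finset.sum_congr rfl fun n _ => ?_
    rw [Matrix.conjTranspose_smul, Matrix.conjTranspose_mul, Matrix.conjTranspose_conjTranspose,
      ← add_smul, phase_eq]
    congr 1
    simp only [star_add, star_mul', Complex.star_def, Complex.conj_I, Complex.conj_ofReal,
      Nat.cast_one, mul_one]
    ring
  have hmu : ∑ j ∈ Finset.Icc 1 N, ((site N j)ᴴ * site N j - (1 / 2 : ℝ) • (1 : Op N)) =
      ∑ n : Fin N, ((fourier n)ᴴ * fourier n - (1 / 2 : ℂ) • (1 : Op N)) := by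
    have h := sum_site_conjTranspose_mul hN 0
    simp only [add_zero, phase_zero, one_smul] at h
    rw [Finset.sum_sub_distrib, Finset.sum_sub_distrib, h]
    simp [← Complex.coe_smul]
  have hD : ∑ j ∈ Finset.Icc 1 (N - 1), ∑ l ∈ Finset.Icc 1 (N - j),
      pairing κ N l • (site N j * site N (j + l) + (site N (j + l))ᴴ * (site N j)ᴴ) =
      ∑ n : Fin N, ((1 / 2 : ℂ) * (Complex.I * pairingTransform κ N (momentum N n))) •
        (fourier n.rev * fourier n - (fourier n)ᴴ * (fourier n.rev)ᴴ : Op N) := by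
    have hX : ∑ j ∈ Finset.Icc 1 (N - 1), ∑ l ∈ Finset.Icc 1 (N - j),
        pairing κ N l • (site N j * site N (j + l)) =
        ∑ n : Fin N, ((1 / 2 : ℂ) * (Complex.I * pairingTransform κ N (momentum N n))) •
          (fourier n.rev * fourier n : Op N) := by
      have h := sum_pairing_site κ hN
      simp only [sum_site_mul hN, Finset.smul_sum] at h
      rw [Finset.sum_comm] at h
      have e (n : Fin N) : ∑ l ∈ Finset.Icc 1 (N - 1), pairing κ N l •
          star (phase N n l) • (fourier n * fourier n.rev : Op N) =
          (Complex.I * pairingTransform κ N (momentum N n)) • (fourier n.rev * fourier n) := by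
        simp only [← Complex.coe_smul, smul_smul]
        rw [← Finset.sum_smul, sum_pairing_phase κ he hN, fourier_rev_mul]
        module
      simp only [e] at h
      simp only [mul_smul (1 / 2 : ℂ)]
      rw [← Finset.smul_sum, h]
      simp only [← Finset.smul_sum]
      rw [← Complex.coe_smul, smul_smul]
      norm_num
    have h1 : ∑ j ∈ Finset.Icc 1 (N - 1), ∑ l ∈ Finset.Icc 1 (N - j),
        pairing κ N l • ((site N (j + l))ᴴ * (site N j)ᴴ) =
        (∑ j ∈ Finset.Icc 1 (N - 1), ∑ l ∈ Finset.Icc 1 (N - j),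
          pairing κ N l • (site N j * site N (j + l)))ᴴ := by
      simp only [Matrix.conjTranspose_sum, Matrix.conjTranspose_mul, Matrix.conjTranspose_smul]
      simp
    simp only [smul_add, Finset.sum_add_distrib]
    rw [h1, hX, Matrix.conjTranspose_sum, ← Finset.sum_add_distrib]
    refine Finset.sum_congr rfl fun n _ => ?_
    rw [Matrix.conjTranspose_smul, Matrix.conjTranspose_mul]
    simp only [star_mul', Complex.star_def, Complex.conj_I, Complex.conj_ofReal]
    rw [show (starRingEnd ℂ) (1 / 2) = 1 / 2 by simp [Complex.conj_ofNat]]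
    module
  unfold hamiltonian quad
  rw [hJ, hmu, hD, ← Complex.coe_smul (p J / 2), ← Complex.coe_smul (p mu),
    ← Complex.coe_smul (p Delta / 2), Finset.smul_sum, Finset.smul_sum, Finset.smul_sum,
    ← Finset.sum_neg_distrib, ← Finset.sum_sub_distrib, ← Finset.sum_add_distrib]
  refine Finset.sum_congr rfl fun n _ => ?_
  simp only [star_neg, star_mul', Complex.star_def, Complex.conj_I, Complex.conj_ofReal]
  push_cast
  module

/-! ### Commutators and Heisenberg evolution of quadratic operators -/

lemma mul_commutator_eq_anticommutator {R : Type*} [Ring R] (A B C : R) :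
    A * B * C - C * (A * B) = A * (C * B + B * C) - (C * A + A * C) * B := by
  noncomm_ring

section Commutators

variable {N : ℕ} {c : Fin N → Op N}

lemma quad_conjTranspose (z : Fin N → ℝ) (w : Fin N → ℂ) : (quad c z w)ᴴ = quad c z w := by
  unfold quad
  rw [Matrix.conjTranspose_sum]
  refine Finset.sum_congr rfl fun n _ => ?_
  simp only [Matrix.conjTranspose_add, Matrix.conjTranspose_sub, Matrix.conjTranspose_smul,
    Matrix.conjTranspose_mul, Matrix.conjTranspose_conjTranspose, Matrix.conjTranspose_one,
    star_star]
  rw [show star (1 / 2 : ℂ) = 1 / 2 by simp, show star (z n : ℂ) = z n from Complex.conj_ofReal _,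
    add_comm (_ • (c n.rev * _))]

lemma quad_commutator_mode (hc : ∀ m n, c m * c n + c n * c m = 0)
    (hd : ∀ m n, c m * (c n)ᴴ + (c n)ᴴ * c m = if m = n then 1 else 0)
    (z : Fin N → ℝ) {w : Fin N → ℂ} (hw : ∀ n, w n.rev = -w n) (m : Fin N) :
    quad c z w * c m - c m * quad c z w = -((z m : ℂ) • c m) - w m • (c m.rev)ᴴ := by
  have h1 (n : Fin N) : (c n)ᴴ * c n * c m - c m * ((c n)ᴴ * c n) =
      if m = n then -c n else 0 := by
    rw [mul_commutator_eq_anticommutator, hc, hd]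
    split_ifs <;> simp
  have h2 (n : Fin N) : (c n)ᴴ * (c n.rev)ᴴ * c m - c m * ((c n)ᴴ * (c n.rev)ᴴ) =
      (if m.rev = n then (c n)ᴴ else 0) - (if m = n then (c n.rev)ᴴ else 0) := by
    rw [mul_commutator_eq_anticommutator, hd, hd]
    simp only [Fin.rev_eq_iff]
    split_ifs <;> simp
  have h3 (n : Fin N) : c n.rev * c n * c m - c m * (c n.rev * c n) = 0 := by
    rw [mul_commutator_eq_anticommutator, hc, hc]; simp
  calc _ = ∑ n, ((z n : ℂ) • ((c n)ᴴ * c n * c m - c m * ((c n)ᴴ * c n))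
        + (1 / 2 : ℂ) • (w n • ((c n)ᴴ * (c n.rev)ᴴ * c m - c m * ((c n)ᴴ * (c n.rev)ᴴ))
          + star (w n) • (c n.rev * c n * c m - c m * (c n.rev * c n)))) := by
        unfold quad
        rw [Finset.sum_mul, Finset.mul_sum, ← Finset.sum_sub_distrib]
        refine Finset.sum_congr rfl fun n _ => ?_
        simp only [add_mul, mul_add, sub_mul, mul_sub, smul_mul_assoc, mul_smul_comm, one_mul,
          mul_one]
        module
    _ = _ := by
        simp only [h1, h2, h3, smul_zero, add_zero, smul_sub, smul_ite,
          Finset.sum_add_distrib, Finset.sum_sub_distrib, Finset.sum_ite_eq, Finset.mem_univ,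
          if_true, hw]
        module

lemma quad_commutator_mode_conjTranspose (hc : ∀ m n, c m * c n + c n * c m = 0)
    (hd : ∀ m n, c m * (c n)ᴴ + (c n)ᴴ * c m = if m = n then 1 else 0)
    (z : Fin N → ℝ) {w : Fin N → ℂ} (hw : ∀ n, w n.rev = -w n) (m : Fin N) :
    quad c z w * (c m)ᴴ - (c m)ᴴ * quad c z w = (z m : ℂ) • (c m)ᴴ + star (w m) • c m.rev := by
  have h := congrArg (fun A => -Aᴴ) (quad_commutator_mode hc hd z hw m)
  simp only [Matrix.conjTranspose_sub, Matrix.conjTranspose_mul, quad_conjTranspose,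
    Matrix.conjTranspose_neg, Matrix.conjTranspose_smul, Matrix.conjTranspose_conjTranspose,
    neg_sub, Complex.star_def, Complex.conj_ofReal] at h
  rw [h, Complex.star_def]
  module

lemma commutator_mul {R : Type*} [Ring R] (X A B : R) :
    X * (A * B) - A * B * X = (X * A - A * X) * B + A * (X * B - B * X) := by
  noncomm_ring

/-- The quadratic operators form a Lie algebra: on the pseudo-spin of each pair of opposite
momenta, the commutator acts as the vector product. -/
lemma quad_commutator (hc : ∀ m n, c m * c n + c n * c m = 0)
    (hd : ∀ m n, c m * (c n)ᴴ + (c n)ᴴ * c m = if m = n then 1 else 0)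
    {z z' : Fin N → ℝ} {w w' : Fin N → ℂ}
    (hw : ∀ n, w n.rev = -w n) (hz : ∀ n, z n.rev = z n) (hw' : ∀ n, w' n.rev = -w' n) :
    Complex.I • (quad c z w * quad c z' w' - quad c z' w' * quad c z w) =
      quad c (fun n => 2 * (star (w n) * w' n).im)
        (fun n => 2 * Complex.I * (z n * w' n - z' n * w n)) := by
  set X := quad c z w with hX
  have hm := quad_commutator_mode hc hd z hw
  have hmc := quad_commutator_mode_conjTranspose hc hd z hw
  rw [← hX] at hm hmc
  have ha (m : Fin N) : c m * (c m)ᴴ = 1 - (c m)ᴴ * c m := by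
    rw [eq_sub_iff_add_eq, hd, if_pos rfl]
  have h1 (m : Fin N) : X * ((c m)ᴴ * c m) - (c m)ᴴ * c m * X =
      star (w m) • (c m.rev * c m) - w m • ((c m)ᴴ * (c m.rev)ᴴ) := by
    rw [commutator_mul, hm, hmc]
    simp only [add_mul, mul_sub, mul_neg, smul_mul_assoc, mul_smul_comm]
    module
  have h2 (m : Fin N) : X * ((c m)ᴴ * (c m.rev)ᴴ) - (c m)ᴴ * (c m.rev)ᴴ * X =
      (2 * (z m : ℂ)) • ((c m)ᴴ * (c m.rev)ᴴ) +
        star (w m) • (1 - (c m)ᴴ * c m - (c m.rev)ᴴ * c m.rev) := by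
    rw [commutator_mul, hmc, hmc, hw, hz, Fin.rev_rev]
    simp only [add_mul, mul_add, smul_mul_assoc, mul_smul_comm, star_neg, ha]
    module
  have h3 (m : Fin N) : X * (c m.rev * c m) - c m.rev * c m * X =
      -((2 * (z m : ℂ)) • (c m.rev * c m)) -
        w m • (1 - (c m)ᴴ * c m - (c m.rev)ᴴ * c m.rev) := by
    rw [commutator_mul, hm, hm, hw, hz, Fin.rev_rev]
    simp only [mul_sub, sub_mul, mul_neg, neg_mul, neg_smul, smul_mul_assoc, mul_smul_comm, ha]
    module
  set t : Fin N → ℂ := fun m => w' m * star (w m) - star (w' m) * w m with ht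
  have hsum : ∑ m, t m • ((c m.rev)ᴴ * c m.rev) = ∑ m, t m • ((c m)ᴴ * c m) := by
    rw [← Equiv.sum_comp Fin.revPerm]
    refine Finset.sum_congr rfl fun m _ => ?_
    simp [ht, hw, hw']
  have hexp : X * quad c z' w' - quad c z' w' * X =
      ∑ m, ((z m * w' m - z' m * w m) • ((c m)ᴴ * (c m.rev)ᴴ)
        + (z' m * star (w m) - z m * star (w' m)) • (c m.rev * c m)
        + (t m / 2) • (1 - (c m)ᴴ * c m)) - (1 / 2 : ℂ) • ∑ m, t m • ((c m.rev)ᴴ * c m.rev) := by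
    rw [quad, Finset.sum_mul, Finset.mul_sum, ← Finset.sum_sub_distrib, Finset.smul_sum,
      ← Finset.sum_sub_distrib]
    refine Finset.sum_congr rfl fun m _ => ?_
    calc _ = (z' m : ℂ) • (X * ((c m)ᴴ * c m) - (c m)ᴴ * c m * X)
        + (1 / 2 : ℂ) • (w' m • (X * ((c m)ᴴ * (c m.rev)ᴴ) - (c m)ᴴ * (c m.rev)ᴴ * X)
          + star (w' m) • (X * (c m.rev * c m) - c m.rev * c m * X)) := by
          simp only [add_mul, mul_add, sub_mul, mul_sub, smul_mul_assoc, mul_smul_comm, one_mul,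
            mul_one]
          module
      _ = _ := by
        rw [h1, h2, h3, ht]
        module
  rw [hexp, hsum, Finset.smul_sum, ← Finset.sum_sub_distrib, quad, Finset.smul_sum]
  refine Finset.sum_congr rfl fun m _ => ?_
  have hi : ((2 * (star (w m) * w' m).im : ℝ) : ℂ) = -(Complex.I * t m) := by
    simp only [ht]
    refine Complex.ext ?_ ?_
    · simp; ring
    · simp
  have hs : star (2 * Complex.I * (z m * w' m - z' m * w m)) =
      2 * Complex.I * (z' m * star (w m) - z m * star (w' m)) := by
    simp only [Complex.star_def, map_mul, map_sub, Complex.conj_I, Complex.conj_ofReal,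
      Complex.conj_ofNat]
    ring
  rw [hi, hs]
  module

end Commutators

section Evolution

open scoped Matrix.Norms.Operator

variable {N : ℕ}

lemma evolution_conjTranspose {H : Op N} (hH : Hᴴ = H) (τ : ℝ) :
    (evolution H τ)ᴴ = NormedSpace.exp ((Complex.I * τ) • H) := by
  unfold evolution
  rw [← Matrix.exp_conjTranspose, Matrix.conjTranspose_smul, hH]
  simp

lemma evolution_conjTranspose_mul {H : Op N} (hH : Hᴴ = H) (τ : ℝ) :
    (evolution H τ)ᴴ * evolution H τ = 1 := by
  rw [evolution_conjTranspose hH, evolution, ← Matrix.exp_add_of_commute]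
  · rw [← add_smul]; simp
  · exact ((Commute.refl H).smul_left _).smul_right _

lemma hasDerivAt_evolution (H : Op N) (τ : ℝ) :
    HasDerivAt (evolution H) (-(Complex.I • (H * evolution H τ))) τ := by
  have h := hasDerivAt_exp_smul_const' (𝕂 := ℝ) (-(Complex.I • H)) τ
  have e (s : ℝ) : evolution H s = NormedSpace.exp (s • -(Complex.I • H)) := by
    unfold evolution
    rw [← Complex.coe_smul, smul_neg, smul_smul, neg_smul, mul_comm]
  have e' : evolution H = fun s : ℝ => NormedSpace.exp (s • -(Complex.I • H)) := funext e
  have hv : -(Complex.I • (H * evolution H τ)) =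
      -(Complex.I • H) * NormedSpace.exp (τ • -(Complex.I • H)) := by
    rw [e, neg_mul, smul_mul_assoc]
  rw [hv, e']
  exact h

lemma hasDerivAt_evolution_conjTranspose {H : Op N} (hH : Hᴴ = H) (τ : ℝ) :
    HasDerivAt (fun s => (evolution H s)ᴴ) (Complex.I • ((evolution H τ)ᴴ * H)) τ := by
  have h := hasDerivAt_exp_smul_const (𝕂 := ℝ) (Complex.I • H) τ
  have e (s : ℝ) : (evolution H s)ᴴ = NormedSpace.exp (s • (Complex.I • H)) := by
    rw [evolution_conjTranspose hH, ← Complex.coe_smul, smul_smul, mul_comm]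
  simp only [e]
  rw [← mul_smul_comm]
  exact h

/-- A solution of the Heisenberg equation of motion is the conjugation of its initial value by
the evolution operator. -/
lemma evolution_conj_eq {H : Op N} (hH : Hᴴ = H) {F F' : ℝ → Op N}
    (hF : ∀ τ, HasDerivAt F (F' τ) τ) (h : ∀ τ, F' τ = Complex.I • (H * F τ - F τ * H)) (τ : ℝ) :
    (evolution H τ)ᴴ * F 0 * evolution H τ = F τ := by
  have hW (s : ℝ) : HasDerivAt (fun s => evolution H s * F s * (evolution H s)ᴴ) 0 s := by
    have hd := ((hasDerivAt_evolution H s).mul (hF s)).mul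
      (hasDerivAt_evolution_conjTranspose hH s)
    have hz : (-(Complex.I • (H * evolution H s)) * F s + evolution H s * F' s) *
        (evolution H s)ᴴ + evolution H s * F s * (Complex.I • ((evolution H s)ᴴ * H)) = 0 := by
      have h1 : evolution H s * H = H * evolution H s := by
        unfold evolution
        exact (((Commute.refl H).smul_left _).exp_left).eq
      have h2 : H * (evolution H s)ᴴ = (evolution H s)ᴴ * H := by
        have := congrArg (·ᴴ) h1
        simpa only [Matrix.conjTranspose_mul, hH] using this
      rw [h, ← h1, ← h2]
      simp only [neg_mul, smul_mul_assoc, mul_smul_comm, mul_sub, sub_mul, smul_sub, add_mul,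
        mul_assoc]
      abel
    rw [← hz]
    exact hd
  have hconst := is_const_of_deriv_eq_zero (fun s => (hW s).differentiableAt)
    (fun s => (hW s).deriv) 0 τ
  have h0 : evolution H 0 = 1 := by simp [evolution]
  simp only [h0, Matrix.conjTranspose_one, one_mul, mul_one] at hconst
  have hu := evolution_conjTranspose_mul hH τ
  rw [hconst]
  calc _ = ((evolution H τ)ᴴ * evolution H τ) * F τ * ((evolution H τ)ᴴ * evolution H τ) := by
        simp only [mul_assoc]
    _ = _ := by rw [hu, one_mul, mul_one]

lemma hasDerivAt_quad {c : Fin N → Op N} {z z' : ℝ → Fin N → ℝ} {w w' : ℝ → Fin N → ℂ} {τ : ℝ}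
    (hz : ∀ n, HasDerivAt (fun s => z s n) (z' τ n) τ)
    (hw : ∀ n, HasDerivAt (fun s => w s n) (w' τ n) τ) :
    HasDerivAt (fun s => quad c (z s) (w s)) (quad c (z' τ) (w' τ)) τ := by
  unfold quad
  refine HasDerivAt.fun_sum fun n _ => ?_
  refine ((hz n).ofReal_comp.smul_const _).add (HasDerivAt.const_smul (1 / 2 : ℂ) ?_)
  exact ((hw n).smul_const _).add ((hw n).star.smul_const _)

end Evolution

/-! ### Fisher information and spectrum of free modes -/

/-- The canonical anticommutation relations for a family of modes. -/
def IsCAR {N : ℕ} (c : Fin N → Op N) : Prop :=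
  (∀ m n, c m * c n + c n * c m = 0) ∧
  (∀ m n, c m * (c n)ᴴ + (c n)ᴴ * c m = if m = n then 1 else 0)

lemma IsCAR.conjTranspose {N : ℕ} {c : Fin N → Op N} (h : IsCAR c) : IsCAR fun n => (c n)ᴴ := by
  refine ⟨fun m n => ?_, fun m n => ?_⟩
  · rw [← Matrix.conjTranspose_mul, ← Matrix.conjTranspose_mul, ← Matrix.conjTranspose_add, h.1,
      Matrix.conjTranspose_zero]
  · rw [Matrix.conjTranspose_conjTranspose, add_comm, h.2]
    simp only [eq_comm]

lemma isCAR_fourier {N : ℕ} : IsCAR (fourier : Fin N → Op N) :=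
  ⟨fourier_anticomm, fourier_anticomm_conjTranspose⟩

/-- The modes can be filled one after another: if `cᵢ† v` vanishes, the mode `i` of `v` is already
occupied. -/
lemma IsCAR.exists_filled {N : ℕ} {c : Fin N → Op N} (h : IsCAR c) (S : Finset (Fin N)) :
    ∃ v : Finset (Fin N) → ℂ, v ≠ 0 ∧ ∀ i ∈ S, ((c i)ᴴ * c i) *ᵥ v = v := by
  classical
  induction S using Finset.induction_on with
  | empty => exact ⟨fun _ => 1, fun h => one_ne_zero (congrFun h ∅), by simp⟩
  | insert m S hm ih =>
    obtain ⟨v, hv, hS⟩ := ih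
    have h0 : c m * (c m)ᴴ = 1 - (c m)ᴴ * c m := by
      rw [eq_sub_iff_add_eq, h.2, if_pos rfl]
    by_cases hz : (c m)ᴴ *ᵥ v = 0
    · refine ⟨v, hv, fun i hi => ?_⟩
      rcases Finset.mem_insert.1 hi with rfl | hi
      · have : c i *ᵥ ((c i)ᴴ *ᵥ v) = 0 := by rw [hz, Matrix.mulVec_zero]
        rw [Matrix.mulVec_mulVec, h0, Matrix.sub_mulVec, Matrix.one_mulVec, sub_eq_zero] at this
        exact this.symm
      · exact hS i hi
    · refine ⟨(c m)ᴴ *ᵥ v, hz, fun i hi => ?_⟩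
      rcases Finset.mem_insert.1 hi with rfl | hi
      · have hcc : (c i)ᴴ * (c i)ᴴ = 0 := by
          have := h.conjTranspose.1 i i
          rwa [← two_smul ℂ, smul_eq_zero_iff_right two_ne_zero] at this
        rw [Matrix.mulVec_mulVec, mul_assoc, h0, mul_sub, mul_one, ← mul_assoc, hcc, zero_mul,
          sub_zero]
      · have him : i ≠ m := fun e => hm (e ▸ hi)
        have h1 : c i * (c m)ᴴ = -((c m)ᴴ * c i) := by
          rw [eq_neg_iff_add_eq_zero, h.2, if_neg him]
        have h2 : (c i)ᴴ * (c m)ᴴ = -((c m)ᴴ * (c i)ᴴ) := by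
          rw [eq_neg_iff_add_eq_zero]
          exact h.conjTranspose.1 i m
        have h3 : (c i)ᴴ * c i * (c m)ᴴ = (c m)ᴴ * ((c i)ᴴ * c i) := by
          rw [mul_assoc, h1, mul_neg, ← mul_assoc, h2, neg_mul, neg_neg, mul_assoc]
        rw [Matrix.mulVec_mulVec, h3, ← Matrix.mulVec_mulVec, hS i hi]

/-- The Hilbert space norm of a state vector. -/
noncomputable def stateNorm {N : ℕ} (v : Finset (Fin N) → ℂ) : ℝ := ‖WithLp.toLp 2 v‖

section Norm

variable {N : ℕ}

lemma star_dotProduct_self (v : Finset (Fin N) → ℂ) :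
    star v ⬝ᵥ v = ((stateNorm v ^ 2 : ℝ) : ℂ) := by
  have h := EuclideanSpace.inner_eq_star_dotProduct (𝕜 := ℂ) (WithLp.toLp 2 v) (WithLp.toLp 2 v)
  rw [inner_self_eq_norm_sq_to_K] at h
  rw [dotProduct_comm]
  simpa [stateNorm] using h.symm

lemma stateNorm_smul (a : ℂ) (v : Finset (Fin N) → ℂ) : stateNorm (a • v) = ‖a‖ * stateNorm v := by
  unfold stateNorm
  rw [WithLp.toLp_smul, norm_smul]

lemma stateNorm_pos {v : Finset (Fin N) → ℂ} (hv : v ≠ 0) : 0 < stateNorm v := by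
  unfold stateNorm
  rw [norm_pos_iff]
  exact fun h => hv (by simpa using h)

lemma stateNorm_nonneg (v : Finset (Fin N) → ℂ) : 0 ≤ stateNorm v := norm_nonneg _

lemma stateNorm_sum_le {ι : Type*} (s : Finset ι) (f : ι → Finset (Fin N) → ℂ) :
    stateNorm (∑ i ∈ s, f i) ≤ ∑ i ∈ s, stateNorm (f i) := by
  unfold stateNorm
  rw [WithLp.toLp_sum]
  exact norm_sum_le _ _

lemma star_dotProduct_mulVec (A : Op N) (v w : Finset (Fin N) → ℂ) :
    star v ⬝ᵥ (A *ᵥ w) = star (Aᴴ *ᵥ v) ⬝ᵥ w := by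
  rw [Matrix.star_mulVec, Matrix.conjTranspose_conjTranspose, Matrix.dotProduct_mulVec]

lemma stateNorm_mulVec_of_unitary {A : Op N} (hA : Aᴴ * A = 1) (v : Finset (Fin N) → ℂ) :
    stateNorm (A *ᵥ v) = stateNorm v := by
  have h := star_dotProduct_self (A *ᵥ v)
  rw [star_dotProduct_mulVec, Matrix.mulVec_mulVec, hA, Matrix.one_mulVec,
    star_dotProduct_self] at h
  have h' : stateNorm v ^ 2 = stateNorm (A *ᵥ v) ^ 2 := by exact_mod_cast h
  exact ((pow_left_inj₀ (stateNorm_nonneg _) (stateNorm_nonneg _) two_ne_zero).1 h').symm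

lemma expect_mul_self {G : Op N} (hG : Gᴴ = G) (v : Finset (Fin N) → ℂ) :
    expect (G * G) v = stateNorm (G *ᵥ v) ^ 2 := by
  unfold expect
  rw [← Matrix.mulVec_mulVec, star_dotProduct_mulVec, hG, star_dotProduct_self, Complex.ofReal_re]

end Norm

/-- The operator `∑ₙ Eₙ (ψₙ† ψₙ - 1/2)` of free modes. -/
noncomputable def freeOp {N : ℕ} (ψ : Fin N → Op N) (E : Fin N → ℝ) : Op N :=
  ∑ n, E n • ((ψ n)ᴴ * ψ n - (1 / 2 : ℝ) • (1 : Op N))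

section FreeOp

variable {N : ℕ} {ψ : Fin N → Op N} {E : Fin N → ℝ}

lemma freeOp_conjTranspose : (freeOp ψ E)ᴴ = freeOp ψ E := by
  unfold freeOp
  rw [Matrix.conjTranspose_sum]
  refine Finset.sum_congr rfl fun n _ => ?_
  simp [Matrix.conjTranspose_smul]

/-- `2 ψ† ψ - 1` is a Hermitian unitary. -/
lemma IsCAR.stateNorm_number_sub_half (h : IsCAR ψ) (n : Fin N) (v : Finset (Fin N) → ℂ) :
    stateNorm (((ψ n)ᴴ * ψ n - (1 / 2 : ℝ) • (1 : Op N)) *ᵥ v) = 1 / 2 * stateNorm v := by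
  set P := (ψ n)ᴴ * ψ n with hP
  have hPH : Pᴴ = P := by simp [hP]
  have hcc : (ψ n)ᴴ * (ψ n)ᴴ = 0 := by
    have := h.conjTranspose.1 n n
    rwa [← two_smul ℂ, smul_eq_zero_iff_right two_ne_zero] at this
  have h0 : ψ n * (ψ n)ᴴ = 1 - (ψ n)ᴴ * ψ n := by
    rw [eq_sub_iff_add_eq, h.2, if_pos rfl]
  have hPP : P * P = P := by
    rw [hP, mul_assoc, ← mul_assoc (ψ n), h0, sub_mul, one_mul, mul_sub, mul_assoc, ← mul_assoc,
      hcc, zero_mul, sub_zero]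
  have hU : ((2 : ℂ) • P - 1)ᴴ * ((2 : ℂ) • P - 1) = 1 := by
    have h2 : ((2 : ℂ) • P - 1)ᴴ = (2 : ℂ) • P - 1 := by
      simp [Matrix.conjTranspose_smul, hPH]
    rw [h2, mul_sub, sub_mul, smul_mul_smul_comm, hPP]
    simp only [one_mul, mul_one]
    module
  have he : (P - (1 / 2 : ℝ) • (1 : Op N)) *ᵥ v = (1 / 2 : ℂ) • (((2 : ℂ) • P - 1) *ᵥ v) := by
    rw [← Matrix.smul_mulVec]
    congr 1
    rw [← Complex.coe_smul]
    push_cast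
    module
  rw [he, stateNorm_smul, stateNorm_mulVec_of_unitary hU]
  norm_num

lemma IsCAR.stateNorm_freeOp_le (h : IsCAR ψ) (hE : ∀ n, 0 ≤ E n) (v : Finset (Fin N) → ℂ) :
    stateNorm (freeOp ψ E *ᵥ v) ≤ (∑ n, E n) / 2 * stateNorm v := by
  unfold freeOp
  rw [Matrix.sum_mulVec]
  refine (stateNorm_sum_le _ _).trans (le_of_eq ?_)
  rw [Finset.sum_div, Finset.sum_mul]
  refine Finset.sum_congr rfl fun n _ => ?_
  rw [← Complex.coe_smul, Matrix.smul_mulVec, stateNorm_smul, h.stateNorm_number_sub_half,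
    Complex.norm_real, Real.norm_of_nonneg (hE n)]
  ring

lemma freeOp_mulVec_of_number {v : Finset (Fin N) → ℂ} {x : ℝ}
    (hv : ∀ n, ((ψ n)ᴴ * ψ n) *ᵥ v = (x : ℂ) • v) :
    freeOp ψ E *ᵥ v = (((x - 1 / 2) * ∑ n, E n : ℝ) : ℂ) • v := by
  unfold freeOp
  rw [Matrix.sum_mulVec, Finset.mul_sum, Complex.ofReal_sum, Finset.sum_smul]
  refine Finset.sum_congr rfl fun n _ => ?_
  rw [← Complex.coe_smul, ← Complex.coe_smul, Matrix.smul_mulVec, Matrix.sub_mulVec, hv,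
    Matrix.smul_mulVec, Matrix.one_mulVec]
  push_cast
  module

/-- The fully occupied and the empty state of the modes: normalized, orthogonal eigenvectors to
the extreme eigenvalues. -/
lemma IsCAR.exists_extreme (h : IsCAR ψ) (hN : 0 < N) (E : Fin N → ℝ) :
    ∃ v w : Finset (Fin N) → ℂ, star v ⬝ᵥ v = 1 ∧ star w ⬝ᵥ w = 1 ∧ star v ⬝ᵥ w = 0 ∧
      freeOp ψ E *ᵥ v = (((∑ n, E n) / 2 : ℝ) : ℂ) • v ∧
      freeOp ψ E *ᵥ w = (-((∑ n, E n) / 2 : ℝ) : ℂ) • w := by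
  obtain ⟨v, hv, hv1⟩ := h.exists_filled Finset.univ
  obtain ⟨w, hw, hw1⟩ := h.conjTranspose.exists_filled Finset.univ
  have normalize (u : Finset (Fin N) → ℂ) (hu : u ≠ 0) :
      star (((stateNorm u)⁻¹ : ℂ) • u) ⬝ᵥ (((stateNorm u)⁻¹ : ℂ) • u) = 1 := by
    have hp := stateNorm_pos hu
    rw [star_dotProduct_self, stateNorm_smul]
    simp [abs_of_pos hp, hp.ne']
  have hv2 (n : Fin N) : ((ψ n)ᴴ * ψ n) *ᵥ v = ((1 : ℝ) : ℂ) • v := by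
    rw [hv1 n (Finset.mem_univ _)]; simp
  have hw2 (n : Fin N) : ((ψ n)ᴴ * ψ n) *ᵥ w = ((0 : ℝ) : ℂ) • w := by
    have h1 := hw1 n (Finset.mem_univ _)
    rw [Matrix.conjTranspose_conjTranspose] at h1
    have h2 : (ψ n)ᴴ * ψ n = 1 - ψ n * (ψ n)ᴴ := by
      rw [eq_sub_iff_add_eq, add_comm, h.2, if_pos rfl]
    rw [h2, Matrix.sub_mulVec, h1, Matrix.one_mulVec]; simp
  have horth : star v ⬝ᵥ w = 0 := by
    have e : ((ψ ⟨0, hN⟩)ᴴ * ψ ⟨0, hN⟩)ᴴ *ᵥ v = v := by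
      rw [Matrix.conjTranspose_mul, Matrix.conjTranspose_conjTranspose,
        hv1 _ (Finset.mem_univ _)]
    rw [← e, ← star_dotProduct_mulVec, hw2]; simp
  refine ⟨((stateNorm v)⁻¹ : ℂ) • v, ((stateNorm w)⁻¹ : ℂ) • w, normalize v hv, normalize w hw,
    ?_, ?_, ?_⟩
  · rw [star_smul, smul_dotProduct, dotProduct_smul, horth]; simp
  · rw [Matrix.mulVec_smul, freeOp_mulVec_of_number hv2, smul_comm]
    congr 2; ring
  · rw [Matrix.mulVec_smul, freeOp_mulVec_of_number hw2, smul_comm]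
    congr 2; push_cast; ring

/-- The variance is maximal in the equal superposition of two extreme eigenvectors. -/
lemma IsCAR.isGreatest_fisherValues (h : IsCAR ψ) (hN : 0 < N) (hE : ∀ n, 0 ≤ E n) :
    IsGreatest (fisherValues (freeOp ψ E)) ((∑ n, E n) ^ 2) := by
  have hG := freeOp_conjTranspose (ψ := ψ) (E := E)
  constructor
  · obtain ⟨v, w, hv, hw, hvw, hGv, hGw⟩ := h.exists_extreme hN E
    have hwv : star w ⬝ᵥ v = 0 := by
      have := congrArg star hvw
      rwa [← Matrix.star_dotProduct_star, star_star, star_zero] at this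
    have hs : (((√2)⁻¹ : ℝ) : ℂ) * ((√2)⁻¹ : ℝ) = 1 / 2 := by
      rw [← Complex.ofReal_mul, ← mul_inv, Real.mul_self_sqrt (by norm_num)]
      norm_num
    set r : ℂ := (((√2)⁻¹ : ℝ) : ℂ) with hr
    have hsr : star r = r := Complex.conj_ofReal _
    set S : ℝ := (∑ n, E n) / 2 with hS
    have hGu : freeOp ψ E *ᵥ (r • (v + w)) = (S * r : ℂ) • (v - w) := by
      rw [Matrix.mulVec_smul, Matrix.mulVec_add, hGv, hGw]
      module
    refine ⟨r • (v + w), ?_, ?_⟩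
    · rw [star_smul, smul_dotProduct, dotProduct_smul, star_add, add_dotProduct, dotProduct_add,
        dotProduct_add, hv, hw, hvw, hwv, hsr]
      simp only [smul_eq_mul]
      linear_combination (2 : ℂ) * hs
    · have e1 : expect (freeOp ψ E) (r • (v + w)) = 0 := by
        unfold expect
        rw [hGu, star_smul, smul_dotProduct, dotProduct_smul, star_add, add_dotProduct,
          dotProduct_sub, dotProduct_sub, hv, hw, hvw, hwv]
        simp
      have e2 : expect (freeOp ψ E * freeOp ψ E) (r • (v + w)) = S ^ 2 := by
        unfold expect
        rw [← Matrix.mulVec_mulVec, star_dotProduct_mulVec, hG, hGu, star_smul, smul_dotProduct,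
          dotProduct_smul, star_sub, sub_dotProduct, dotProduct_sub, dotProduct_sub, hv, hw, hvw,
          hwv, star_mul', hsr, Complex.star_def, Complex.conj_ofReal]
        simp only [smul_eq_mul]
        have : (S : ℂ) * r * (S * r * (1 - 0 - (0 - 1))) = ((S ^ 2 : ℝ) : ℂ) := by
          push_cast
          linear_combination (2 * (S : ℂ) ^ 2) * hs
        rw [this, Complex.ofReal_re]
      rw [variance, e1, e2, hS]
      ring
  · rintro x ⟨v, hv, rfl⟩
    have hn : stateNorm v = 1 := by
      rw [star_dotProduct_self] at hv
      have : stateNorm v ^ 2 = 1 := by exact_mod_cast hv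
      exact (pow_eq_one_iff_of_nonneg (stateNorm_nonneg v) two_ne_zero).1 this
    have hle := h.stateNorm_freeOp_le hE v
    rw [hn, mul_one] at hle
    have h2 := pow_le_pow_left₀ (stateNorm_nonneg _) hle 2
    rw [variance, expect_mul_self hG]
    nlinarith [sq_nonneg (expect (freeOp ψ E) v)]

lemma IsCAR.spread_freeOp (h : IsCAR ψ) (hN : 0 < N) (hE : ∀ n, 0 ≤ E n) :
    spread (freeOp ψ E) = ∑ n, E n := by
  obtain ⟨v, w, hv, hw, -, hGv, hGw⟩ := h.exists_extreme hN E
  have hmem (u : Finset (Fin N) → ℂ) (x : ℝ) (hu : star u ⬝ᵥ u = 1)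
      (hx : freeOp ψ E *ᵥ u = (x : ℂ) • u) : x ∈ spectrum ℝ (freeOp ψ E) := by
    rw [spectrum.mem_iff]
    intro hunit
    obtain ⟨B, hB⟩ := hunit.exists_left_inv
    have h0 : (algebraMap ℝ (Op N) x - freeOp ψ E) *ᵥ u = 0 := by
      rw [Algebra.algebraMap_eq_smul_one, Matrix.sub_mulVec, hx, ← Complex.coe_smul,
        Matrix.smul_mulVec, Matrix.one_mulVec, sub_self]
    have h1 : u = 0 := by
      rw [← Matrix.one_mulVec u, ← hB, ← Matrix.mulVec_mulVec, h0, Matrix.mulVec_zero]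
    rw [h1] at hu
    simp at hu
  have hbd (x : ℝ) (hx : x ∈ spectrum ℝ (freeOp ψ E)) : |x| ≤ (∑ n, E n) / 2 := by
    rw [spectrum.mem_iff, Matrix.isUnit_iff_isUnit_det, isUnit_iff_ne_zero, not_not,
      ← Matrix.exists_mulVec_eq_zero_iff] at hx
    obtain ⟨u, hu, h0⟩ := hx
    rw [Algebra.algebraMap_eq_smul_one, Matrix.sub_mulVec, ← Complex.coe_smul,
      Matrix.smul_mulVec, Matrix.one_mulVec, sub_eq_zero] at h0
    have h1 := h.stateNorm_freeOp_le hE u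
    rw [← h0, stateNorm_smul, Complex.norm_real, Real.norm_eq_abs] at h1
    exact le_of_mul_le_mul_right h1 (stateNorm_pos hu)
  have hmax : IsGreatest (spectrum ℝ (freeOp ψ E)) ((∑ n, E n) / 2) :=
    ⟨hmem v _ hv hGv, fun x hx => (abs_le.1 (hbd x hx)).2⟩
  have hmin : IsLeast (spectrum ℝ (freeOp ψ E)) (-((∑ n, E n) / 2)) :=
    ⟨hmem w _ hw (by rw [hGw]; push_cast; rfl), fun x hx => (abs_le.1 (hbd x hx)).1⟩
  rw [spread, hmax.csSup_eq, hmin.csInf_eq]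
  ring

end FreeOp

/-! ### Bogoliubov diagonalization -/

/-- Half-angle coefficients: with `E = √(z² + |w|²)`, the coefficients satisfy
`E (|α|² - |β|²) = z` and `2 E α β = w`. The degenerate case is `z = -E`, which forces `w = 0`. -/
lemma exists_bogoliubov_angle (z : ℝ) (w : ℂ) :
    ∃ (α : ℝ) (β : ℂ), α ^ 2 + Complex.normSq β = 1 ∧
      √(z ^ 2 + Complex.normSq w) * (α ^ 2 - Complex.normSq β) = z ∧
      2 * (√(z ^ 2 + Complex.normSq w) : ℂ) * α * β = w := by
  set E := √(z ^ 2 + Complex.normSq w) with hE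
  have hw := Complex.normSq_nonneg w
  have hE2 : E ^ 2 = z ^ 2 + Complex.normSq w := Real.sq_sqrt (by positivity)
  have hE0 : 0 ≤ E := Real.sqrt_nonneg _
  have hEz : 0 ≤ E + z := by
    have : |z| ≤ E := Real.abs_le_sqrt (by linarith)
    linarith [neg_abs_le z]
  rcases hEz.eq_or_lt with h | h
  · have hz : z = -E := by linarith
    have hw0 : Complex.normSq w = 0 := by rw [hz] at hE2; nlinarith
    refine ⟨0, 1, by simp, by simp [hz], ?_⟩
    rw [Complex.normSq_eq_zero] at hw0
    simp [hw0]
  · have hEpos : 0 < E := by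
      rcases hE0.eq_or_lt with h0 | h0
      · exfalso
        have : z ^ 2 + Complex.normSq w = 0 := by rw [← hE2, ← h0]; norm_num
        have : z = 0 := by nlinarith [sq_nonneg z]
        linarith
      · exact h0
    set d := √(2 * E * (E + z)) with hd
    have hd2 : d ^ 2 = 2 * E * (E + z) := Real.sq_sqrt (by positivity)
    have hdpos : 0 < d := Real.sqrt_pos.2 (by positivity)
    have hn : Complex.normSq (w / d) = Complex.normSq w / d ^ 2 := by
      rw [Complex.normSq_div, Complex.normSq_ofReal, sq]
    have hnw : Complex.normSq w = E ^ 2 - z ^ 2 := by linarith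
    refine ⟨(E + z) / d, w / d, ?_, ?_, ?_⟩
    · rw [hn, div_pow, ← add_div, hd2, hnw, div_eq_one_iff_eq (by positivity)]
      ring
    · rw [hn, div_pow, ← sub_div, hd2, hnw]
      field_simp
      ring
    · have hdc : (d : ℂ) ^ 2 = 2 * E * (E + z) := by exact_mod_cast hd2
      have hdn : (d : ℂ) ≠ 0 := by exact_mod_cast hdpos.ne'
      push_cast
      field_simp
      linear_combination -w * hdc

/-- Every quadratic operator that couples only opposite momenta is diagonalized by a Bogoliubov
transformation. The sign of the second coefficient is opposite on the two momenta of a pair, as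
the anticommutation relations require. -/
lemma exists_bogoliubov_quad {N : ℕ} (he : Even N) {z : Fin N → ℝ} {w : Fin N → ℂ}
    (hz : ∀ n, z n.rev = z n) (hw : ∀ n, w n.rev = -w n) :
    ∃ ψ : Fin N → Op N, IsBogoliubov ψ ∧
      quad fourier z w = freeOp ψ fun n => √(z n ^ 2 + Complex.normSq (w n)) := by
  choose α₀ β₀ h1 h2 h3 using fun n : Fin N => exists_bogoliubov_angle (z n) (w n)
  have hne (n : Fin N) : n ≠ n.rev := by
    intro h
    have := congrArg Fin.val h
    rw [Fin.val_rev] at this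
    obtain ⟨M, hM⟩ := he
    have := n.2
    omega
  have hlt (n : Fin N) (h : ¬ n < n.rev) : n.rev < n.rev.rev := by
    rw [Fin.rev_rev]; exact lt_of_le_of_ne (not_lt.1 h) (hne n).symm
  have hlt' (n : Fin N) (h : n < n.rev) : ¬ n.rev < n.rev.rev := by
    rw [Fin.rev_rev]; exact h.not_gt
  set α : Fin N → ℝ := fun n => if n < n.rev then α₀ n else α₀ n.rev with hα
  set β : Fin N → ℂ := fun n => if n < n.rev then β₀ n else -β₀ n.rev with hβ
  set E : Fin N → ℝ := fun n => √(z n ^ 2 + Complex.normSq (w n)) with hE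
  have hEr (n : Fin N) : E n.rev = E n := by simp [hE, hz, hw]
  have hαr (n : Fin N) : α n.rev = α n := by
    by_cases h : n < n.rev
    · simp only [hα, if_pos h, if_neg (hlt' n h), Fin.rev_rev]
    · simp only [hα, if_neg h, if_pos (hlt n h)]
  have hβr (n : Fin N) : β n.rev = -β n := by
    by_cases h : n < n.rev
    · simp only [hβ, if_pos h, if_neg (hlt' n h), Fin.rev_rev]
    · simp only [hβ, if_neg h, if_pos (hlt n h), neg_neg]
  have key1 (n : Fin N) : α n ^ 2 + Complex.normSq (β n) = 1 := by
    by_cases h : n < n.rev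
    · simp only [hα, hβ, if_pos h, h1]
    · simp only [hα, hβ, if_neg h, Complex.normSq_neg, h1]
  have key2 (n : Fin N) : E n * (α n ^ 2 - Complex.normSq (β n)) = z n := by
    by_cases h : n < n.rev
    · simp only [hα, hβ, hE, if_pos h, h2]
    · have := h2 n.rev
      simp only [hz, hw, Complex.normSq_neg] at this
      simp only [hα, hβ, hE, if_neg h, Complex.normSq_neg, this]
  have key3 (n : Fin N) : 2 * (E n : ℂ) * α n * β n = w n := by
    by_cases h : n < n.rev
    · simp only [hα, hβ, hE, if_pos h, h3]
    · have := h3 n.rev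
      simp only [hz, hw, Complex.normSq_neg] at this
      simp only [hα, hβ, hE, if_neg h]
      linear_combination -this
  have hββ (n : Fin N) : star (β n) * β n = ((Complex.normSq (β n) : ℝ) : ℂ) :=
    Complex.normSq_eq_conj_mul_self.symm
  set ψ : Fin N → Op N := fun n => (α n : ℂ) • fourier n + β n • (fourier n.rev)ᴴ with hψ
  have hψc (n : Fin N) : (ψ n)ᴴ = (α n : ℂ) • (fourier n)ᴴ + star (β n) • fourier n.rev := by
    simp [hψ, Matrix.conjTranspose_add, Matrix.conjTranspose_smul]
  have hcc := isCAR_fourier (N := N).1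
  have hcd := isCAR_fourier (N := N).2
  have hccc := (isCAR_fourier (N := N)).conjTranspose.1
  refine ⟨ψ, ⟨?_, fun m n => ?_, fun m n => ?_⟩, ?_⟩
  · refine ⟨fun n j => (α n : ℂ) * ((((√N)⁻¹ : ℝ) : ℂ) * star (phase N n j)),
      fun n j => β n * star ((((√N)⁻¹ : ℝ) : ℂ) * star (phase N n.rev j)), fun n => ?_⟩
    simp only [hψ]
    unfold fourier
    rw [field_conjTranspose]
    simp only [field, Finset.smul_sum, ← Finset.sum_add_distrib, Pi.zero_apply, Pi.star_apply,
      star_zero, zero_smul, add_zero, zero_add, smul_smul]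
  · calc _ = ((α m : ℂ) * α n) • (fourier m * fourier n + fourier n * fourier m : Op N)
          + ((α m : ℂ) * β n) •
            (fourier m * (fourier n.rev)ᴴ + (fourier n.rev)ᴴ * fourier m : Op N)
          + (β m * α n) • (fourier n * (fourier m.rev)ᴴ + (fourier m.rev)ᴴ * fourier n : Op N)
          + (β m * β n) • ((fourier m.rev)ᴴ * (fourier n.rev)ᴴ
            + (fourier n.rev)ᴴ * (fourier m.rev)ᴴ : Op N) := by
          simp only [hψ, add_mul, mul_add, smul_mul_smul_comm]
          module
      _ = 0 := by
        rw [hcc, hcd, hcd, hccc]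
        by_cases h : m = n.rev
        · subst h
          simp only [Fin.rev_rev, if_true, hαr, hβr]
          module
        · have h' : n ≠ m.rev := fun e => h (by rw [e, Fin.rev_rev])
          simp [h, h']
  · rw [hψc]
    calc _ = ((α m : ℂ) * α n) • (fourier m * (fourier n)ᴴ + (fourier n)ᴴ * fourier m : Op N)
          + ((α m : ℂ) * star (β n)) •
            (fourier m * fourier n.rev + fourier n.rev * fourier m : Op N)
          + (β m * α n) • ((fourier m.rev)ᴴ * (fourier n)ᴴ + (fourier n)ᴴ * (fourier m.rev)ᴴ)
          + (β m * star (β n)) • (fourier n.rev * (fourier m.rev)ᴴ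
            + (fourier m.rev)ᴴ * fourier n.rev : Op N) := by
          simp only [hψ, add_mul, mul_add, smul_mul_smul_comm]
          module
      _ = _ := by
        rw [hcc, hcd, hcd, hccc]
        by_cases h : m = n
        · subst h
          simp only [if_true, smul_zero, add_zero]
          rw [← add_smul]
          have : (α m : ℂ) * α m + β m * star (β m) = 1 := by
            rw [mul_comm (β m), hββ, ← sq]
            exact_mod_cast key1 m
          rw [this, one_smul]
        · have h' : n.rev ≠ m.rev := fun e => h (Fin.rev_injective e).symm
          simp [h, h']
  · have hna (n : Fin N) : (fourier n : Op N) * (fourier n)ᴴ = 1 - (fourier n)ᴴ * fourier n := by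
      rw [eq_sub_iff_add_eq, hcd, if_pos rfl]
    have hswap : ∑ n : Fin N, ((E n : ℂ) * Complex.normSq (β n)) •
        ((fourier n.rev)ᴴ * fourier n.rev : Op N) =
        ∑ n : Fin N, ((E n : ℂ) * Complex.normSq (β n)) • ((fourier n)ᴴ * fourier n : Op N) := by
      rw [← Equiv.sum_comp Fin.revPerm]
      refine Finset.sum_congr rfl fun n _ => ?_
      simp [hEr, hβr]
    have hexp : freeOp ψ E = ∑ n : Fin N, (((E n : ℂ) * (α n) ^ 2) • ((fourier n)ᴴ * fourier n)
        + ((E n : ℂ) * Complex.normSq (β n)) • (1 : Op N)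
        + ((E n : ℂ) * α n * β n) • ((fourier n)ᴴ * (fourier n.rev)ᴴ)
        + ((E n : ℂ) * α n * star (β n)) • (fourier n.rev * fourier n)
        - ((E n : ℂ) / 2) • (1 : Op N))
        - ∑ n : Fin N, ((E n : ℂ) * Complex.normSq (β n)) •
          ((fourier n.rev)ᴴ * fourier n.rev : Op N) := by
      rw [freeOp, ← Finset.sum_sub_distrib]
      refine Finset.sum_congr rfl fun n _ => ?_
      rw [← Complex.coe_smul, ← Complex.coe_smul, hψc]
      simp only [hψ, add_mul, mul_add, smul_mul_smul_comm, hna, hββ]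
      push_cast
      module
    rw [hexp, hswap, ← Finset.sum_sub_distrib, quad]
    refine Finset.sum_congr rfl fun n _ => ?_
    have k1 : (α n : ℂ) ^ 2 = 1 - Complex.normSq (β n) := by
      have := key1 n
      rw [eq_sub_iff_add_eq]; exact_mod_cast this
    have k2 : (z n : ℂ) = E n * ((α n : ℂ) ^ 2 - Complex.normSq (β n)) := by
      exact_mod_cast (key2 n).symm
    have k3 : star (w n) = 2 * (E n : ℂ) * α n * star (β n) := by
      rw [← key3 n]
      simp only [star_mul', Complex.star_def, Complex.conj_ofReal, Complex.conj_ofNat]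
    rw [k2, k3, ← key3 n, k1]
    module

lemma IsBogoliubov.isCAR {N : ℕ} {ψ : Fin N → Op N} (h : IsBogoliubov ψ) : IsCAR ψ := h.2

/-! ### The generator -/

lemma hamiltonian_add (κ : ℝ → ℝ) (N : ℕ) (p q : Coupling → ℝ) :
    hamiltonian κ N (p + q) = hamiltonian κ N p + hamiltonian κ N q := by
  simp only [hamiltonian, Pi.add_apply]
  module

lemma hamiltonian_smul (κ : ℝ → ℝ) (N : ℕ) (x : ℝ) (p : Coupling → ℝ) :
    hamiltonian κ N (x • p) = x • hamiltonian κ N p := by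
  simp only [hamiltonian, Pi.smul_apply, smul_eq_mul]
  module

/-- The Hamiltonian is linear in the couplings, so that its derivative is the Hamiltonian with a
single unit coupling. -/
lemma opDeriv_hamiltonian_add (κ : ℝ → ℝ) (N : ℕ) (θ : Coupling) (p : Coupling → ℝ) (B : Op N) :
    opDeriv θ (fun p' => hamiltonian κ N p' + B) p = hamiltonian κ N (Pi.single θ 1) := by
  have hu (x : ℝ) : Function.update p θ x = p + (x - p θ) • (Pi.single θ 1 : Coupling → ℝ) := by
    ext i
    by_cases h : i = θ
    · subst h; simp
    · simp [h]
  ext s t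
  simp only [opDeriv, Matrix.of_apply, hu, hamiltonian_add, hamiltonian_smul, Matrix.add_apply,
    Matrix.smul_apply]
  set y := hamiltonian κ N (Pi.single θ 1) s t
  have : HasDerivAt (fun x : ℝ => hamiltonian κ N p s t + (x - p θ) • y + B s t) ((1 : ℝ) • y)
      (p θ) :=
    ((((hasDerivAt_id (p θ)).sub_const (p θ)).smul_const y).const_add _).add_const _
  rw [this.deriv, one_smul]

/-- The hopping component `J cos k + μ` of the pseudo-spin at momentum `k`. -/
noncomputable def hop (p : Coupling → ℝ) (k : ℝ) : ℝ := p J * cos k + p mu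

/-- The pairing component `Δ f(k) / 2` of the pseudo-spin at momentum `k`. -/
noncomputable def gap (κ : ℝ → ℝ) (N : ℕ) (p : Coupling → ℝ) (k : ℝ) : ℝ :=
  p Delta * pairingTransform κ N k / 2

/-- `sin (2 e t) / (2 e)`; at `e = 0` the value is `0`, by the convention for division. -/
noncomputable def rotSin (e t : ℝ) : ℝ := sin (2 * e * t) / (2 * e)

/-- The integral of `rotSin e` from `0` to `t`; it vanishes at `e = 0`. -/
noncomputable def rotCos (e t : ℝ) : ℝ := (1 - cos (2 * e * t)) / (4 * e ^ 2)

/-- The integral of `rotCos e` from `0` to `t`; it vanishes at `e = 0`. -/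
noncomputable def rotInt (e t : ℝ) : ℝ := (t - rotSin e t) / (4 * e ^ 2)

lemma hasDerivAt_rotSin {e : ℝ} (he : e ≠ 0) (t : ℝ) :
    HasDerivAt (rotSin e) (cos (2 * e * t)) t := by
  unfold rotSin
  have h1 : HasDerivAt (fun t : ℝ => 2 * e * t) (2 * e) t := by
    simpa using (hasDerivAt_id t).const_mul (2 * e)
  refine (h1.sin.div_const (2 * e)).congr_deriv ?_
  field_simp

/-- By the convention for division, this holds at `e = 0` too, where both functions vanish. -/
lemma hasDerivAt_rotCos (e t : ℝ) : HasDerivAt (rotCos e) (rotSin e t) t := by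
  by_cases he : e = 0
  · subst he
    have : rotCos 0 = fun _ => 0 := by ext; simp [rotCos]
    rw [this, rotSin]; simpa using hasDerivAt_const t (0 : ℝ)
  unfold rotCos rotSin
  have h1 : HasDerivAt (fun t : ℝ => 2 * e * t) (2 * e) t := by
    simpa using (hasDerivAt_id t).const_mul (2 * e)
  refine ((h1.cos.const_sub 1).div_const (4 * e ^ 2)).congr_deriv ?_
  field_simp
  ring

lemma hasDerivAt_rotInt (e t : ℝ) : HasDerivAt (rotInt e) (rotCos e t) t := by
  by_cases he : e = 0
  · subst he
    have : rotInt 0 = fun _ => 0 := by ext; simp [rotInt]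
    rw [this, rotCos]; simpa using hasDerivAt_const t (0 : ℝ)
  exact ((hasDerivAt_id t).sub (hasDerivAt_rotSin he t)).div_const (4 * e ^ 2)

section Generator

open scoped Matrix.Norms.Operator

variable {N : ℕ}

lemma hasDerivAt_entry {F : ℝ → Op N} {F' : Op N} {τ : ℝ} (h : HasDerivAt F F' τ)
    (s t : Finset (Fin N)) : HasDerivAt (fun x => F x s t) (F' s t) τ := by
  have := ((Matrix.entryLinearMap ℝ ℂ s t).toContinuousLinearMap).hasFDerivAt.comp_hasDerivAt τ h
  exact this

/-- Integration of the Heisenberg evolution: every pseudo-spin `(a, b)` of the derivative rotates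
about the pseudo-spin `(A, B)` of the Hamiltonian with frequency `2 √(A² + B²)`. -/
lemma integral_heisenberg_quad {c : Fin N → Op N} (hcar : IsCAR c) {A B a b : Fin N → ℝ}
    (hA : ∀ n, A n.rev = A n) (hB : ∀ n, B n.rev = -B n)
    (ha : ∀ n, a n.rev = a n) (hb : ∀ n, b n.rev = -b n) (T : ℝ) (s t : Finset (Fin N)) :
    ∫ τ in (0 : ℝ)..T,
      ((evolution (quad c (fun n => -A n) fun n => -(Complex.I * B n)) τ)ᴴ *
        quad c (fun n => -a n) (fun n => -(Complex.I * b n)) *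
        evolution (quad c (fun n => -A n) fun n => -(Complex.I * B n)) τ) s t =
    quad c (fun n => -(a n * T) + 4 * B n * (a n * B n - b n * A n) *
        rotInt √(A n ^ 2 + B n ^ 2) T)
      (fun n => ((2 * (a n * B n - b n * A n) * rotCos √(A n ^ 2 + B n ^ 2) T : ℝ) : ℂ)
        - Complex.I * ((b n * T + 4 * A n * (a n * B n - b n * A n) *
          rotInt √(A n ^ 2 + B n ^ 2) T : ℝ) : ℂ)) s t := by
  set H := quad c (fun n => -A n) fun n => -(Complex.I * B n) with hH
  set e : Fin N → ℝ := fun n => √(A n ^ 2 + B n ^ 2) with he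
  set D : Fin N → ℝ := fun n => a n * B n - b n * A n with hD
  have hDr (n : Fin N) : D n.rev = -D n := by simp only [hD, hA, hB, ha, hb]; ring
  have her (n : Fin N) : e n.rev = e n := by simp only [he, hA, hB, neg_sq]
  have he2 (n : Fin N) : e n ^ 2 = A n ^ 2 + B n ^ 2 := Real.sq_sqrt (by positivity)
  -- where the Hamiltonian has no pseudo-spin there is no rotation, and `D = 0` cancels the values
  -- that `rotSin`, `rotCos` and `rotInt` take there by convention
  have hD0 (n : Fin N) (h : e n = 0) : D n = 0 := by
    have h2 := he2 n
    rw [h] at h2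
    have hA0 : A n = 0 := by nlinarith [sq_nonneg (A n), sq_nonneg (B n)]
    have hB0 : B n = 0 := by nlinarith [sq_nonneg (A n), sq_nonneg (B n)]
    simp [hD, hA0, hB0]
  -- the solution of the equation of motion, its derivative, and (below) its integral
  set z : ℝ → Fin N → ℝ := fun τ n => -a n + 4 * B n * D n * rotCos (e n) τ with hz
  set w : ℝ → Fin N → ℂ := fun τ n => ((2 * D n * rotSin (e n) τ : ℝ) : ℂ)
    - Complex.I * ((b n + 4 * A n * D n * rotCos (e n) τ : ℝ) : ℂ) with hw
  set z' : ℝ → Fin N → ℝ := fun τ n => 4 * B n * D n * rotSin (e n) τ with hz'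
  set w' : ℝ → Fin N → ℂ := fun τ n => ((2 * D n * cos (2 * e n * τ) : ℝ) : ℂ)
    - Complex.I * ((4 * A n * D n * rotSin (e n) τ : ℝ) : ℂ) with hw'
  have hsin (n : Fin N) (τ : ℝ) : HasDerivAt (fun x => 2 * D n * rotSin (e n) x)
      (2 * D n * cos (2 * e n * τ)) τ := by
    by_cases h : e n = 0
    · rw [hD0 n h]; simpa using hasDerivAt_const τ (0 : ℝ)
    · exact (hasDerivAt_rotSin h τ).const_mul _
  have hF (τ : ℝ) : HasDerivAt (fun x => quad c (z x) (w x)) (quad c (z' τ) (w' τ)) τ := by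
    refine hasDerivAt_quad (fun n => ?_) (fun n => ?_)
    · exact ((hasDerivAt_rotCos (e n) τ).const_mul _).const_add _
    · exact (hsin n τ).ofReal_comp.sub
        ((((hasDerivAt_rotCos (e n) τ).const_mul _).const_add _).ofReal_comp.const_mul _)
  have heq (τ : ℝ) : quad c (z' τ) (w' τ) =
      Complex.I • (H * quad c (z τ) (w τ) - quad c (z τ) (w τ) * H) := by
    rw [hH, quad_commutator hcar.1 hcar.2]
    · congr 1
      · ext n
        simp [hz', hw]
        ring
      · ext n
        have hcos : D n * (1 - 4 * e n ^ 2 * rotCos (e n) τ) = D n * cos (2 * e n * τ) := by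
          by_cases h : e n = 0
          · rw [hD0 n h]; ring
          · unfold rotCos; field_simp; ring
        have hcos' : 2 * D n * cos (2 * e n * τ) =
            2 * (-A n * (b n + 4 * A n * D n * rotCos (e n) τ)
            + B n * (a n - 4 * B n * D n * rotCos (e n) τ)) := by
          rw [mul_assoc, ← hcos, he2]
          simp only [hD]; ring
        simp only [hw', hz, hw, hcos']
        push_cast
        linear_combination (-2 * ((A n : ℂ) * (b n + 4 * A n * D n * rotCos (e n) τ)
          - B n * (a n - 4 * B n * D n * rotCos (e n) τ))) * Complex.I_sq
    · intro n; simp [hB]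
    · intro n; simp [hA]
    · intro n
      simp only [hw, hDr, her, hA, hb]
      push_cast; ring
  have hconj (τ : ℝ) : (evolution H τ)ᴴ * quad c (fun n => -a n) (fun n => -(Complex.I * b n)) *
      evolution H τ = quad c (z τ) (w τ) := by
    rw [← evolution_conj_eq (quad_conjTranspose _ _) hF heq τ]
    congr 3
    · ext n; simp [hz, rotCos]
    · ext n; simp [hw, rotCos, rotSin]
  simp only [hconj]
  set Z : ℝ → Fin N → ℝ := fun τ n => -(a n * τ) + 4 * B n * D n * rotInt (e n) τ with hZ
  set W : ℝ → Fin N → ℂ := fun τ n => ((2 * D n * rotCos (e n) τ : ℝ) : ℂ)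
    - Complex.I * ((b n * τ + 4 * A n * D n * rotInt (e n) τ : ℝ) : ℂ) with hW
  have hG (τ : ℝ) : HasDerivAt (fun x => quad c (Z x) (W x)) (quad c (z τ) (w τ)) τ := by
    have hl (x : ℝ) : HasDerivAt (fun τ => x * τ) x τ := by
      simpa using (hasDerivAt_id τ).const_mul x
    refine hasDerivAt_quad (fun n => ?_) (fun n => ?_)
    · exact (hl (a n)).neg.add ((hasDerivAt_rotInt (e n) τ).const_mul _)
    · exact ((hasDerivAt_rotCos (e n) τ).const_mul _).ofReal_comp.sub
        (((hl (b n)).add ((hasDerivAt_rotInt (e n) τ).const_mul _)).ofReal_comp.const_mul _)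
  rw [intervalIntegral.integral_eq_sub_of_hasDerivAt (fun τ _ => hasDerivAt_entry (hG τ) s t)]
  · have h0 : quad c (Z 0) (W 0) = 0 := by
      simp [hZ, hW, quad, rotInt, rotCos, rotSin]
    rw [h0, Matrix.zero_apply, sub_zero]
  · exact (continuous_iff_continuousAt.2 fun τ =>
      (hasDerivAt_entry (hF τ) s t).continuousAt).intervalIntegrable _ _

end Generator

/-! ### The Fisher information of the chain -/

/-- The length of the pseudo-spin `∫₀ᵀ v(τ) dτ`, where `v` starts at `(a, b)` and rotates about
`(A, B)`. -/
noncomputable def rotNorm (A B a b T : ℝ) : ℝ :=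
  √((-(a * T) + 4 * B * (a * B - b * A) * rotInt √(A ^ 2 + B ^ 2) T) ^ 2 +
    ((2 * (a * B - b * A) * rotCos √(A ^ 2 + B ^ 2) T) ^ 2 +
      (b * T + 4 * A * (a * B - b * A) * rotInt √(A ^ 2 + B ^ 2) T) ^ 2))

lemma rotNorm_nonneg (A B a b T : ℝ) : 0 ≤ rotNorm A B a b T := Real.sqrt_nonneg _

lemma normSq_sub_I_mul (x y : ℝ) : Complex.normSq ((x : ℂ) - Complex.I * y) = x ^ 2 + y ^ 2 := by
  simp [Complex.normSq_apply]; ring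

section Chain

variable {N : ℕ}

lemma hop_rev (p : Coupling → ℝ) (n : Fin N) :
    hop p (momentum N n.rev) = hop p (momentum N n) := by
  have h := momentum_rev_mul n 1
  simp only [Nat.cast_one, mul_one, one_mul] at h
  rw [hop, hop, h, Real.cos_add_two_pi, Real.cos_neg]

lemma gap_rev (κ : ℝ → ℝ) (p : Coupling → ℝ) (n : Fin N) :
    gap κ N p (momentum N n.rev) = -gap κ N p (momentum N n) := by
  have h (l : ℕ) : sin (momentum N n.rev * l) = -sin (momentum N n * l) := by
    rw [momentum_rev_mul, Real.sin_add_nat_mul_two_pi, Real.sin_neg]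
  simp only [gap, pairingTransform, h, mul_neg, Finset.sum_neg_distrib]
  ring

lemma hamiltonian_eq_quad_hop (κ : ℝ → ℝ) (he : Even N) (hN : 0 < N) (p : Coupling → ℝ) :
    hamiltonian κ N p = quad fourier (fun n => -hop p (momentum N n))
      (fun n => -(Complex.I * gap κ N p (momentum N n))) :=
  hamiltonian_eq_quad κ he hN p

/-- The length of the pseudo-spin of the generator at momentum `k`, for the residual couplings `P`.
Unlike `genSpectrum` it is also meaningful where the energy vanishes. -/
noncomputable def modeNorm (κ : ℝ → ℝ) (N : ℕ) (T k : ℝ) (P : Coupling → ℝ) (θ : Coupling) : ℝ :=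
  rotNorm (hop P k) (gap κ N P k) (hop (Pi.single θ 1) k) (gap κ N (Pi.single θ 1) k) T

/-- The length of the pseudo-spin of `∂_θ H` at momentum `k`. -/
noncomputable def slopeNorm (κ : ℝ → ℝ) (N : ℕ) (k : ℝ) (θ : Coupling) : ℝ :=
  √(hop (Pi.single θ 1) k ^ 2 + gap κ N (Pi.single θ 1) k ^ 2)

lemma exists_bogoliubov_chainGenerator (κ : ℝ → ℝ) (he : Even N) (hN : 0 < N) (T : ℝ)
    (p q : Coupling → ℝ) (θ : Coupling) :
    ∃ ψ : Fin N → Op N, IsBogoliubov ψ ∧ chainGenerator κ N T p q θ =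
      freeOp ψ fun n => modeNorm κ N T (momentum N n) (p + q) θ := by
  set A : Fin N → ℝ := fun n => hop (p + q) (momentum N n) with hA
  set B : Fin N → ℝ := fun n => gap κ N (p + q) (momentum N n) with hB
  set a : Fin N → ℝ := fun n => hop (Pi.single θ 1) (momentum N n) with ha
  set b : Fin N → ℝ := fun n => gap κ N (Pi.single θ 1) (momentum N n) with hb
  have hAr (n : Fin N) : A n.rev = A n := hop_rev _ n
  have hBr (n : Fin N) : B n.rev = -B n := gap_rev κ _ n
  have har (n : Fin N) : a n.rev = a n := hop_rev _ n
  have hbr (n : Fin N) : b n.rev = -b n := gap_rev κ _ n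
  have hG : chainGenerator κ N T p q θ =
      quad fourier (fun n => -(a n * T) + 4 * B n * (a n * B n - b n * A n) *
          rotInt √(A n ^ 2 + B n ^ 2) T)
        (fun n => ((2 * (a n * B n - b n * A n) * rotCos √(A n ^ 2 + B n ^ 2) T : ℝ) : ℂ)
          - Complex.I * ((b n * T + 4 * A n * (a n * B n - b n * A n) *
            rotInt √(A n ^ 2 + B n ^ 2) T : ℝ) : ℂ)) := by
    ext s t
    rw [← integral_heisenberg_quad isCAR_fourier hAr hBr har hbr T s t]
    simp only [chainGenerator, generator, Matrix.of_apply, opDeriv_hamiltonian_add]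
    simp only [← hamiltonian_add]
    rw [hamiltonian_eq_quad_hop κ he hN, hamiltonian_eq_quad_hop κ he hN]
  obtain ⟨ψ, hψ, hq⟩ := exists_bogoliubov_quad he
    (z := fun n => -(a n * T) + 4 * B n * (a n * B n - b n * A n) *
          rotInt √(A n ^ 2 + B n ^ 2) T)
    (w := fun n => ((2 * (a n * B n - b n * A n) * rotCos √(A n ^ 2 + B n ^ 2) T : ℝ) : ℂ)
          - Complex.I * ((b n * T + 4 * A n * (a n * B n - b n * A n) *
            rotInt √(A n ^ 2 + B n ^ 2) T : ℝ) : ℂ))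
    (fun n => by simp only [hAr, hBr, har, hbr, neg_sq]; ring)
    (fun n => by simp only [hAr, hBr, har, hbr, neg_sq]; push_cast; ring)
  refine ⟨ψ, hψ, ?_⟩
  rw [hG, hq]
  simp only [normSq_sub_I_mul]
  rfl

lemma spread_opDeriv_hamiltonian (κ : ℝ → ℝ) (he : Even N) (hN : 0 < N) (p : Coupling → ℝ)
    (θ : Coupling) : spread (opDeriv θ (hamiltonian κ N) p) =
      ∑ n : Fin N, slopeNorm κ N (momentum N n) θ := by
  have h := opDeriv_hamiltonian_add κ N θ p 0
  simp only [add_zero] at h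
  obtain ⟨ψ, hψ, hq⟩ := exists_bogoliubov_quad he
    (z := fun n : Fin N => -hop (Pi.single θ 1) (momentum N n))
    (w := fun n => -(Complex.I * gap κ N (Pi.single θ 1) (momentum N n)))
    (fun n => by rw [hop_rev]) (fun n => by rw [gap_rev]; push_cast; ring)
  rw [h, hamiltonian_eq_quad_hop κ he hN, hq, hψ.isCAR.spread_freeOp hN
    (fun n => Real.sqrt_nonneg _)]
  refine Finset.sum_congr rfl fun n _ => ?_
  rw [slopeNorm]
  congr 1
  simp [Complex.normSq_apply]
  ring

lemma modeNorm_nonneg (κ : ℝ → ℝ) (N : ℕ) (T k : ℝ) (P : Coupling → ℝ) (θ : Coupling) :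
    0 ≤ modeNorm κ N T k P θ := rotNorm_nonneg ..

lemma isGreatest_fisherValues_chain (κ : ℝ → ℝ) (he : Even N) (hN : 0 < N) (T : ℝ)
    (p q : Coupling → ℝ) (θ : Coupling) :
    IsGreatest (fisherValues (chainGenerator κ N T p q θ))
      ((∑ n : Fin N, modeNorm κ N T (momentum N n) (p + q) θ) ^ 2) := by
  obtain ⟨ψ, hψ, hG⟩ := exists_bogoliubov_chainGenerator κ he hN T p q θ
  rw [hG]
  exact hψ.isCAR.isGreatest_fisherValues hN fun n => modeNorm_nonneg _ _ _ _ _ _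

lemma qfi_eq (κ : ℝ → ℝ) (he : Even N) (hN : 0 < N) (T : ℝ)
    (p q : Coupling → ℝ) (θ : Coupling) :
    qfi κ N T p q θ = (∑ n : Fin N, modeNorm κ N T (momentum N n) (p + q) θ) ^ 2 :=
  (isGreatest_fisherValues_chain κ he hN T p q θ).csSup_eq

lemma optimalQFI_eq (κ : ℝ → ℝ) (he : Even N) (hN : 0 < N) (T : ℝ)
    (p : Coupling → ℝ) (θ : Coupling) :
    optimalQFI κ N T p θ = (∑ n : Fin N, T * slopeNorm κ N (momentum N n) θ) ^ 2 := by
  rw [optimalQFI, spread_opDeriv_hamiltonian κ he hN, intervalIntegral.integral_const,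
    ← Finset.mul_sum]
  simp

end Chain

/-! ### The length of an averaged rotating pseudo-spin -/

section RotNorm

variable {A B a b T : ℝ}

lemma rotNorm_sq_eq (h : √(A ^ 2 + B ^ 2) ≠ 0) :
    rotNorm A B a b T ^ 2 = T ^ 2 * ((a * A + b * B) / √(A ^ 2 + B ^ 2)) ^ 2
      + 1 / 4 * ((a * B - b * A) / √(A ^ 2 + B ^ 2) ^ 2) ^ 2 * sin (2 * √(A ^ 2 + B ^ 2) * T) ^ 2
      + 1 / 4 * ((a * B - b * A) / √(A ^ 2 + B ^ 2) ^ 2) ^ 2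
        * (1 - cos (2 * √(A ^ 2 + B ^ 2) * T)) ^ 2 := by
  rw [rotNorm, Real.sq_sqrt (by positivity)]
  have he2 : √(A ^ 2 + B ^ 2) ^ 2 = A ^ 2 + B ^ 2 := Real.sq_sqrt (by positivity)
  set e := √(A ^ 2 + B ^ 2)
  unfold rotInt rotCos rotSin
  set s := sin (2 * e * T)
  set c := cos (2 * e * T)
  -- the components along and across the rotation axis
  have h1 : (-(a * T) + 4 * B * (a * B - b * A) * ((T - s / (2 * e)) / (4 * e ^ 2))) ^ 2 +
      (b * T + 4 * A * (a * B - b * A) * ((T - s / (2 * e)) / (4 * e ^ 2))) ^ 2 =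
      T ^ 2 * ((a * A + b * B) / e) ^ 2 + 1 / 4 * ((a * B - b * A) / e ^ 2) ^ 2 * s ^ 2 := by
    have h2 : -(a * T) + 4 * B * (a * B - b * A) * ((T - s / (2 * e)) / (4 * e ^ 2)) =
        -(T * A * (a * A + b * B) + B * (a * B - b * A) * (s / (2 * e))) / e ^ 2 := by
      field_simp
      linear_combination (-2 * e * T * a) * he2
    have h3 : b * T + 4 * A * (a * B - b * A) * ((T - s / (2 * e)) / (4 * e ^ 2)) =
        (T * B * (a * A + b * B) - A * (a * B - b * A) * (s / (2 * e))) / e ^ 2 := by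
      field_simp
      linear_combination (2 * e * T * b) * he2
    rw [h2, h3, div_pow, div_pow, ← add_div]
    have h4 : (-(T * A * (a * A + b * B) + B * (a * B - b * A) * (s / (2 * e)))) ^ 2 +
        (T * B * (a * A + b * B) - A * (a * B - b * A) * (s / (2 * e))) ^ 2 =
        e ^ 2 * ((T * (a * A + b * B)) ^ 2 + ((a * B - b * A) * (s / (2 * e))) ^ 2) := by
      rw [he2]; ring
    rw [h4]
    field_simp
    ring
  have h5 : (2 * (a * B - b * A) * ((1 - c) / (4 * e ^ 2))) ^ 2 =
      1 / 4 * ((a * B - b * A) / e ^ 2) ^ 2 * (1 - c) ^ 2 := by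
    field_simp; ring
  linarith

lemma rotNorm_sq_eq_sin (h : √(A ^ 2 + B ^ 2) ≠ 0) :
    rotNorm A B a b T ^ 2 = T ^ 2 * ((a * A + b * B) / √(A ^ 2 + B ^ 2)) ^ 2
      + ((a * B - b * A) / √(A ^ 2 + B ^ 2) ^ 2) ^ 2 * sin (√(A ^ 2 + B ^ 2) * T) ^ 2 := by
  rw [rotNorm_sq_eq h]
  have h1 := Real.sin_sq_add_cos_sq (√(A ^ 2 + B ^ 2) * T)
  rw [mul_assoc 2 √(A ^ 2 + B ^ 2) T, Real.sin_two_mul, Real.cos_two_mul]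
  set s := sin (√(A ^ 2 + B ^ 2) * T)
  set c := cos (√(A ^ 2 + B ^ 2) * T)
  have h2 : (2 * s * c) ^ 2 + (1 - (2 * c ^ 2 - 1)) ^ 2 = 4 * s ^ 2 := by
    have : c ^ 2 = 1 - s ^ 2 := by linarith
    rw [mul_pow, this]; ring
  linear_combination 1 / 4 * ((a * B - b * A) / √(A ^ 2 + B ^ 2) ^ 2) ^ 2 * h2

lemma sq_add_sq_mul_sq (A B a b : ℝ) :
    (a * A + b * B) ^ 2 + (a * B - b * A) ^ 2 = (a ^ 2 + b ^ 2) * (A ^ 2 + B ^ 2) := by ring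

lemma rotNorm_of_eq_zero (hT : 0 ≤ T) (h : √(A ^ 2 + B ^ 2) = 0) :
    rotNorm A B a b T = T * √(a ^ 2 + b ^ 2) := by
  rw [rotNorm, h]
  simp only [rotInt, rotCos]
  have : (-(a * T) + 4 * B * (a * B - b * A) * ((T - rotSin 0 T) / (4 * (0 : ℝ) ^ 2))) ^ 2 +
      ((2 * (a * B - b * A) * ((1 - cos (2 * 0 * T)) / (4 * (0 : ℝ) ^ 2))) ^ 2 +
        (b * T + 4 * A * (a * B - b * A) * ((T - rotSin 0 T) / (4 * (0 : ℝ) ^ 2))) ^ 2) =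
      T ^ 2 * (a ^ 2 + b ^ 2) := by
    simp; ring
  rw [this, Real.sqrt_mul (by positivity), Real.sqrt_sq hT]

/-- Averaging a rotating vector does not increase its length. -/
lemma rotNorm_le (hT : 0 ≤ T) : rotNorm A B a b T ≤ T * √(a ^ 2 + b ^ 2) := by
  by_cases h : √(A ^ 2 + B ^ 2) = 0
  · exact (rotNorm_of_eq_zero hT h).le
  refine (sq_le_sq₀ (rotNorm_nonneg ..) (by positivity)).1 ?_
  rw [rotNorm_sq_eq_sin h, mul_pow, Real.sq_sqrt (show 0 ≤ a ^ 2 + b ^ 2 by positivity)]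
  have he2 : √(A ^ 2 + B ^ 2) ^ 2 = A ^ 2 + B ^ 2 := Real.sq_sqrt (by positivity)
  set e := √(A ^ 2 + B ^ 2)
  have hs : sin (e * T) ^ 2 ≤ (e * T) ^ 2 := by
    rw [sq_le_sq]; exact Real.abs_sin_le_abs
  calc _ ≤ T ^ 2 * ((a * A + b * B) / e) ^ 2 + ((a * B - b * A) / e ^ 2) ^ 2 * (e * T) ^ 2 := by
        gcongr
    _ = T ^ 2 * ((a * A + b * B) ^ 2 + (a * B - b * A) ^ 2) / e ^ 2 := by field_simp
    _ = _ := by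
      rw [sq_add_sq_mul_sq, ← he2]; field_simp

lemma le_rotNorm (hT : 0 ≤ T) (h : √(A ^ 2 + B ^ 2) ≠ 0) :
    T * (|a * A + b * B| / √(A ^ 2 + B ^ 2)) ≤ rotNorm A B a b T := by
  refine (sq_le_sq₀ (by positivity) (rotNorm_nonneg ..)).1 ?_
  rw [rotNorm_sq_eq_sin h, mul_pow, div_pow, sq_abs, ← div_pow]
  have : 0 ≤ ((a * B - b * A) / √(A ^ 2 + B ^ 2) ^ 2) ^ 2 * sin (√(A ^ 2 + B ^ 2) * T) ^ 2 := by
    positivity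
  linarith

/-- A vector that turns by at most one radian keeps half of its length under averaging. -/
lemma half_le_rotNorm (hT : 0 ≤ T) (h1 : √(A ^ 2 + B ^ 2) * T ≤ 1) :
    T * √(a ^ 2 + b ^ 2) / 2 ≤ rotNorm A B a b T := by
  by_cases h : √(A ^ 2 + B ^ 2) = 0
  · rw [rotNorm_of_eq_zero hT h]
    have : 0 ≤ T * √(a ^ 2 + b ^ 2) := by positivity
    linarith
  refine (sq_le_sq₀ (by positivity) (rotNorm_nonneg ..)).1 ?_
  rw [rotNorm_sq_eq_sin h, div_pow, mul_pow, Real.sq_sqrt (show 0 ≤ a ^ 2 + b ^ 2 by positivity)]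
  have he2 : √(A ^ 2 + B ^ 2) ^ 2 = A ^ 2 + B ^ 2 := Real.sq_sqrt (by positivity)
  have he0 : 0 ≤ √(A ^ 2 + B ^ 2) := Real.sqrt_nonneg _
  set e := √(A ^ 2 + B ^ 2)
  have hs : 1 / 2 * (e * T) ≤ sin (e * T) := by
    have h2 := Real.mul_le_sin (x := e * T) (by positivity) (by linarith [Real.pi_gt_three])
    have h3 : 1 / 2 ≤ 2 / π := by
      rw [div_le_div_iff₀ two_pos Real.pi_pos]
      linarith [Real.pi_le_four]
    exact (mul_le_mul_of_nonneg_right h3 (by positivity)).trans h2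
  have hs2 : (1 / 2 * (e * T)) ^ 2 ≤ sin (e * T) ^ 2 := by gcongr
  calc _ = T ^ 2 / 4 * ((a * A + b * B) ^ 2 + (a * B - b * A) ^ 2) / e ^ 2 := by
        rw [sq_add_sq_mul_sq, ← he2]; field_simp; norm_num
    _ ≤ T ^ 2 * ((a * A + b * B) / e) ^ 2 +
        ((a * B - b * A) / e ^ 2) ^ 2 * (1 / 2 * (e * T)) ^ 2 := by
        have e1 : ((a * B - b * A) / e ^ 2) ^ 2 * (1 / 2 * (e * T)) ^ 2 =
          T ^ 2 / 4 * ((a * B - b * A) ^ 2 / e ^ 2) := by field_simp; ring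
        have e2 : T ^ 2 / 4 * ((a * A + b * B) ^ 2 + (a * B - b * A) ^ 2) / e ^ 2 =
          T ^ 2 / 4 * ((a * A + b * B) ^ 2 / e ^ 2) +
            T ^ 2 / 4 * ((a * B - b * A) ^ 2 / e ^ 2) := by
          ring
        rw [e1, e2, div_pow]
        have : 0 ≤ T ^ 2 * ((a * A + b * B) ^ 2 / e ^ 2) := by positivity
        linarith
    _ ≤ _ := by gcongr

end RotNorm

/-! ### The single-mode spectrum -/

section Spectrum

variable (κ : ℝ → ℝ) (N : ℕ) (k : ℝ) (P : Coupling → ℝ)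

lemma energy_eq : energy κ N k P = √(hop P k ^ 2 + gap κ N P k ^ 2) := by
  rw [energy, add_comm]; rfl

lemma energy_sq : energy κ N k P ^ 2 = hop P k ^ 2 + gap κ N P k ^ 2 := by
  rw [energy_eq, Real.sq_sqrt (by positivity)]

lemma hasDerivAt_hop_update (θ : Coupling) :
    HasDerivAt (fun t => hop (Function.update P θ t) k) (hop (Pi.single θ 1) k) (P θ) := by
  have h (t : ℝ) : hop (Function.update P θ t) k = hop P k + (t - P θ) * hop (Pi.single θ 1) k := by
    cases θ <;> (simp [hop, Function.update, Pi.single]; try ring)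
  simp only [h]
  simpa using (((hasDerivAt_id (P θ)).sub_const (P θ)).mul_const (hop (Pi.single θ 1) k)).const_add
    (hop P k)

lemma hasDerivAt_gap_update (θ : Coupling) :
    HasDerivAt (fun t => gap κ N (Function.update P θ t) k) (gap κ N (Pi.single θ 1) k) (P θ) := by
  have h (t : ℝ) : gap κ N (Function.update P θ t) k =
      gap κ N P k + (t - P θ) * gap κ N (Pi.single θ 1) k := by
    cases θ <;> (simp [gap, Function.update, Pi.single]; try ring)
  simp only [h]
  simpa using (((hasDerivAt_id (P θ)).sub_const (P θ)).mul_const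
    (gap κ N (Pi.single θ 1) k)).const_add (gap κ N P k)

variable {κ N k P}

lemma hasDerivAt_energy_update (he : energy κ N k P ≠ 0) (θ : Coupling) :
    HasDerivAt (fun t => energy κ N k (Function.update P θ t))
      ((hop (Pi.single θ 1) k * hop P k + gap κ N (Pi.single θ 1) k * gap κ N P k)
        / energy κ N k P) (P θ) := by
  have hA := hasDerivAt_hop_update k P θ
  have hB := hasDerivAt_gap_update κ N k P θ
  simp only [energy_eq] at he ⊢
  have h0 : hop (Function.update P θ (P θ)) k ^ 2 +
      gap κ N (Function.update P θ (P θ)) k ^ 2 ≠ 0 := by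
    rw [Function.update_eq_self]
    exact fun h => he (by rw [h, Real.sqrt_zero])
  refine (((hA.pow 2).add (hB.pow 2)).sqrt h0).congr_deriv ?_
  simp only [Function.update_eq_self, Pi.add_apply, Pi.pow_apply]
  field_simp
  ring

lemma partialDeriv_energy (he : energy κ N k P ≠ 0) (θ : Coupling) :
    partialDeriv θ (energy κ N k) P =
      (hop (Pi.single θ 1) k * hop P k + gap κ N (Pi.single θ 1) k * gap κ N P k)
        / energy κ N k P :=
  (hasDerivAt_energy_update he θ).deriv

/-- Only for `Δ ≠ 0` does the convention `ξ = 0` at `sin φ = 0` agree with the right-hand side. -/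
lemma xi_eq (hD : P Delta ≠ 0) (he : energy κ N k P ≠ 0) (θ : Coupling) :
    xi κ N k P θ = (hop (Pi.single θ 1) k * gap κ N P k - gap κ N (Pi.single θ 1) k * hop P k)
      / energy κ N k P ^ 2 := by
  have hA := hasDerivAt_hop_update k P θ
  have hE := hasDerivAt_energy_update he θ
  have hc : HasDerivAt (fun t => cosPhi κ N k (Function.update P θ t))
      (-(gap κ N P k * (hop (Pi.single θ 1) k * gap κ N P k
        - gap κ N (Pi.single θ 1) k * hop P k)) / energy κ N k P ^ 3) (P θ) := by
    refine (hA.neg.div hE (by rwa [Function.update_eq_self])).congr_deriv ?_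
    simp only [Function.update_eq_self, Pi.neg_apply]
    have h2 := energy_sq κ N k P
    field_simp
    rw [h2]; ring
  have hs : sinPhi κ N k P = -gap κ N P k / energy κ N k P := by
    rw [sinPhi, gap]; field_simp
  rw [xi, partialDeriv, hc.deriv, hs]
  by_cases hB : gap κ N P k = 0
  · -- where `f(k) = 0` both sides vanish
    have hf : pairingTransform κ N k = 0 := by
      simpa [gap, hD] using hB
    simp [gap, hf]
  · field_simp

lemma genSpectrum_eq_modeNorm (hD : P Delta ≠ 0) (he : energy κ N k P ≠ 0) (T : ℝ)
    (θ : Coupling) : genSpectrum κ N T k P θ = modeNorm κ N T k P θ := by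
  have he' : √(hop P k ^ 2 + gap κ N P k ^ 2) ≠ 0 := by rwa [← energy_eq]
  rw [genSpectrum, partialDeriv_energy he, xi_eq hD he, energy_eq, modeNorm,
    ← rotNorm_sq_eq he', Real.sqrt_sq (rotNorm_nonneg ..)]

variable (κ N k)

@[simp] lemma hop_single_J : hop (Pi.single J 1) k = cos k := by simp [hop]
@[simp] lemma hop_single_mu : hop (Pi.single mu 1) k = 1 := by simp [hop]
@[simp] lemma hop_single_Delta : hop (Pi.single Delta 1) k = 0 := by simp [hop]
@[simp] lemma gap_single_J : gap κ N (Pi.single J 1) k = 0 := by simp [gap]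
@[simp] lemma gap_single_mu : gap κ N (Pi.single mu 1) k = 0 := by simp [gap]
@[simp] lemma gap_single_Delta :
    gap κ N (Pi.single Delta 1) k = pairingTransform κ N k / 2 := by simp [gap]

lemma slopeNorm_J : slopeNorm κ N k J = |cos k| := by
  simp [slopeNorm, Real.sqrt_sq_eq_abs]

lemma slopeNorm_mu : slopeNorm κ N k mu = 1 := by simp [slopeNorm]

lemma slopeNorm_Delta : slopeNorm κ N k Delta = |pairingTransform κ N k| / 2 := by
  simp [slopeNorm, Real.sqrt_sq_eq_abs, abs_div]

lemma modeNorm_le {T : ℝ} (hT : 0 ≤ T) (P : Coupling → ℝ) (θ : Coupling) :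
    modeNorm κ N T k P θ ≤ T * slopeNorm κ N k θ :=
  rotNorm_le hT

lemma qfi_le_optimalQFI {κ : ℝ → ℝ} {N : ℕ} (he : Even N) (hN : 0 < N) {T : ℝ} (hT : 0 ≤ T)
    (p q : Coupling → ℝ) (θ : Coupling) : qfi κ N T p q θ ≤ optimalQFI κ N T p θ := by
  rw [qfi_eq κ he hN, optimalQFI_eq κ he hN]
  exact pow_le_pow_left₀ (Finset.sum_nonneg fun n _ => modeNorm_nonneg ..)
    (Finset.sum_le_sum fun n _ => modeNorm_le _ _ _ hT _ _) 2

end Spectrum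

/-! ### Divergence of the pairing transform -/

lemma abs_hop_le (P : Coupling → ℝ) (k : ℝ) : |hop P k| ≤ |P J| + |P mu| := by
  unfold hop
  refine (abs_add_le _ _).trans (add_le_add ?_ le_rfl)
  rw [abs_mul]
  exact mul_le_of_le_one_right (abs_nonneg _) (Real.abs_cos_le_one k)

section Energy

variable (κ : ℝ → ℝ) (N : ℕ) (k : ℝ) (P : Coupling → ℝ)

lemma abs_gap : |gap κ N P k| = |P Delta| * |pairingTransform κ N k| / 2 := by
  rw [gap, abs_div, abs_mul, abs_two]

lemma abs_gap_le_energy : |gap κ N P k| ≤ energy κ N k P := by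
  rw [energy_eq]; exact Real.abs_le_sqrt (by nlinarith [sq_nonneg (hop P k)])

lemma energy_le : energy κ N k P ≤ |gap κ N P k| + (|P J| + |P mu|) := by
  have h := abs_hop_le P k
  rw [energy_eq, Real.sqrt_le_left (by positivity), ← sq_abs (hop P k), ← sq_abs (gap κ N P k)]
  nlinarith [abs_nonneg (hop P k), abs_nonneg (gap κ N P k)]

end Energy

/-- Where `|f|` is large, the pseudo-spin of the Hamiltonian is nearly aligned with that of
`∂_Δ H`, and all errors are of relative order `1 / |f|`. -/
lemma divergence_bound {P : Coupling → ℝ} (hD : P Delta ≠ 0) {T : ℝ} (hT : 0 < T) {δ : ℝ}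
    (hδ : 0 < δ) : ∃ R : ℝ, ∀ (κ : ℝ → ℝ) (N : ℕ) (k : ℝ), R ≤ |pairingTransform κ N k| →
      |xi κ N k P Delta| ≤ δ ∧
      |partialDeriv Delta (energy κ N k) P / |pairingTransform κ N k|
        - SignType.sign (P Delta) / 2| ≤ δ ∧
      |genSpectrum κ N T k P Delta / |pairingTransform κ N k| - T / 2| ≤ δ := by
  set M := |P J| + |P mu| with hM
  have hM0 : 0 ≤ M := by positivity
  set d := |P Delta| with hd
  have hd0 : 0 < d := abs_pos.2 hD
  refine ⟨1 + (4 * M / (d ^ 2 * δ) + M / (d * δ) + 2 * T * M / (d * δ)), fun κ N k hR => ?_⟩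
  set f := pairingTransform κ N k with hf
  have hx1 : 1 ≤ |f| := by
    have : 0 ≤ 4 * M / (d ^ 2 * δ) + M / (d * δ) + 2 * T * M / (d * δ) := by positivity
    linarith
  have t1 : 0 ≤ 4 * M / (d ^ 2 * δ) := by positivity
  have t2 : 0 ≤ M / (d * δ) := by positivity
  have t3 : 0 ≤ 2 * T * M / (d * δ) := by positivity
  have r1 : 4 * M / (d ^ 2 * δ) ≤ |f| := by linarith
  have r2 : M / (d * δ) ≤ |f| := by linarith
  have r3 : 2 * T * M / (d * δ) ≤ |f| := by linarith
  set x := |f| with hx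
  have hx0 : 0 < x := by linarith
  have hg := abs_gap κ N k P
  rw [← hf, ← hd, ← hx] at hg
  have hle := abs_gap_le_energy κ N k P
  have hge := energy_le κ N k P
  rw [hg] at hle hge
  have he0 : 0 < energy κ N k P := lt_of_lt_of_le (by positivity) hle
  set e := energy κ N k P with he
  have hxi : |xi κ N k P Delta| ≤ 2 * M / (d ^ 2 * x) := by
    rw [xi_eq hD he0.ne', hop_single_Delta, gap_single_Delta, ← hf, ← he]
    have : (0 * gap κ N P k - f / 2 * hop P k) / e ^ 2 = -(f * hop P k / (2 * e ^ 2)) := by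
      ring
    rw [this, abs_neg, abs_div, abs_mul, ← hx, abs_of_pos (by positivity : 0 < 2 * e ^ 2),
      div_le_div_iff₀ (by positivity) (by positivity)]
    have h1 : d ^ 2 * x ^ 2 ≤ 4 * e ^ 2 := by nlinarith [mul_pos hd0 hx0]
    calc x * |hop P k| * (d ^ 2 * x) = |hop P k| * (d ^ 2 * x ^ 2) := by ring
      _ ≤ M * (4 * e ^ 2) := mul_le_mul (abs_hop_le P k) h1 (by positivity) hM0
      _ = _ := by ring
  have hxi2 : 2 * M / (d ^ 2 * x) ≤ δ / 2 := by
    rw [div_le_iff₀ (by positivity)] at r1 ⊢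
    linarith
  have hdE : partialDeriv Delta (energy κ N k) P = P Delta * x ^ 2 / (4 * e) := by
    rw [partialDeriv_energy he0.ne', hop_single_Delta, gap_single_Delta, ← hf, ← he, gap, ← hf,
      hx, sq_abs]
    field_simp
    ring
  have hratio : |d * x / (4 * e) - 1 / 2| ≤ M / (d * x) := by
    have : d * x / (4 * e) - 1 / 2 = -((2 * e - d * x) / (4 * e)) := by field_simp; ring
    rw [this, abs_neg, abs_of_nonneg (div_nonneg (by linarith) (by positivity)),
      div_le_div_iff₀ (by positivity) (by positivity)]
    nlinarith [mul_pos hd0 hx0]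
  have hM1 : M / (d * x) ≤ δ := by
    rw [div_le_iff₀ (by positivity)] at r2 ⊢
    linarith
  have hM2 : T * (M / (d * x)) ≤ δ / 2 := by
    rw [div_le_iff₀ (by positivity)] at r3
    rw [← mul_div_assoc, div_le_iff₀ (by positivity)]
    linarith
  refine ⟨by linarith, ?_, ?_⟩
  · have hs : partialDeriv Delta (energy κ N k) P / x - SignType.sign (P Delta) / 2 =
        SignType.sign (P Delta) * (d * x / (4 * e) - 1 / 2) := by
      rw [hdE]
      have : P Delta = SignType.sign (P Delta) * d := (sign_mul_abs _).symm
      field_simp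
      linear_combination 2 * x * this
    have hsa : |((SignType.sign (P Delta) : SignType) : ℝ)| = 1 := by
      rcases lt_or_gt_of_ne hD with h | h <;> simp [h]
    rw [hs, abs_mul, hsa, one_mul]
    exact hratio.trans hM1
  · have hdE' : |partialDeriv Delta (energy κ N k) P| = d * x ^ 2 / (4 * e) := by
      rw [hdE, abs_div, abs_mul, abs_of_pos (by positivity : 0 < 4 * e),
        abs_of_nonneg (by positivity : 0 ≤ x ^ 2)]
    set s := sin (2 * e * T)
    set c := cos (2 * e * T)
    have hsc : s ^ 2 + c ^ 2 = 1 := Real.sin_sq_add_cos_sq _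
    have hgen : genSpectrum κ N T k P Delta = √((T * (d * x ^ 2 / (4 * e))) ^ 2 +
        xi κ N k P Delta ^ 2 * ((1 - c) / 2)) := by
      rw [genSpectrum, ← hdE', mul_pow, sq_abs]
      congr 1
      linear_combination 1 / 4 * xi κ N k P Delta ^ 2 * hsc
    have hc1 : 0 ≤ (1 - c) / 2 := by linarith [Real.cos_le_one (2 * e * T)]
    have hc2 : (1 - c) / 2 ≤ 1 := by linarith [Real.neg_one_le_cos (2 * e * T)]
    have hlow : T * (d * x ^ 2 / (4 * e)) ≤ genSpectrum κ N T k P Delta := by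
      rw [hgen]
      exact Real.le_sqrt_of_sq_le (le_add_of_nonneg_right (mul_nonneg (sq_nonneg _) hc1))
    have hup : genSpectrum κ N T k P Delta ≤ T * (d * x ^ 2 / (4 * e)) + |xi κ N k P Delta| := by
      rw [hgen, Real.sqrt_le_left (by positivity), ← sq_abs (xi κ N k P Delta)]
      have h1 : 0 ≤ T * (d * x ^ 2 / (4 * e)) * |xi κ N k P Delta| := by positivity
      have h2 : |xi κ N k P Delta| ^ 2 * ((1 - c) / 2) ≤ |xi κ N k P Delta| ^ 2 :=
        mul_le_of_le_one_right (sq_nonneg _) hc2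
      rw [add_sq]
      linarith
    have hmid : T * (d * x ^ 2 / (4 * e)) / x - T / 2 = T * (d * x / (4 * e) - 1 / 2) := by
      field_simp
    have hr := abs_le.1 hratio
    have hTr : |T * (d * x / (4 * e) - 1 / 2)| ≤ δ / 2 := by
      rw [abs_mul, abs_of_pos hT]
      exact (mul_le_mul_of_nonneg_left hratio hT.le).trans hM2
    have hTr' := abs_le.1 hTr
    have hl : T * (d * x ^ 2 / (4 * e)) / x ≤ genSpectrum κ N T k P Delta / x := by gcongr
    have hu : genSpectrum κ N T k P Delta / x ≤ T * (d * x ^ 2 / (4 * e)) / x + δ / 2 := by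
      calc _ ≤ (T * (d * x ^ 2 / (4 * e)) + |xi κ N k P Delta|) / x := by gcongr
        _ = T * (d * x ^ 2 / (4 * e)) / x + |xi κ N k P Delta| / x := add_div _ _ _
        _ ≤ _ := by
          have : |xi κ N k P Delta| / x ≤ |xi κ N k P Delta| := div_le_self (abs_nonneg _) hx1
          linarith
    rw [abs_le]
    constructor <;> linarith

/-! ### The scaling of the pairing coupling -/

/-- The first Fourier coefficient of `f` is `κ 1`, so that `f` cannot be small on average. -/
lemma chain_le_sum_abs_pairingTransform {κ : ℝ → ℝ} (h1 : κ 1 = 1) {N : ℕ} (he : Even N)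
    (hN : 0 < N) : (N : ℝ) ≤ ∑ n : Fin N, |pairingTransform κ N (momentum N n)| := by
  have hN2 : 1 < N := by
    obtain ⟨M, rfl⟩ := he; omega
  have hp1 : pairing κ N 1 = 1 := by
    rw [pairing, min_eq_left (by omega), Nat.cast_one, h1]
  have key : ∑ n : Fin N, -(Complex.I * pairingTransform κ N (momentum N n)) * phase N n 1 = N := by
    simp only [← sum_pairing_phase κ he hN, Finset.sum_mul]
    rw [Finset.sum_comm]
    rw [Finset.sum_eq_single 1]
    · have := sum_phase_mul_star_phase (N := N) ⟨1, hN2⟩ ⟨1, hN2⟩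
      simp only [if_true] at this
      rw [← this]
      refine Finset.sum_congr rfl fun n _ => ?_
      rw [hp1]; push_cast; ring
    · intro l hl hl1
      rw [Finset.mem_Icc] at hl
      have := sum_phase_mul_star_phase (N := N) ⟨1, hN2⟩ ⟨l, by omega⟩
      rw [if_neg (by simpa using hl1.symm)] at this
      simp only at this
      calc _ = (pairing κ N l : ℂ) * ∑ n : Fin N, phase N n 1 * star (phase N n l) := by
            rw [Finset.mul_sum]
            exact Finset.sum_congr rfl fun n _ => by ring
        _ = 0 := by rw [this, mul_zero]
    · intro h
      exact absurd (Finset.mem_Icc.2 ⟨le_rfl, by omega⟩) h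
  have hph (n : ℕ) : ‖phase N n 1‖ = 1 := by
    unfold phase
    rw [mul_comm]
    exact Complex.norm_exp_ofReal_mul_I _
  calc (N : ℝ)
      = ‖∑ n : Fin N, -(Complex.I * pairingTransform κ N (momentum N n)) * phase N n 1‖ := by
        rw [key, Complex.norm_natCast]
    _ ≤ _ := by
      refine (norm_sum_le _ _).trans (le_of_eq (Finset.sum_congr rfl fun n _ => ?_))
      rw [norm_mul, hph, norm_neg, norm_mul, Complex.norm_I, Complex.norm_real, Real.norm_eq_abs]
      ring

/-- With `x = |f|` and `d = |Δ|`, each mode contributes at least `(T d / 2) x² / (d x + 2 M)`; the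
Cauchy-Schwarz inequality and `∑ x ≥ N` give a fixed fraction of `(T / 2) ∑ x`. -/
lemma exists_mul_optimalQFI_le {p q : Coupling → ℝ} (hD : (p + q) Delta ≠ 0) :
    ∃ c : ℝ, 0 < c ∧ ∀ (κ : ℝ → ℝ) (N : ℕ) (T : ℝ), κ 1 = 1 → Even N → 0 < N → 0 < T →
      c * optimalQFI κ N T p Delta ≤ qfi κ N T p q Delta := by
  set P := p + q with hP
  set d := |P Delta| with hd
  have hd0 : 0 < d := abs_pos.2 hD
  -- the summand `1` keeps the denominators below positive
  set M := |P J| + |P mu| + 1 with hM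
  have hM0 : 0 < M := by positivity
  refine ⟨(d / (d + 2 * M)) ^ 2, by positivity, fun κ N T h1 he hN hT => ?_⟩
  rw [qfi_eq κ he hN, optimalQFI_eq κ he hN, ← mul_pow]
  refine pow_le_pow_left₀ (by
    refine mul_nonneg (by positivity) (Finset.sum_nonneg fun n _ => ?_)
    rw [slopeNorm_Delta]; positivity) ?_ 2
  set x : Fin N → ℝ := fun n => |pairingTransform κ N (momentum N n)| with hx
  have hx0 (n : Fin N) : 0 ≤ x n := abs_nonneg _
  have hS := chain_le_sum_abs_pairingTransform h1 he hN
  change (N : ℝ) ≤ ∑ n, x n at hS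
  have hNpos : (0 : ℝ) < N := by exact_mod_cast hN
  have hmode (n : Fin N) : T * d / 2 * (x n ^ 2 / (d * x n + 2 * M)) ≤
      modeNorm κ N T (momentum N n) P Delta := by
    have hg := abs_gap κ N (momentum N n) P
    have hle := energy_le κ N (momentum N n) P
    by_cases hz : energy κ N (momentum N n) P = 0
    · have hge := abs_gap_le_energy κ N (momentum N n) P
      rw [hz, hg] at hge
      have : x n = 0 := by
        have : d * x n / 2 ≤ 0 := hge
        nlinarith [hx0 n]
      rw [this]
      simpa using modeNorm_nonneg κ N T (momentum N n) P Delta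
    have he0 : 0 < energy κ N (momentum N n) P :=
      lt_of_le_of_ne (Real.sqrt_nonneg _) (Ne.symm hz)
    have hr := le_rotNorm (A := hop P (momentum N n)) (B := gap κ N P (momentum N n))
      (a := hop (Pi.single Delta 1) (momentum N n))
      (b := gap κ N (Pi.single Delta 1) (momentum N n)) hT.le (by rwa [← energy_eq])
    refine le_trans ?_ hr
    rw [← energy_eq, hop_single_Delta, gap_single_Delta, zero_mul, zero_add, abs_mul, hg, abs_div,
      abs_two]
    change _ ≤ T * (x n / 2 * (d * x n / 2) / energy κ N (momentum N n) P)
    rw [hg] at hle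
    change _ ≤ d * x n / 2 + _ at hle
    have hle' : 2 * energy κ N (momentum N n) P ≤ d * x n + 2 * M := by linarith
    calc T * d / 2 * (x n ^ 2 / (d * x n + 2 * M))
        ≤ T * d / 2 * (x n ^ 2 / (2 * energy κ N (momentum N n) P)) := by gcongr
      _ = _ := by field_simp
  have hcs := Finset.sq_sum_div_le_sum_sq_div Finset.univ x (g := fun n => d * x n + 2 * M)
    (fun n _ => by have := hx0 n; positivity)
  have hden : ∑ n : Fin N, (d * x n + 2 * M) ≤ (d + 2 * M) * ∑ n, x n := by
    rw [Finset.sum_add_distrib, ← Finset.mul_sum]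
    simp only [Finset.sum_const, Finset.card_univ, Fintype.card_fin, nsmul_eq_mul]
    nlinarith
  have hXpos : 0 < ∑ n, x n := lt_of_lt_of_le hNpos hS
  have hdenpos : 0 < ∑ n : Fin N, (d * x n + 2 * M) :=
    Finset.sum_pos (fun n _ => by have := hx0 n; positivity) ⟨⟨0, hN⟩, Finset.mem_univ _⟩
  calc d / (d + 2 * M) * ∑ n : Fin N, T * slopeNorm κ N (momentum N n) Delta
      = T * d / 2 * ((∑ n, x n) ^ 2 / ((d + 2 * M) * ∑ n, x n)) := by
        have : ∑ n : Fin N, T * slopeNorm κ N (momentum N n) Delta = T / 2 * ∑ n, x n := by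
          rw [Finset.mul_sum]
          refine Finset.sum_congr rfl fun n _ => ?_
          rw [slopeNorm_Delta]; ring
        rw [this]
        field_simp
    _ ≤ T * d / 2 * ((∑ n, x n) ^ 2 / ∑ n : Fin N, (d * x n + 2 * M)) := by gcongr
    _ ≤ T * d / 2 * ∑ n, (x n ^ 2 / (d * x n + 2 * M)) := by gcongr
    _ ≤ _ := by
      rw [Finset.mul_sum]
      exact Finset.sum_le_sum fun n _ => hmode n

/-! ### Finite differences of the decay law -/

section Differences

lemma abs_fwdDiff_iterate_le {x : ℕ → ℝ} {C : ℝ} (h : ∀ l, |x l| ≤ C) (m l : ℕ) :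
    |(fwdDiff 1)^[m] x l| ≤ 2 ^ m * C := by
  induction m generalizing l with
  | zero => simpa using h l
  | succ m ih =>
    rw [Function.iterate_succ_apply', fwdDiff]
    calc _ ≤ |(fwdDiff 1)^[m] x (l + 1)| + |(fwdDiff 1)^[m] x l| := abs_sub _ _
      _ ≤ 2 ^ m * C + 2 ^ m * C := add_le_add (ih _) (ih _)
      _ = _ := by ring

/-- If a bounded sequence has second differences tending to zero, so do its first differences:
a first difference of size `η` would persist over `n` steps and add up to `n η / 2`. -/
lemma tendsto_fwdDiff_of_bounded {w : ℕ → ℝ} {C : ℝ} (h : ∀ l, |w l| ≤ C)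
    (h2 : Tendsto (fwdDiff 1 (fwdDiff 1 w)) atTop (nhds 0)) :
    Tendsto (fwdDiff 1 w) atTop (nhds 0) := by
  rw [Metric.tendsto_atTop] at h2 ⊢
  intro η hη
  obtain ⟨n, hn⟩ := exists_nat_gt (4 * C / η)
  have hC : 0 ≤ C := (abs_nonneg _).trans (h 0)
  have hn0 : (0 : ℝ) < n := lt_of_le_of_lt (by positivity) hn
  obtain ⟨L, hL⟩ := h2 (η / (2 * n)) (by positivity)
  refine ⟨L, fun l hl => ?_⟩
  simp only [Real.dist_eq, sub_zero] at hL ⊢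
  set v := fwdDiff 1 w with hv
  have h3 (i : ℕ) : |v (l + i) - v l| ≤ i * (η / (2 * n)) := by
    induction i with
    | zero => simp
    | succ i ih =>
      have h4 := (hL (l + i) (by omega)).le
      rw [fwdDiff] at h4
      have e : v (l + (i + 1)) - v l = (v (l + i + 1) - v (l + i)) + (v (l + i) - v l) := by
        rw [add_assoc]; ring
      rw [e]
      refine (abs_add_le _ _).trans ?_
      push_cast
      linarith
  have h5 : w (l + n) - w l = n * v l + ∑ i ∈ Finset.range n, (v (l + i) - v l) := by
    have : ∑ i ∈ Finset.range n, v (l + i) = w (l + n) - w l := by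
      have := Finset.sum_range_sub (fun i => w (l + i)) n
      simpa [hv, fwdDiff, add_assoc] using this
    rw [Finset.sum_sub_distrib, this]; simp
  have h6 : |∑ i ∈ Finset.range n, (v (l + i) - v l)| ≤ n * (η / 2) := by
    refine (Finset.abs_sum_le_sum_abs _ _).trans ?_
    have : ∀ i ∈ Finset.range n, |v (l + i) - v l| ≤ η / 2 := by
      intro i hi
      refine (h3 i).trans ?_
      have : (i : ℝ) ≤ n := by exact_mod_cast (Finset.mem_range.1 hi).le
      calc (i : ℝ) * (η / (2 * n)) ≤ n * (η / (2 * n)) := by gcongr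
        _ = η / 2 := by field_simp
    simpa using Finset.sum_le_card_nsmul _ _ _ this
  have h7 : n * |v l| ≤ 2 * C + n * (η / 2) := by
    have e : (n : ℝ) * v l = w (l + n) - w l - ∑ i ∈ Finset.range n, (v (l + i) - v l) := by
      rw [h5]; ring
    have : |(n : ℝ) * v l| ≤ 2 * C + n * (η / 2) := by
      rw [e]
      refine (abs_sub _ _).trans (add_le_add ?_ h6)
      refine (abs_sub _ _).trans ?_
      linarith [h (l + n), h l]
    rwa [abs_mul, abs_of_pos hn0] at this
  rw [div_lt_iff₀ hη] at hn
  nlinarith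

lemma tendsto_fwdDiff_of_tendsto_iterate {x : ℕ → ℝ} {C : ℝ} (h : ∀ l, |x l| ≤ C) (j : ℕ)
    (hj : Tendsto ((fwdDiff 1)^[j + 1] x) atTop (nhds 0)) :
    Tendsto (fwdDiff 1 x) atTop (nhds 0) := by
  induction j with
  | zero => simpa using hj
  | succ j ih =>
    refine ih ?_
    rw [Function.iterate_succ_apply']
    refine tendsto_fwdDiff_of_bounded (abs_fwdDiff_iterate_le h j) ?_
    have e : (fwdDiff 1)^[j + 1 + 1] x = fwdDiff 1 (fwdDiff 1 ((fwdDiff 1)^[j] x)) := by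
      rw [Function.iterate_succ_apply', Function.iterate_succ_apply']
    rwa [← e]

/-- Repeated summation by parts: away from `z = 1` a power sum with bounded coefficients is
controlled by the differences of any order. -/
lemma norm_sum_mul_pow_le {z : ℂ} (hz : ‖z‖ = 1) (hz1 : 1 ≤ ‖1 - z‖) (j : ℕ) {y : ℕ → ℝ} {ε : ℝ}
    (h0 : ∀ l, |y l| ≤ ε) (hj : ∀ n, ∑ i ∈ Finset.range n, |(fwdDiff 1)^[j] y i| ≤ ε) (n : ℕ) :
    ‖∑ i ∈ Finset.range n, (y i : ℂ) * z ^ i‖ ≤ 4 ^ j * ε := by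
  induction j generalizing y ε n with
  | zero =>
    refine (norm_sum_le _ _).trans ?_
    simpa [hz] using hj n
  | succ j ih =>
    have hε : 0 ≤ ε := (abs_nonneg _).trans (h0 0)
    have h1 (l : ℕ) : |fwdDiff 1 y l| ≤ 2 * ε := by
      rw [fwdDiff]
      exact (abs_sub _ _).trans (by linarith [h0 (l + 1), h0 l])
    have h2 (n : ℕ) : ∑ i ∈ Finset.range n, |(fwdDiff 1)^[j] (fwdDiff 1 y) i| ≤ 2 * ε := by
      have := hj n
      rw [Function.iterate_succ_apply] at this
      linarith
    have h3 := ih h1 h2 n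
    have hparts : (1 - z) * ∑ i ∈ Finset.range n, (y i : ℂ) * z ^ i =
        y 0 - y n * z ^ n + z * ∑ i ∈ Finset.range n, ((fwdDiff 1 y i : ℝ) : ℂ) * z ^ i := by
      clear h3
      induction n with
      | zero => simp
      | succ n ihn =>
        rw [Finset.sum_range_succ, mul_add, ihn, Finset.sum_range_succ, fwdDiff]
        push_cast
        ring
    have h4 : ‖(1 - z) * ∑ i ∈ Finset.range n, (y i : ℂ) * z ^ i‖ ≤
        ε + ε + 4 ^ j * (2 * ε) := by
      rw [hparts]
      refine (norm_add_le _ _).trans (add_le_add ((norm_sub_le _ _).trans (add_le_add ?_ ?_)) ?_)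
      · simpa using h0 0
      · simpa [hz] using h0 n
      · rw [norm_mul, hz, one_mul]; exact h3
    rw [norm_mul] at h4
    have h5 : (1 : ℝ) ≤ 4 ^ j := one_le_pow₀ (by norm_num)
    have h6 := norm_nonneg (∑ i ∈ Finset.range n, (y i : ℂ) * z ^ i)
    rw [pow_succ]
    nlinarith

/-- For a bounded sequence with an absolutely summable difference of some order, the trapezoidal
sine sum is small near `k = π`, uniformly in its length. -/
lemma exists_abs_sine_sum_le {x : ℕ → ℝ} {C : ℝ} (hx : ∀ l, |x l| ≤ C) {j : ℕ}
    (hs : Summable fun l => |(fwdDiff 1)^[j + 1] x l|) {η : ℝ} (hη : 0 < η) :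
    ∃ δ > 0, ∃ M₀ : ℕ, ∀ M ≥ M₀, ∀ k : ℝ, |k - π| ≤ δ →
      |2 * ∑ l ∈ Finset.range M, x l * sin (k * l) + x M * sin (k * M)| ≤ η := by
  set y := fwdDiff 1 x with hy
  have hyd : (fwdDiff 1)^[j] y = (fwdDiff 1)^[j + 1] x := (Function.iterate_succ_apply _ _ _).symm
  have hy0 : Tendsto y atTop (nhds 0) :=
    tendsto_fwdDiff_of_tendsto_iterate hx j
      ((tendsto_zero_iff_abs_tendsto_zero _).2 hs.tendsto_atTop_zero)
  set ε := η / (3 * 4 ^ j) with hε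
  have hε0 : 0 < ε := by positivity
  -- beyond `L`, the coefficients and the variation of the differences `y` are small
  obtain ⟨L, hL1, hL2⟩ : ∃ L : ℕ, (∀ l, |y (l + L)| ≤ ε) ∧
      ∀ n, ∑ i ∈ Finset.range n, |(fwdDiff 1)^[j] (fun r => y (r + L)) i| ≤ ε := by
    have e1 : ∀ᶠ L in atTop, ∀ l ≥ L, |y l| ≤ ε := by
      rw [Metric.tendsto_atTop] at hy0
      obtain ⟨L, hL⟩ := hy0 ε hε0
      filter_upwards [eventually_ge_atTop L] with L' hL' l hl
      simpa [Real.dist_eq] using (hL l (by omega)).le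
    have e2 : ∀ᶠ L in atTop, ∑' i, |(fwdDiff 1)^[j + 1] x (i + L)| ≤ ε := by
      have := tendsto_sum_nat_add fun l => |(fwdDiff 1)^[j + 1] x l|
      exact this.eventually_le_const hε0
    obtain ⟨L, h1, h2⟩ := (e1.and e2).exists
    refine ⟨L, fun l => h1 _ (by omega), fun n => le_trans ?_ h2⟩
    simp only [fwdDiff_iter_comp_add, hyd]
    exact ((summable_nat_add_iff L).2 hs).sum_le_tsum _ fun _ _ => abs_nonneg _
  set C' := C + ∑' l, |(fwdDiff 1)^[j + 1] x l| with hC'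
  have hS0 : 0 ≤ ∑' l, |(fwdDiff 1)^[j + 1] x l| := tsum_nonneg fun _ => abs_nonneg _
  have hC0 : 0 ≤ C := (abs_nonneg _).trans (hx 0)
  set Z : ℝ → ℂ := fun k => Complex.exp (k * Complex.I) with hZ
  have hZπ : Z π = -1 := Complex.exp_pi_mul_I
  have hZc : Continuous Z := by fun_prop
  -- `g` bounds the sum up to the tail; at `k = π` the head is real, so that `g` vanishes there
  set g : ℝ → ℝ := fun k => ‖1 + Z k‖ * (4 ^ (j + 1) * C') +
    |(Z k * ∑ l ∈ Finset.range L, (y l : ℂ) * Z k ^ l).im| with hg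
  have hgc : Continuous g := by
    simp only [hg]
    refine ((continuous_const.add hZc).norm.mul continuous_const).add (continuous_abs.comp
      (Complex.continuous_im.comp (hZc.mul (continuous_finsetSum _ fun l _ =>
        continuous_const.mul (hZc.pow l)))))
  have hgπ : g π = 0 := by
    have : (-1 : ℂ) * ∑ l ∈ Finset.range L, (y l : ℂ) * (-1) ^ l =
        ((-1 * ∑ l ∈ Finset.range L, y l * (-1) ^ l : ℝ) : ℂ) := by push_cast; rfl
    simp only [hg, hZπ]
    rw [this, Complex.ofReal_im]; simp
  have ev1 : ∀ᶠ k in nhds π, g k ≤ 2 * η / 3 :=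
    (hgc.tendsto π).eventually_le_const (by rw [hgπ]; positivity)
  have ev2 : ∀ᶠ k in nhds π, 1 ≤ ‖1 - Z k‖ :=
    ((continuous_const.sub hZc).norm.tendsto π).eventually_const_le
      (by change 1 < ‖1 - Z π‖; rw [hZπ]; norm_num)
  obtain ⟨δ, hδ, hδ'⟩ := Metric.eventually_nhds_iff.1 (ev1.and ev2)
  refine ⟨δ / 2, by positivity, L, fun M hM k hk => ?_⟩
  obtain ⟨hk1, hk2⟩ := hδ' (y := k) (by rw [Real.dist_eq]; linarith)
  have hZn : ‖Z k‖ = 1 := Complex.norm_exp_ofReal_mul_I k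
  have hsin (l : ℕ) : sin (k * l) = (Z k ^ l).im := by
    rw [hZ, ← Complex.exp_nat_mul]
    rw [show (l : ℂ) * (k * Complex.I) = ((k * l : ℝ) : ℂ) * Complex.I by push_cast; ring,
      Complex.exp_ofReal_mul_I_im]
  have hsum : 2 * ∑ l ∈ Finset.range M, x l * sin (k * l) + x M * sin (k * M) =
      ((1 + Z k) * ∑ l ∈ Finset.range M, (x l : ℂ) * Z k ^ l
        + Z k * ∑ l ∈ Finset.range M, (y l : ℂ) * Z k ^ l).im := by
    -- the terms `l` and `l + 1` of the two copies of the sum are paired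
    have hpair : 2 * ∑ l ∈ Finset.range M, (x l : ℂ) * Z k ^ l + x M * Z k ^ M =
        x 0 + ((1 + Z k) * ∑ l ∈ Finset.range M, (x l : ℂ) * Z k ^ l
          + Z k * ∑ l ∈ Finset.range M, (y l : ℂ) * Z k ^ l) := by
      clear hM
      induction M with
      | zero => simp
      | succ M ih =>
        have hyM : (y M : ℂ) = x (M + 1) - x M := by rw [hy, fwdDiff]; push_cast; rfl
        simp only [Finset.sum_range_succ, hyM]
        linear_combination ih
    have := congrArg Complex.im hpair
    rw [Complex.add_im (x 0 : ℂ), Complex.ofReal_im, zero_add] at this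
    rw [← this, Complex.add_im, Complex.im_ofReal_mul, show (2 : ℂ) = ((2 : ℝ) : ℂ) by simp,
      Complex.im_ofReal_mul, Complex.im_sum]
    simp only [hsin, Complex.im_ofReal_mul]
  have hU : ‖∑ l ∈ Finset.range M, (x l : ℂ) * Z k ^ l‖ ≤ 4 ^ (j + 1) * C' :=
    norm_sum_mul_pow_le hZn hk2 (j + 1) (fun l => (hx l).trans (by linarith))
      (fun n => (hs.sum_le_tsum _ fun _ _ => abs_nonneg _).trans (by linarith)) M
  have hsplit : ∑ l ∈ Finset.range M, (y l : ℂ) * Z k ^ l =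
      ∑ l ∈ Finset.range L, (y l : ℂ) * Z k ^ l +
        Z k ^ L * ∑ i ∈ Finset.range (M - L), (y (i + L) : ℂ) * Z k ^ i := by
    rw [← Finset.sum_range_add_sum_Ico _ hM, Finset.sum_Ico_eq_sum_range, Finset.mul_sum]
    congr 1
    refine Finset.sum_congr rfl fun i _ => ?_
    rw [pow_add, add_comm L i]; ring
  have htail : ‖∑ i ∈ Finset.range (M - L), (y (i + L) : ℂ) * Z k ^ i‖ ≤ 4 ^ j * ε :=
    norm_sum_mul_pow_le hZn hk2 j hL1 hL2 _
  have hηε : 4 ^ j * ε = η / 3 := by rw [hε]; field_simp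
  rw [hsum, hsplit, mul_add, Complex.add_im, Complex.add_im]
  have b1 : |((1 + Z k) * ∑ l ∈ Finset.range M, (x l : ℂ) * Z k ^ l).im| ≤
      ‖1 + Z k‖ * (4 ^ (j + 1) * C') := by
    refine (Complex.abs_im_le_norm _).trans ?_
    rw [norm_mul]; gcongr
  have b2 : |(Z k * (Z k ^ L * ∑ i ∈ Finset.range (M - L), (y (i + L) : ℂ) * Z k ^ i)).im| ≤
      η / 3 := by
    refine (Complex.abs_im_le_norm _).trans ?_
    rw [norm_mul, norm_mul, norm_pow, hZn, one_pow, one_mul, one_mul, ← hηε]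
    exact htail
  have b3 := abs_add_le ((1 + Z k) * ∑ l ∈ Finset.range M, (x l : ℂ) * Z k ^ l).im
    ((Z k * ∑ l ∈ Finset.range L, (y l : ℂ) * Z k ^ l).im +
      (Z k * (Z k ^ L * ∑ i ∈ Finset.range (M - L), (y (i + L) : ℂ) * Z k ^ i)).im)
  have b4 := abs_add_le (Z k * ∑ l ∈ Finset.range L, (y l : ℂ) * Z k ^ l).im
      (Z k * (Z k ^ L * ∑ i ∈ Finset.range (M - L), (y (i + L) : ℂ) * Z k ^ i)).im
  simp only [hg] at hk1
  linarith

end Differences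

section Smooth

/-- Mean value theorem for iterated differences; `F i` is the `i`-th derivative of `F 0`. -/
lemma abs_fwdDiff_iterate_le_of_deriv {a C : ℝ} (j : ℕ) {F : ℕ → ℝ → ℝ}
    (hF : ∀ i < j, ∀ x > a, HasDerivAt (F i) (F (i + 1) x) x) {t : ℝ} (ht : a < t)
    (hC : ∀ x ∈ Set.Icc t (t + j), |F j x| ≤ C) : |(fwdDiff 1)^[j] (F 0) t| ≤ C := by
  induction j generalizing F with
  | zero => exact hC t (by simp)
  | succ j ih =>
    rw [Function.iterate_succ_apply]
    refine ih (F := fun i => fwdDiff 1 (F i)) (fun i hi x hx => ?_) (fun x hx => ?_)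
    · have h1 := hF i (by omega) (x + 1) (by linarith)
      exact (h1.comp_add_const x 1).sub (hF i (by omega) x hx)
    · have hsub : Set.Icc x (x + 1) ⊆ Set.Icc t (t + (j + 1 : ℕ)) := by
        intro s hs
        push_cast
        exact ⟨hx.1.trans hs.1, hs.2.trans (by linarith [hx.2])⟩
      have := (convex_Icc x (x + 1)).norm_image_sub_le_of_norm_hasDerivWithin_le
        (f := F j) (f' := F (j + 1)) (C := C) (x := x) (y := x + 1)
        (fun s hs => (hF j (by omega) s (by linarith [hs.1, hx.1])).hasDerivWithinAt)
        (fun s hs => hC s (hsub hs)) (by simp) (by simp)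
      simpa [fwdDiff] using this

/-- A difference of order `j + 1` is bounded by the integral of the derivative of that order. -/
lemma abs_fwdDiff_iterate_le_integral {a : ℝ} (j : ℕ) {F : ℕ → ℝ → ℝ}
    (hF : ∀ i < j + 1, ∀ x > a, HasDerivAt (F i) (F (i + 1) x) x)
    (hint : MeasureTheory.IntegrableOn (F (j + 1)) (Set.Ioi a)) {t : ℝ} (ht : a < t) :
    |(fwdDiff 1)^[j + 1] (F 0) t| ≤ ∫ s in t..(t + (j + 1 : ℕ)), |F (j + 1) s| := by
  rw [Function.iterate_succ_apply]
  have hii (u v : ℝ) (hu : a < u) (huv : u ≤ v) :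
      IntervalIntegrable (F (j + 1)) MeasureTheory.volume u v := by
    rw [intervalIntegrable_iff_integrableOn_Ioc_of_le huv]
    exact hint.mono_set fun s hs => hu.trans hs.1
  refine abs_fwdDiff_iterate_le_of_deriv (F := fun i => fwdDiff 1 (F i)) j
    (fun i hi x hx => ?_) ht (fun x hx => ?_)
  · have h1 := hF i (by omega) (x + 1) (by linarith)
    exact (h1.comp_add_const x 1).sub (hF i (by omega) x hx)
  · have hxa : a < x := ht.trans_le hx.1
    have hftc : ∫ s in x..(x + 1), F (j + 1) s = F j (x + 1) - F j x := by
      refine intervalIntegral.integral_eq_sub_of_hasDerivAt (fun s hs => ?_)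
        (hii x (x + 1) hxa (by linarith))
      rw [Set.uIcc_of_le (by linarith)] at hs
      exact hF j (by omega) s (hxa.trans_le hs.1)
    change |F j (x + 1) - F j x| ≤ _
    rw [← hftc]
    refine (intervalIntegral.abs_integral_le_integral_abs (by linarith)).trans ?_
    refine intervalIntegral.integral_mono_interval hx.1 (by linarith) ?_ ?_ ?_
    · push_cast; linarith [hx.2]
    · exact Eventually.of_forall fun s => abs_nonneg _
    · refine (hii t _ ht ?_).abs
      push_cast
      have : (0 : ℝ) ≤ j := Nat.cast_nonneg j
      linarith

lemma summable_abs_fwdDiff_iterate {a : ℝ} (j : ℕ) {F : ℕ → ℝ → ℝ}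
    (hF : ∀ i < j + 1, ∀ x > a, HasDerivAt (F i) (F (i + 1) x) x)
    (hint : MeasureTheory.IntegrableOn (F (j + 1)) (Set.Ioi a)) :
    Summable fun l : ℕ => |(fwdDiff 1)^[j + 1] (fun l : ℕ => F 0 l) l| := by
  have hcast (m : ℕ) (G : ℝ → ℝ) (l : ℕ) :
      (fwdDiff 1)^[m] (fun l : ℕ => G l) l = (fwdDiff 1)^[m] G (l : ℝ) := by
    induction m generalizing G with
    | zero => rfl
    | succ m ih =>
      have e : fwdDiff 1 (fun l : ℕ => G l) = fun l : ℕ => fwdDiff 1 G (l : ℝ) := by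
        funext l
        simp [fwdDiff]
      rw [Function.iterate_succ_apply, Function.iterate_succ_apply, ← ih, e]
  simp only [hcast]
  obtain ⟨L, hL⟩ := exists_nat_gt a
  rw [← summable_nat_add_iff L]
  have hii (u v : ℝ) (hu : a < u) (huv : u ≤ v) :
      IntervalIntegrable (fun s => |F (j + 1) s|) MeasureTheory.volume u v := by
    rw [intervalIntegrable_iff_integrableOn_Ioc_of_le huv]
    exact (hint.mono_set fun s hs => hu.trans hs.1).abs
  have hstep (l : ℕ) : |(fwdDiff 1)^[j + 1] (F 0) ((l + L : ℕ) : ℝ)| ≤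
      ∑ i ∈ Finset.range (j + 1), ∫ s in ((l + L + i : ℕ) : ℝ)..((l + L + (i + 1) : ℕ) : ℝ),
        |F (j + 1) s| := by
    have hl : a < ((l + L : ℕ) : ℝ) := by
      push_cast
      have : (0 : ℝ) ≤ l := Nat.cast_nonneg l
      linarith
    refine (abs_fwdDiff_iterate_le_integral j hF hint hl).trans (le_of_eq ?_)
    have := intervalIntegral.sum_integral_adjacent_intervals (μ := MeasureTheory.volume)
      (f := fun s => |F (j + 1) s|) (a := fun i : ℕ => ((l + L + i : ℕ) : ℝ)) (n := j + 1)
      (fun i _ => hii _ _ (hl.trans_le (by push_cast; linarith [(Nat.cast_nonneg i : (0 : ℝ) ≤ i)]))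
        (by push_cast; linarith))
    rw [this]
    push_cast
    simp
  refine Summable.of_nonneg_of_le (fun _ => abs_nonneg _) hstep (summable_sum fun i _ => ?_)
  refine summable_of_sum_range_le (c := ∫ s in Set.Ioi a, |F (j + 1) s|)
    (fun l => intervalIntegral.integral_nonneg (by push_cast; linarith) fun _ _ => abs_nonneg _)
    fun n => ?_
  have hLi : a < ((0 + L + i : ℕ) : ℝ) := by
    push_cast
    have : (0 : ℝ) ≤ i := Nat.cast_nonneg i
    linarith
  have := intervalIntegral.sum_integral_adjacent_intervals (μ := MeasureTheory.volume)
      (f := fun s => |F (j + 1) s|) (a := fun l : ℕ => ((l + L + i : ℕ) : ℝ)) (n := n)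
      (fun l _ => hii _ _
        (hLi.trans_le (by push_cast; linarith [(Nat.cast_nonneg l : (0 : ℝ) ≤ l)]))
        (by push_cast; linarith))
  have e (l : ℕ) : l + L + (i + 1) = l + 1 + L + i := by ring
  simp only [e]
  rw [this, intervalIntegral.integral_of_le (by
    push_cast; linarith [(Nat.cast_nonneg n : (0 : ℝ) ≤ n)])]
  exact MeasureTheory.setIntegral_mono_set hint.abs
    (Eventually.of_forall fun s => abs_nonneg _)
    (LE.le.eventuallyLE fun s hs => hLi.trans hs.1)

/-- For a regular decay law, `f` is small near `k = π` on all long chains. -/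
lemma RegularDecay.exists_abs_pairingTransform_le {κ : ℝ → ℝ} (h : RegularDecay κ) {η : ℝ}
    (hη : 0 < η) : ∃ δ > 0, ∃ M₀ : ℕ, ∀ M ≥ M₀, ∀ k : ℝ, |k - π| ≤ δ →
      |pairingTransform κ (2 * M) k| ≤ η := by
  obtain ⟨Q, B, hB, hsm, hbd, hint⟩ := h
  obtain ⟨C, hC⟩ := hbd 0 (by omega)
  simp only [iteratedDeriv_zero] at hC
  -- the values at the finitely many joints, at `0` and at `1` are bounded as well
  obtain ⟨C', hC'⟩ : ∃ C' : ℝ, ∀ l : ℕ, |κ l| ≤ C' := by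
    have hfin : (κ '' (B ∪ {0, 1})).Finite := (hB.union (by simp)).image κ
    obtain ⟨C₂, hC₂⟩ := hfin.isBounded.exists_norm_le
    refine ⟨max C C₂, fun l => ?_⟩
    by_cases hl : (l : ℝ) ∈ B ∪ {0, 1}
    · exact (hC₂ _ (Set.mem_image_of_mem κ hl)).trans (le_max_right _ _)
    · simp only [Set.mem_union, Set.mem_insert_iff, Set.mem_singleton_iff, not_or] at hl
      refine (hC l ⟨?_, hl.1⟩).trans (le_max_left _ _)
      have h0 : l ≠ 0 := by exact_mod_cast hl.2.1
      have h1 : l ≠ 1 := by exact_mod_cast hl.2.2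
      have : 1 < l := by omega
      exact Set.mem_Ioi.2 (by exact_mod_cast this)
  obtain ⟨b, hb⟩ := hB.bddAbove
  set a := max 1 b with ha
  have hsub : Set.Ioi a ⊆ Set.Ioi 1 \ B := fun x hx =>
    ⟨(le_max_left 1 b).trans_lt hx, fun hxB => absurd (hb hxB)
      (not_le.2 ((le_max_right 1 b).trans_lt hx))⟩
  have hsm' : ContDiffOn ℝ (2 * Q + 1 : ℕ) κ (Set.Ioi a) := hsm.mono hsub
  have hder : ∀ i < 2 * Q + 1, ∀ x > a,
      HasDerivAt (iteratedDeriv i κ) (iteratedDeriv (i + 1) κ x) x := by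
    intro i hi x hx
    have h1 := (hsm'.differentiableOn_iteratedDerivWithin (m := i) (by exact_mod_cast hi)
      isOpen_Ioi.uniqueDiffOn).differentiableAt (isOpen_Ioi.mem_nhds hx)
    have h2 : iteratedDerivWithin i κ (Set.Ioi a) =ᶠ[nhds x] iteratedDeriv i κ :=
      (iteratedDerivWithin_of_isOpen isOpen_Ioi).eventuallyEq_of_mem (isOpen_Ioi.mem_nhds hx)
    rw [iteratedDeriv_succ]
    exact (h2.differentiableAt_iff.1 h1).hasDerivAt
  have hsumm := summable_abs_fwdDiff_iterate (a := a) (2 * Q) (F := fun i => iteratedDeriv i κ) hder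
    (hint.mono_set (Set.Ioi_subset_Ioi (le_max_left 1 b)))
  simp only [iteratedDeriv_zero] at hsumm
  obtain ⟨δ, hδ, M₀, hM⟩ := exists_abs_sine_sum_le hC' hsumm hη
  refine ⟨δ, hδ, M₀, fun M hMM k hk => ?_⟩
  have h1 := hM M hMM k hk
  rw [pairingTransform, Nat.mul_div_cancel_left M two_pos]
  have h2 : ∑ l ∈ Finset.Ico 1 M, κ l * sin (k * l) = ∑ l ∈ Finset.range M, κ l * sin (k * l) := by
    rcases Nat.eq_zero_or_pos M with rfl | hM0
    · simp
    · rw [Finset.range_eq_Ico, Finset.sum_eq_sum_Ico_succ_bot hM0]; simp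
  rw [h2]
  exact h1

end Smooth

/-! ### Heisenberg scaling for the hopping and the chemical potential -/

/-- Where the pairing is weak compared with `1 / T`, averaging keeps half of a pseudo-spin without
pairing component: either the rotation is slow, or its axis is close to that pseudo-spin. -/
lemma half_le_rotNorm_of_weak_pairing {A B a T : ℝ} (hT : 0 < T) (hB : |B| * T ≤ 1 / 2) :
    T * |a| / 2 ≤ rotNorm A B a 0 T := by
  by_cases h1 : √(A ^ 2 + B ^ 2) * T ≤ 1
  · simpa [Real.sqrt_sq_eq_abs] using half_le_rotNorm (a := a) (b := 0) hT.le h1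
  rw [not_le] at h1
  have he0 : 0 < √(A ^ 2 + B ^ 2) := pos_of_mul_pos_left (one_pos.trans h1) hT.le
  have he2 : √(A ^ 2 + B ^ 2) ^ 2 = A ^ 2 + B ^ 2 := Real.sq_sqrt (by positivity)
  refine le_trans ?_ (le_rotNorm hT.le he0.ne')
  rw [zero_mul, add_zero, abs_mul]
  set e := √(A ^ 2 + B ^ 2)
  have hBe : |B| ≤ e / 2 := by
    refine le_of_mul_le_mul_right ?_ hT
    linarith
  have hA : e / 2 ≤ |A| := by
    have h2 : |B| ^ 2 ≤ (e / 2) ^ 2 := by gcongr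
    rw [sq_abs] at h2
    refine abs_le_of_sq_le_sq' ?_ (abs_nonneg A) |>.2
    rw [sq_abs]
    linarith [sq_nonneg e]
  rw [mul_div_assoc]
  refine mul_le_mul_of_nonneg_left ?_ hT.le
  rw [div_le_div_iff₀ two_pos he0]
  nlinarith [abs_nonneg a]

/-- A fixed fraction of the momenta, those near `π`, contributes at least `T / 4` each. -/
lemma exists_le_sum_modeNorm {κ : ℝ → ℝ} (h : RegularDecay κ) {T : ℝ} (hT : 0 < T)
    (P : Coupling → ℝ) {θ : Coupling} (hθ : θ = J ∨ θ = mu) :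
    ∃ c > 0, ∀ᶠ M : ℕ in atTop, c * ((2 * M : ℕ) : ℝ) ≤
      ∑ n : Fin (2 * M), modeNorm κ (2 * M) T (momentum (2 * M) n) P θ := by
  set d := |P Delta| + 1 with hd
  have hd0 : 0 < d := by positivity
  obtain ⟨δ₀, hδ₀, M₀, hf⟩ := h.exists_abs_pairingTransform_le (η := 1 / (d * T)) (by positivity)
  set δ := min δ₀ (π / 3) with hδ
  have hπ := Real.pi_pos
  have hδpos : 0 < δ := lt_min hδ₀ (by positivity)
  have hmode (M : ℕ) (hM : M₀ ≤ M) (k : ℝ) (hk : |k - π| ≤ δ) :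
      T / 4 ≤ modeNorm κ (2 * M) T k P θ := by
    have hfk := hf M hM k (hk.trans (min_le_left _ _))
    have hgap : |gap κ (2 * M) P k| * T ≤ 1 / 2 := by
      rw [abs_gap]
      have h1 : |P Delta| * |pairingTransform κ (2 * M) k| ≤ d * (1 / (d * T)) :=
        mul_le_mul (by linarith) hfk (abs_nonneg _) hd0.le
      have h2 : d * (1 / (d * T)) * T = 1 := by field_simp
      nlinarith
    have hcos : 1 / 2 ≤ |cos k| := by
      have h1 : cos (π / 3) ≤ cos |k - π| :=
        Real.cos_le_cos_of_nonneg_of_le_pi (abs_nonneg _) (by linarith)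
          (hk.trans (min_le_right _ _))
      rw [Real.cos_pi_div_three, Real.cos_abs, Real.cos_sub_pi] at h1
      rw [le_abs]; right; exact h1
    have hslope : gap κ (2 * M) (Pi.single θ 1) k = 0 ∧ 1 / 2 ≤ |hop (Pi.single θ 1) k| := by
      rcases hθ with rfl | rfl
      · simpa using hcos
      · norm_num
    rw [modeNorm, hslope.1]
    refine le_trans ?_ (half_le_rotNorm_of_weak_pairing hT hgap)
    nlinarith [hslope.2]
  refine ⟨T / 4 * (δ / (4 * π)), by positivity, ?_⟩
  -- the momenta `M, …, M + m - 1` with `m = ⌊M δ / π⌋` lie within `δ` of `π`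
  have hlarge : ∀ᶠ M : ℕ in atTop, 2 * π / δ ≤ M :=
    tendsto_natCast_atTop_atTop.eventually_ge_atTop _
  filter_upwards [eventually_ge_atTop M₀, hlarge, eventually_gt_atTop 0] with M hM hMl hM0
  have hM0' : (0 : ℝ) < M := by exact_mod_cast hM0
  set m := ⌊M * δ / π⌋₊ with hm
  have hmle : (m : ℝ) ≤ M * δ / π := Nat.floor_le (by positivity)
  have hmge : M * δ / (2 * π) ≤ m := by
    have h1 := Nat.lt_floor_add_one (M * δ / π)
    rw [← hm] at h1
    have h2 : 1 ≤ M * δ / (2 * π) := by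
      rw [div_le_iff₀ hδpos] at hMl
      rw [le_div_iff₀ (by positivity)]
      linarith
    have h3 : M * δ / π = 2 * (M * δ / (2 * π)) := by field_simp
    linarith
  have hmM : m ≤ M := by
    have : (m : ℝ) ≤ M := by
      refine hmle.trans ?_
      rw [div_le_iff₀ hπ]
      have : δ ≤ π := (min_le_right _ _).trans (by linarith)
      gcongr
    exact_mod_cast this
  have hnear (i : ℕ) (hi : i < m) : |momentum (2 * M) (M + i) - π| ≤ δ := by
    have hi' : (i : ℝ) + 1 ≤ m := by exact_mod_cast hi
    have e : momentum (2 * M) (M + i) - π = (2 * i + 1) * π / (2 * M) := by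
      unfold momentum; push_cast; field_simp; ring
    rw [e, abs_of_nonneg (by positivity), div_le_iff₀ (by positivity)]
    have h1 := hi'.trans hmle
    rw [le_div_iff₀ hπ] at h1
    nlinarith
  rw [Fin.sum_univ_eq_sum_range (fun n => modeNorm κ (2 * M) T (momentum (2 * M) n) P θ)]
  calc T / 4 * (δ / (4 * π)) * ((2 * M : ℕ) : ℝ) = T / 4 * (M * δ / (2 * π)) := by
        push_cast; field_simp; ring
    _ ≤ T / 4 * m := by gcongr
    _ = ∑ i ∈ Finset.range m, T / 4 := by simp [mul_comm]
    _ ≤ ∑ i ∈ Finset.range m, modeNorm κ (2 * M) T (momentum (2 * M) (M + i)) P θ :=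
      Finset.sum_le_sum fun i hi => hmode M hM _ (hnear i (Finset.mem_range.1 hi))
    _ = ∑ n ∈ Finset.Ico M (M + m), modeNorm κ (2 * M) T (momentum (2 * M) n) P θ := by
      rw [Finset.sum_Ico_eq_sum_range, Nat.add_sub_cancel_left]
    _ ≤ _ := by
      refine Finset.sum_le_sum_of_subset_of_nonneg (fun n hn => ?_)
        fun n _ _ => modeNorm_nonneg ..
      rw [Finset.mem_Ico] at hn
      rw [Finset.mem_range]
      omega

lemma isTheta_qfi {κ : ℝ → ℝ} (h : RegularDecay κ) {T : ℝ} (hT : 0 < T)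
    (p q : Coupling → ℝ) {θ : Coupling} (hθ : θ = J ∨ θ = mu) :
    ((fun M : ℕ => qfi κ (2 * M) T p q θ) =Θ[atTop] fun M : ℕ => ((2 * M : ℕ) : ℝ) ^ 2) ∧
    ((fun M : ℕ => qfi κ (2 * M) T p q θ) =Θ[atTop] fun M : ℕ => optimalQFI κ (2 * M) T p θ) := by
  obtain ⟨c, hc, hlow⟩ := exists_le_sum_modeNorm h hT (p + q) hθ
  have hle : ∀ᶠ M : ℕ in atTop, qfi κ (2 * M) T p q θ ≤ optimalQFI κ (2 * M) T p θ := by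
    filter_upwards [eventually_gt_atTop 0] with M hM
    exact qfi_le_optimalQFI (even_two_mul M) (by omega) hT.le p q θ
  have hslope (N : ℕ) (k : ℝ) : slopeNorm κ N k θ ≤ 1 := by
    rcases hθ with rfl | rfl
    · rw [slopeNorm_J]; exact Real.abs_cos_le_one k
    · rw [slopeNorm_mu]
  have hopt : ∀ᶠ M : ℕ in atTop, optimalQFI κ (2 * M) T p θ ≤ T ^ 2 * ((2 * M : ℕ) : ℝ) ^ 2 := by
    filter_upwards [eventually_gt_atTop 0] with M hM
    rw [optimalQFI_eq κ (even_two_mul M) (by omega), ← mul_pow]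
    refine pow_le_pow_left₀ (Finset.sum_nonneg fun n _ =>
      mul_nonneg hT.le (Real.sqrt_nonneg _)) ?_ 2
    calc _ ≤ ∑ n : Fin (2 * M), T :=
          Finset.sum_le_sum fun n _ => mul_le_of_le_one_right hT.le (hslope _ _)
      _ = _ := by simp [mul_comm]
  have hqfi : ∀ᶠ M : ℕ in atTop, c ^ 2 * ((2 * M : ℕ) : ℝ) ^ 2 ≤ qfi κ (2 * M) T p q θ := by
    filter_upwards [eventually_gt_atTop 0, hlow] with M hM hl
    rw [qfi_eq κ (even_two_mul M) (by omega), ← mul_pow]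
    exact pow_le_pow_left₀ (by positivity) hl 2
  have hnn : ∀ᶠ M : ℕ in atTop, 0 ≤ qfi κ (2 * M) T p q θ := by
    filter_upwards [hqfi] with M hM
    exact le_trans (by positivity) hM
  have hO1 : (fun M : ℕ => ((2 * M : ℕ) : ℝ) ^ 2) =O[atTop] fun M : ℕ => qfi κ (2 * M) T p q θ := by
    refine IsBigO.of_bound (c ^ 2)⁻¹ ?_
    filter_upwards [hqfi, hnn] with M hM h0
    rw [Real.norm_of_nonneg (sq_nonneg _), Real.norm_of_nonneg h0, inv_mul_eq_div,
      le_div_iff₀ (by positivity)]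
    linarith
  have hO2 : (fun M : ℕ => optimalQFI κ (2 * M) T p θ) =O[atTop]
      fun M : ℕ => ((2 * M : ℕ) : ℝ) ^ 2 := by
    refine IsBigO.of_bound (T ^ 2) ?_
    filter_upwards [hopt, hle, hnn] with M hM h1 h0
    rw [Real.norm_of_nonneg (h0.trans h1), Real.norm_of_nonneg (sq_nonneg _)]
    exact hM
  have hO3 : (fun M : ℕ => qfi κ (2 * M) T p q θ) =O[atTop]
      fun M : ℕ => optimalQFI κ (2 * M) T p θ := by
    refine IsBigO.of_bound 1 ?_
    filter_upwards [hle, hnn] with M hM h0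
    rw [Real.norm_of_nonneg h0, Real.norm_of_nonneg (h0.trans hM), one_mul]
    exact hM
  exact ⟨⟨hO3.trans hO2, hO1⟩, ⟨hO3, hO2.trans hO1⟩⟩

end LRK

theorem mainTheorem7 (p q : Coupling → ℝ) (hpair : (p + q) Delta ≠ 0) :
    -- diagonalization of the generator and the formula for the quantum Fisher information
    (∀ (κ : ℝ → ℝ) (N : ℕ) (T : ℝ), Even N → 0 < N → 0 < T →
      (∀ n ∈ Finset.range N, energy κ N (momentum N n) (p + q) ≠ 0) → ∀ θ : Coupling,
        (∃ ψ : Fin N → Op N, IsBogoliubov ψ ∧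
          chainGenerator κ N T p q θ = ∑ n : Fin N,
            genSpectrum κ N T (momentum N n) (p + q) θ •
              ((ψ n)ᴴ * ψ n - (1 / 2 : ℝ) • (1 : Op N))) ∧
        IsGreatest (fisherValues (chainGenerator κ N T p q θ))
          ((∑ n ∈ Finset.range N, genSpectrum κ N T (momentum N n) (p + q) θ) ^ 2) ∧
        qfi κ N T p q θ =
          (∑ n ∈ Finset.range N, genSpectrum κ N T (momentum N n) (p + q) θ) ^ 2) ∧
    -- explicit form of the ingredients of the spectrum
    (∀ (κ : ℝ → ℝ) (N : ℕ) (k : ℝ), energy κ N k (p + q) ≠ 0 →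
      partialDeriv J (energy κ N k) (p + q) =
        cos k * ((p + q) J * cos k + (p + q) mu) / energy κ N k (p + q) ∧
      partialDeriv mu (energy κ N k) (p + q) =
        ((p + q) J * cos k + (p + q) mu) / energy κ N k (p + q) ∧
      partialDeriv Delta (energy κ N k) (p + q) =
        (p + q) Delta * pairingTransform κ N k ^ 2 / (4 * energy κ N k (p + q)) ∧
      xi κ N k (p + q) J =
        (p + q) Delta * pairingTransform κ N k * cos k / (2 * energy κ N k (p + q) ^ 2) ∧
      xi κ N k (p + q) mu =
        (p + q) Delta * pairingTransform κ N k / (2 * energy κ N k (p + q) ^ 2) ∧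
      xi κ N k (p + q) Delta =
        -((p + q) J * cos k + (p + q) mu) * pairingTransform κ N k /
          (2 * energy κ N k (p + q) ^ 2)) ∧
    -- the spectrum does not blow up for `J` and `mu`, and does so at most like `f` for `Delta`
    (∀ (κ : ℝ → ℝ) (N : ℕ) (T k : ℝ), 0 < T → energy κ N k (p + q) ≠ 0 →
      genSpectrum κ N T k (p + q) J ≤ T * |cos k| ∧
      genSpectrum κ N T k (p + q) mu ≤ T ∧
      genSpectrum κ N T k (p + q) Delta ≤ T * |pairingTransform κ N k| / 2) ∧
    -- optimal control never decreases the quantum Fisher information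
    (∀ (κ : ℝ → ℝ) (N : ℕ) (T : ℝ), Even N → 0 < N → 0 < T → ∀ θ : Coupling,
      qfi κ N T p q θ ≤ optimalQFI κ N T p θ) ∧
    -- Heisenberg scaling for `J` and `mu`, as under optimal control
    (∀ (κ : ℝ → ℝ) (T : ℝ), RegularDecay κ → 0 < T → ∀ θ : Coupling, θ = J ∨ θ = mu →
      ((fun M : ℕ => qfi κ (2 * M) T p q θ) =Θ[atTop] fun M : ℕ => ((2 * M : ℕ) : ℝ) ^ 2) ∧
      ((fun M : ℕ => qfi κ (2 * M) T p q θ) =Θ[atTop]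
        fun M : ℕ => optimalQFI κ (2 * M) T p θ)) ∧
    -- where `f` diverges, the spectrum for `Delta` diverges in the same way
    (∀ T : ℝ, 0 < T → ∀ δ : ℝ, 0 < δ → ∃ R : ℝ, ∀ (κ : ℝ → ℝ) (N : ℕ) (k : ℝ),
      R ≤ |pairingTransform κ N k| →
        |xi κ N k (p + q) Delta| ≤ δ ∧
        |partialDeriv Delta (energy κ N k) (p + q) / |pairingTransform κ N k|
          - SignType.sign ((p + q) Delta) / 2| ≤ δ ∧
        |genSpectrum κ N T k (p + q) Delta / |pairingTransform κ N k| - T / 2| ≤ δ) ∧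
    -- the scaling for `Delta` is the one under optimal control, up to the prefactor
    (∃ c : ℝ, 0 < c ∧ ∀ (κ : ℝ → ℝ) (N : ℕ) (T : ℝ), κ 1 = 1 → Even N → 0 < N → 0 < T →
      c * optimalQFI κ N T p Delta ≤ qfi κ N T p q Delta) := by
  refine ⟨fun κ N T he hN hT henergy θ => ?_, fun κ N k he => ?_, fun κ N T k hT he => ?_,
    fun κ N T he hN hT θ => qfi_le_optimalQFI he hN hT.le p q θ,
    fun κ T hκ hT θ hθ => isTheta_qfi hκ hT p q hθ,
    fun T hT δ hδ => divergence_bound hpair hT hδ, exists_mul_optimalQFI_le hpair⟩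
  · have hmode (n : Fin N) : modeNorm κ N T (momentum N n) (p + q) θ =
        genSpectrum κ N T (momentum N n) (p + q) θ :=
      (genSpectrum_eq_modeNorm hpair (henergy n (Finset.mem_range.2 n.2)) T θ).symm
    have hsum : ∑ n : Fin N, modeNorm κ N T (momentum N n) (p + q) θ =
        ∑ n ∈ Finset.range N, genSpectrum κ N T (momentum N n) (p + q) θ := by
      rw [← Fin.sum_univ_eq_sum_range (fun n => genSpectrum κ N T (momentum N n) (p + q) θ)]
      exact Finset.sum_congr rfl fun n _ => hmode n
    refine ⟨?_, hsum ▸ isGreatest_fisherValues_chain κ he hN T p q θ, hsum ▸ qfi_eq κ he hN T p q θ⟩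
    obtain ⟨ψ, hψ, hG⟩ := exists_bogoliubov_chainGenerator κ he hN T p q θ
    refine ⟨ψ, hψ, ?_⟩
    rw [hG, freeOp]
    exact Finset.sum_congr rfl fun n _ => by rw [hmode]
  · refine ⟨?_, ?_, ?_, ?_, ?_, ?_⟩
    · rw [partialDeriv_energy he]; simp [hop]
    · rw [partialDeriv_energy he]; simp [hop]
    · rw [partialDeriv_energy he, hop_single_Delta, gap_single_Delta, gap]; ring
    · rw [xi_eq hpair he, hop_single_J, gap_single_J, gap]; ring
    · rw [xi_eq hpair he, hop_single_mu, gap_single_mu, gap]; ring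
    · rw [xi_eq hpair he, hop_single_Delta, gap_single_Delta, hop]; ring
  · simp only [genSpectrum_eq_modeNorm hpair he]
    refine ⟨?_, ?_, ?_⟩
    · rw [← slopeNorm_J κ N k]; exact modeNorm_le _ _ _ hT.le _ _
    · simpa [slopeNorm_mu] using modeNorm_le κ N k hT.le (p + q) mu
    · rw [mul_div_assoc, ← slopeNorm_Delta]; exact modeNorm_le _ _ _ hT.le _ _
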